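/- Let $N\ge 1$, $a<b$, $I=[a,b]$, $|I|=b-a$. Let $G\colon\mathbb R^N\to[0,\infty)$ be a continuously differentiable G-function, i.e. $G$ is convex, even, $G(0)=0$ and $G(x)/|x|\to\infty$ as $|x|\to\infty$. Assume that $G$ satisfies the conditions $\Delta_2$ and $\nabla_2$ at infinity: there are $K_1,M_1$ with $G(2x)\le K_1G(x)$ for $|x|\ge M_1$, and there are $K_2>1$ and $M_2$ with $G(x)\le\frac1{2K_2}G(K_2x)$ for $|x|\ge M_2$. Let $G^*(y)=\sup_x(\langle x,y\rangle-G(x))$ be the convex conjugate. For $H\in\{G,G^*\}$ let $L^H$ be the set of measurable $u\colon I\to\mathbb R^N$ with $\int_I H(u)\,dt<\infty$, with the Luxemburg norm $\|u\|_{L^H}=\inf\{\lambda>0:\int_I H(u/\lambda)\,dt\le1\}$. Let $W_0^1L^G$ be the space of absolutely continuous $u\colon I\to\mathbb R^N$ with $u,\dot u\in L^G$ and $u(a)=u(b)=0$, with the norm $\|\dot u\|_{L^G}$, and let $C_{\infty,G}$ be an embedding constant of $W_0^1L^G$ into $L^\infty$, i.e. $\|u\|_{L^\infty}\le C_{\infty,G}\|\dot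 u\|_{L^G}$ for all $u\in W_0^1L^G$. Let $F\colon I\times\mathbb R^N\times\mathbb R^N\to\mathbb R$ and $V\colon I\times\mathbb R^N\to\mathbb R$ be of class $C^1$ and $f\in L^{G^*}$. Assume that, for all $t\in I$ and $x,v\in\mathbb R^N$, - (F1) $F(t,x,\cdot)$ is convex; - (F2) $|F(t,x,v)|\le\alpha(|x|)(\beta(t)+G(v))$, $|F_x(t,x,v)|\le\alpha(|x|)(\beta(t)+G(v))$ and $G^*(F_v(t,x,v))\le\alpha(|x|)(\beta(t)+G^*(\nabla G(v)))$, for some continuous $\alpha\colon[0,\infty)\to[0,\infty)$ and some integrable $\beta\colon I\to[0,\infty)$; - (F3) $\langle F_x(t,x,v),x\rangle+\langle F_v(t,x,v),v\rangle\le\theta_F F(t,x,v)$, for some constant $\theta_F>0$; - (F4) $F(t,x,v)\ge\Lambda G(v)$, for some constant $\Lambda>0$; - (F5) $F(t,x,0)=0$; - (V1) $\langle\nabla V(t,x),x\rangle\le\theta_V V(t,x)$ whenever $|x|\ge r_0$, for some constants $\theta_V>1$, $\theta_V>\theta_F$ and $r_0>0$ (here $\nabla V$ is the gradient in $x$); -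 (V2) $\int_I V(t,0)\,dt=0$; - (V3) $V(t,x)\ge-g(t)$ whenever $|x|\le\rho_0$, for some constant $\rho_0>0$ and some integrable $g\colon I\to\mathbb R$; - (V4) $V(t,x)<0$ whenever $|x|\ge r_0$. If $\rho_0\ge C_{\infty,G}$ and $$\int_I g(t)\,dt<\bigl(\Lambda-2|I|\,\|f\|_{L^{G^*}}\bigr)\frac{\rho_0}{C_{\infty,G}},$$ then, with $\mathcal L(t,x,v)=F(t,x,v)+V(t,x)+\langle f(t),x\rangle$, the problem $$\frac{d}{dt}\mathcal L_v(t,u(t),\dot u(t))=\mathcal L_x(t,u(t),\dot u(t))\ \text{ for a.e. }t\in I,\qquad u(a)=u(b)=0$$ has at least one solution $u\in W_0^1L^G$ with $u\not\equiv0$. (That is, $t\mapsto\mathcal L_v(t,u(t),\dot u(t))$ agrees a.e. with an absolutely continuous function whose derivative is $\mathcal L_x(t,u(t),\dot u(t))$ for a.e. $t\in I$.) -/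

import Mathlib

open Set Filter Topology MeasureTheory

noncomputable section

namespace OrliczELT

/-- `G` is a continuously differentiable (anisotropic) G-function on `ℝ^N`. -/
structure IsGFunction {N : ℕ} (G : EuclideanSpace ℝ (Fin N) → ℝ) : Prop where
  contDiff : ContDiff ℝ 1 G
  nonneg : ∀ x, 0 ≤ G x
  convex : ConvexOn ℝ univ G
  even : ∀ x, G (-x) = G x
  zero : G 0 = 0
  superlinear : Tendsto (fun x => G x / ‖x‖) (cocompact (EuclideanSpace ℝ (Fin N))) atTop

/-- The `Δ₂` condition at infinity. -/
def DeltaTwoAtInfinity {N : ℕ} (G : EuclideanSpace ℝ (Fin N) → ℝ) : Prop :=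
  ∃ K M : ℝ, ∀ x, M ≤ ‖x‖ → G ((2 : ℝ) • x) ≤ K * G x

/-- The `∇₂` condition at infinity. -/
def NablaTwoAtInfinity {N : ℕ} (G : EuclideanSpace ℝ (Fin N) → ℝ) : Prop :=
  ∃ K M : ℝ, 1 < K ∧ ∀ x, M ≤ ‖x‖ → G x ≤ (1 / (2 * K)) * G (K • x)

/-- The convex conjugate `G^*(y) = sup_x (⟨x, y⟩ - G x)`. The supremum is finite for every
G-function, because a G-function is continuous and superlinear. -/
def conjugate {N : ℕ} (G : EuclideanSpace ℝ (Fin N) → ℝ) (y : EuclideanSpace ℝ (Fin N)) : ℝ :=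
  ⨆ x : EuclideanSpace ℝ (Fin N), (inner ℝ x y - G x)

/-- The Orlicz space `L^G([a,b], ℝ^N)`: measurable functions with finite modular. -/
def MemOrlicz {N : ℕ} (G : EuclideanSpace ℝ (Fin N) → ℝ) (a b : ℝ)
    (u : ℝ → EuclideanSpace ℝ (Fin N)) : Prop :=
  AEStronglyMeasurable u (volume.restrict (Icc a b)) ∧
    IntegrableOn (fun t => G (u t)) (Icc a b)

/-- The Luxemburg norm `inf {l > 0 : ∫_a^b G(u/l) dt ≤ 1}`. -/
def luxNorm {N : ℕ} (G : EuclideanSpace ℝ (Fin N) → ℝ) (a b : ℝ)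
    (u : ℝ → EuclideanSpace ℝ (Fin N)) : ℝ :=
  sInf {l : ℝ | 0 < l ∧ ∫⁻ t in Icc a b, ENNReal.ofReal (G (l⁻¹ • u t)) ≤ 1}

/-- The anisotropic Orlicz–Sobolev space `W^1 L^G([a,b], ℝ^N)`: the absolutely continuous
(representatives of) functions in `L^G` whose almost everywhere defined derivative is in `L^G`. -/
def MemOrliczSobolev {N : ℕ} (G : EuclideanSpace ℝ (Fin N) → ℝ) (a b : ℝ)
    (u : ℝ → EuclideanSpace ℝ (Fin N)) : Prop :=
  AbsolutelyContinuousOnInterval u a b ∧ MemOrlicz G a b u ∧ MemOrlicz G a b (deriv u)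

/-- The subspace `W_0^1 L^G([a,b], ℝ^N)` of functions vanishing at both end points. -/
def MemOrliczSobolevZero {N : ℕ} (G : EuclideanSpace ℝ (Fin N) → ℝ) (a b : ℝ)
    (u : ℝ → EuclideanSpace ℝ (Fin N)) : Prop :=
  MemOrliczSobolev G a b u ∧ u a = 0 ∧ u b = 0

/-- `C` is an embedding constant of `W_0^1 L^G`, with the norm `‖u'‖_{L^G}`, into `L^∞`.
The functions are continuous, so their `L^∞` norm is a supremum over all points. -/
def IsEmbeddingConstant {N : ℕ} (G : EuclideanSpace ℝ (Fin N) → ℝ) (a b C : ℝ) : Prop :=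
  ∀ u : ℝ → EuclideanSpace ℝ (Fin N), MemOrliczSobolevZero G a b u →
    ∀ t ∈ Icc a b, ‖u t‖ ≤ C * luxNorm G a b (deriv u)

/-- The Lagrangian `L(t,x,v) = F(t,x,v) + V(t,x) + ⟨f(t), x⟩`. -/
def lagrangian {N : ℕ}
    (F : ℝ → EuclideanSpace ℝ (Fin N) → EuclideanSpace ℝ (Fin N) → ℝ)
    (V : ℝ → EuclideanSpace ℝ (Fin N) → ℝ) (f : ℝ → EuclideanSpace ℝ (Fin N))
    (t : ℝ) (x v : EuclideanSpace ℝ (Fin N)) : ℝ :=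
  F t x v + V t x + inner ℝ (f t) x

/-- `u ∈ W_0^1 L^G` solves `d/dt L_v(t,u,u') = L_x(t,u,u')` a.e. on `[a,b]`, `u(a) = u(b) = 0`.
As `u'` is only defined almost everywhere, so is `t ↦ L_v(t,u,u')`; its derivative is that of an
absolutely continuous representative `p`. -/
def IsSolutionELT {N : ℕ} (G : EuclideanSpace ℝ (Fin N) → ℝ) (a b : ℝ)
    (L : ℝ → EuclideanSpace ℝ (Fin N) → EuclideanSpace ℝ (Fin N) → ℝ)
    (u : ℝ → EuclideanSpace ℝ (Fin N)) : Prop :=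
  MemOrliczSobolevZero G a b u ∧
    ∃ p : ℝ → EuclideanSpace ℝ (Fin N), AbsolutelyContinuousOnInterval p a b ∧
      (∀ᵐ t ∂(volume.restrict (Icc a b)),
        p t = gradient (fun v => L t (u t) v) (deriv u t)) ∧
      (∀ᵐ t ∂(volume.restrict (Icc a b)),
        HasDerivAt p (gradient (fun x => L t x (deriv u t)) (u t)) t)

end OrliczELT

end

noncomputable section

namespace OrliczELT

section

/-! ### Ekeland's principle and the mountain pass theorem -/

/-! Solutions are critical points of J(u) = ∫ F(t,u,u') + V(t,u) + ⟨f,u⟩ on curves vanishing at both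
ends, and J has a mountain pass geometry. Put R = ρ₀/C ≥ 1. On the ridge ∫ G(u'/R) = 1 the embedding
gives |u| ≤ ρ₀, so (V3) applies. Convexity of G and (F4) give ∫ F ≥ ΛR, and the inequalities of
Jensen and Young bound the forcing term from below by −2|I|R‖f‖. Hence J ≥ γ₀ > 0 on the ridge
(`IsKinetic.le_energy_of_modular_eq_one`). On the other hand J(0) = 0, and along a suitable ray the
potential falls like −s^θV, which beats the growth s^θF of the kinetic part and the linear growth of
the forcing, so J is nonpositive somewhere beyond the ridge (`IsKinetic.exists_energy_nonpos`).

The minimax argument is carried out on finite dimensional spaces of polynomial velocities of mean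
zero, where J is C¹. Ekeland's principle on the space of paths gives velocities w_m whose level lies
in [γ₀, κ] and whose derivative is at most 1/(m+1) relative to the L¹ norm of the test velocity. In
θ_V J(u) − J'(u)u, conditions (F3), (F4) and (V1) leave a positive multiple of ∫ G(w_m) up to lower
order terms, so the modulars are bounded (`IsKinetic.exists_modular_bound`).

Superlinearity of G makes the primitives of the w_m converge uniformly and the w_m converge weakly
along a subsequence (`exists_weak_limit`). The difficulty is the nonlinear dependence on the
velocity. Testing with z − w_m, where z is a polynomial approximation of the limit velocity, and
using convexity in v shows that the kinetic energies do not exceed that of the limit in the limit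
(`IsKinetic.eventually_kin_le_of_almost_critical`). This excludes concentration: the gap between F
and a tangent minorant dominates G at large velocities, so the G(w_m) are uniformly integrable
(`IsKinetic.exists_level_energy_le`). First order expansions then have uniformly small remainders,
and lower semicontinuity of the shifted energies shows that the first variation of the limit is
nonpositive in every admissible direction, hence zero (`IsKinetic.first_variation_le`).

The same energy comparison keeps the level of the limit at least γ₀ > 0 = J(0), so the limit is not
zero. The lemma of du Bois-Reymond turns the weak equation into the Euler–Lagrange equation. -/

/-- A weak form of Ekeland's variational principle. -/
theorem exists_ekeland_point {X : Type*} [MetricSpace X] [CompleteSpace X] {Φ : X → ℝ}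
    (hΦ : Continuous Φ) (hb : BddBelow (range Φ)) (x₀ : X) {ε : ℝ} (hε : 0 < ε) :
    ∃ x, Φ x ≤ Φ x₀ ∧ ∀ y, Φ x ≤ Φ y + ε * dist x y := by
  -- `S x` collects the points below `x` in Ekeland's order. The sequence below always moves to an
  -- almost minimizer of Φ on the current set; these sets are nested because the order is
  -- transitive.
  let S : X → Set X := fun x => {y | Φ y + ε * dist x y ≤ Φ x}
  have hS : ∀ x, x ∈ S x := fun x => by simp [S]
  have hbS : ∀ x, BddBelow (Φ '' S x) := fun x => hb.mono (image_subset_range _ _)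
  have hex : ∀ (n : ℕ) (x : X), ∃ y ∈ S x, Φ y < sInf (Φ '' S x) + 1 / ((n : ℝ) + 1) := by
    intro n x
    obtain ⟨_, ⟨y, hy, rfl⟩, hlt⟩ := exists_lt_of_csInf_lt (s := Φ '' S x)
      ⟨_, mem_image_of_mem _ (hS x)⟩
      (show sInf (Φ '' S x) < sInf (Φ '' S x) + 1 / ((n : ℝ) + 1) from
        lt_add_of_pos_right _ Nat.one_div_pos_of_nat)
    exact ⟨y, hy, hlt⟩
  choose nxt hnS hnlt using hex
  let x : ℕ → X := fun n => Nat.rec x₀ (fun k y => nxt k y) n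
  have hx : ∀ n, x (n + 1) = nxt n (x n) := fun n => rfl
  have htrans : ∀ {p q r : X}, q ∈ S p → r ∈ S q → r ∈ S p := by
    intro p q r h1 h2
    simp only [S, mem_ofPred_eq] at *
    have := mul_le_mul_of_nonneg_left (dist_triangle p q r) hε.le
    linarith
  have hmem : ∀ n k, x (n + k) ∈ S (x n) := by
    intro n k
    induction k with
    | zero => exact hS _
    | succ k ih => exact htrans ih (by rw [← add_assoc, hx]; exact hnS _ _)
  have hanti : Antitone fun n => Φ (x n) := by
    refine antitone_nat_of_succ_le fun n => ?_
    have h : Φ (x (n + 1)) + ε * dist (x n) (x (n + 1)) ≤ Φ (x n) := hmem n 1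
    have : 0 ≤ ε * dist (x n) (x (n + 1)) := by positivity
    linarith
  have hlim := tendsto_atTop_ciInf hanti (hb.mono (by rintro _ ⟨n, rfl⟩; exact ⟨_, rfl⟩))
  have hcau : CauchySeq x := by
    rw [Metric.cauchySeq_iff']
    intro δ hδ
    obtain ⟨n, hn⟩ := Metric.cauchySeq_iff'.1 hlim.cauchySeq (ε * δ) (by positivity)
    refine ⟨n, fun k hk => ?_⟩
    obtain ⟨j, rfl⟩ := Nat.exists_eq_add_of_le hk
    have h : Φ (x (n + j)) + ε * dist (x n) (x (n + j)) ≤ Φ (x n) := hmem n j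
    have h2 := hn _ hk
    rw [Real.dist_eq, abs_lt] at h2
    rw [dist_comm]
    have : ε * dist (x n) (x (n + j)) < ε * δ := by linarith
    exact lt_of_mul_lt_mul_left this hε.le
  obtain ⟨z, hz⟩ := cauchySeq_tendsto_of_complete hcau
  have hzS : ∀ n, z ∈ S (x n) := by
    intro n
    have hc : IsClosed (S (x n)) :=
      isClosed_le (hΦ.add ((continuous_const.dist continuous_id).const_mul ε)) continuous_const
    refine hc.mem_of_tendsto hz ?_
    filter_upwards [eventually_ge_atTop n] with k hk
    obtain ⟨j, rfl⟩ := Nat.exists_eq_add_of_le hk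
    exact hmem n j
  refine ⟨z, ?_, fun y => ?_⟩
  · have h : Φ z + ε * dist x₀ z ≤ Φ x₀ := hzS 0
    have : 0 ≤ ε * dist x₀ z := by positivity
    linarith
  -- A violating `y` lies below the limit `z`, hence in every `S (x n)`. As `x (n + 1)` almost
  -- minimizes Φ there, Φ z ≤ Φ y, which is incompatible with the strict violation.
  · by_contra! hlt
    have hyS : y ∈ S z := hlt.le
    have hle : Φ z ≤ Φ y := by
      have h1 : Tendsto (fun n => Φ (x (n + 1)) - 1 / ((n : ℝ) + 1)) atTop (𝓝 (Φ z - 0)) :=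
        (((hΦ.tendsto z).comp hz).comp (tendsto_add_atTop_nat 1)).sub
          tendsto_one_div_add_atTop_nhds_zero_nat
      rw [sub_zero] at h1
      refine le_of_tendsto' h1 fun n => ?_
      have h2 : sInf (Φ '' S (x n)) ≤ Φ y :=
        csInf_le (hbS _) (mem_image_of_mem _ (htrans (hzS n) hyS))
      have h3 := hnlt n (x n)
      rw [← hx] at h3
      linarith
    have : 0 ≤ ε * dist z y := by positivity
    linarith

/-- The mountain pass principle without compactness: almost critical points at levels between the
height of the mountain range and the height of the straight path. -/
theorem exists_almost_critical_of_mountain_pass {H : Type*} [NormedAddCommGroup H]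
    [InnerProductSpace ℝ H] [CompleteSpace H] {J : H → ℝ} {DJ : H → H}
    (hJ : ∀ x, HasStrictFDerivAt J (innerSL ℝ (DJ x)) x) (hDJ : Continuous DJ)
    {e : H} (h0 : J 0 ≤ 0) (he : J e ≤ 0) {γ₀ κ : ℝ} (hγ₀ : 0 < γ₀)
    (hridge : ∀ p : C(unitInterval, H), p 0 = 0 → p 1 = e → ∃ t, γ₀ ≤ J (p t))
    (hκ : ∀ s ∈ Icc (0 : ℝ) 1, J (s • e) ≤ κ) {ε : ℝ} (hε : 0 < ε) :
    ∃ x, γ₀ ≤ J x ∧ J x ≤ κ ∧ ‖DJ x‖ ≤ ε := by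
  have hJc : Continuous J := continuous_iff_continuousAt.2 fun x => (hJ x).continuousAt
  -- Paths with fixed end points form a closed subset of a complete space; Ekeland's principle is
  -- applied there to the maximum of J along the path.
  let X := {p : C(unitInterval, H) // p 0 = 0 ∧ p 1 = e}
  have hXc : IsClosed {p : C(unitInterval, H) | p 0 = 0 ∧ p 1 = e} :=
    (isClosed_eq (continuous_eval_const 0) continuous_const).inter
      (isClosed_eq (continuous_eval_const 1) continuous_const)
  have : CompleteSpace X := hXc.completeSpace_coe
  let Φ : X → ℝ := fun p => sSup ((fun t => J (p.1 t)) '' univ)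
  have hΦc : Continuous Φ := by
    refine isCompact_univ.continuous_sSup (f := fun (p : X) (t : unitInterval) => J (p.1 t)) ?_
    change Continuous fun q : X × unitInterval => J (q.1.1 q.2)
    exact hJc.comp ((continuous_subtype_val.comp continuous_fst).eval continuous_snd)
  have hcomp : ∀ p : X, Continuous fun t => J (p.1 t) := fun p => hJc.comp p.1.continuous
  have hbdd : ∀ p : X, BddAbove ((fun t => J (p.1 t)) '' univ) := fun p =>
    (isCompact_univ.image (hcomp p)).bddAbove
  have hle : ∀ (p : X) t, J (p.1 t) ≤ Φ p := fun p t =>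
    le_csSup (hbdd p) (mem_image_of_mem _ (mem_univ t))
  have hmax : ∀ p : X, ∃ t, Φ p = J (p.1 t) := by
    intro p
    obtain ⟨t, -, ht⟩ := isCompact_univ.exists_sSup_image_eq univ_nonempty (hcomp p).continuousOn
    exact ⟨t, ht⟩
  have hΦge : ∀ p : X, γ₀ ≤ Φ p := fun p => by
    obtain ⟨t, ht⟩ := hridge p.1 p.2.1 p.2.2
    exact ht.trans (hle p t)
  let p₀ : X := ⟨⟨fun t => (t : ℝ) • e, by fun_prop⟩, by simp, by simp⟩
  have hp₀ : Φ p₀ ≤ κ := by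
    obtain ⟨t, ht⟩ := hmax p₀
    rw [ht]
    exact hκ t t.2
  obtain ⟨p, hpp₀, hp⟩ := exists_ekeland_point hΦc
    ⟨γ₀, by rintro _ ⟨q, rfl⟩; exact hΦge q⟩ p₀ hε
  -- The cut-off vanishes where J ≤ 0, so deformation along `w` fixes both end points, and equals 1
  -- where J ≥ γ₀. The denominator `max ε ‖DJ x‖` keeps `w` continuous at zeros of the gradient and
  -- of norm at most 1.
  let η : H → ℝ := fun x => min 1 (max 0 (J x / γ₀))
  have hη : Continuous η := by fun_prop
  let w : H → H := fun x => (η x / max ε ‖DJ x‖) • DJ x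
  have hmε : ∀ x, 0 < max ε ‖DJ x‖ := fun x => lt_max_of_lt_left hε
  have hw : Continuous w :=
    ((hη.div (continuous_const.max hDJ.norm) fun x => (hmε x).ne')).smul hDJ
  have hη0 : ∀ x, J x ≤ 0 → η x = 0 := by
    intro x hx
    have : J x / γ₀ ≤ 0 := div_nonpos_of_nonpos_of_nonneg hx hγ₀.le
    simp [η, max_eq_left this]
  have hη1 : ∀ x, γ₀ ≤ J x → η x = 1 := by
    intro x hx
    have : 1 ≤ J x / γ₀ := (one_le_div hγ₀).2 hx
    simp [η, this]
  have hwn : ∀ x, ‖w x‖ ≤ 1 := by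
    intro x
    have hη0' : 0 ≤ η x := le_min zero_le_one (le_max_left _ _)
    have hη1' : η x ≤ 1 := min_le_left _ _
    rw [norm_smul, Real.norm_of_nonneg (div_nonneg hη0' (hmε x).le), div_mul_eq_mul_div,
      div_le_one (hmε x)]
    calc η x * ‖DJ x‖ ≤ 1 * ‖DJ x‖ := by gcongr
      _ ≤ _ := by rw [one_mul]; exact le_max_right _ _
  let h : ℕ → ℝ := fun n => 1 / ((n : ℝ) + 1)
  have hh : ∀ n, 0 < h n := fun n => Nat.one_div_pos_of_nat
  have hh0 : Tendsto h atTop (𝓝 0) := tendsto_one_div_add_atTop_nhds_zero_nat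
  -- The Ekeland path pushed down by `h n` along `w`, at distance at most `h n` from it.
  let q : ℕ → X := fun n => ⟨⟨fun t => p.1 t - h n • w (p.1 t),
    p.1.continuous.sub ((hw.comp p.1.continuous).const_smul (h n))⟩, by
    have : w 0 = 0 := by simp [w, hη0 0 h0]
    simp [p.2.1, this], by
    have : w e = 0 := by simp [w, hη0 e he]
    simp [p.2.2, this]⟩
  have hdist : ∀ n, dist p (q n) ≤ h n := by
    intro n
    change dist p.1 (q n).1 ≤ h n
    refine (ContinuousMap.dist_le (hh n).le).2 fun t => ?_
    change dist (p.1 t) (p.1 t - h n • w (p.1 t)) ≤ h n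
    rw [dist_eq_norm, sub_sub_cancel, norm_smul, Real.norm_of_nonneg (hh n).le]
    exact mul_le_of_le_one_right (hh n).le (hwn _)
  -- Maximum points of J along the pushed paths. They accumulate at some `t`, and since pushing
  -- lowers the maximum by at most ε·h, this `t` turns out to be a maximum point along the original
  -- path.
  choose τ hτ using fun n => hmax (q n)
  obtain ⟨t, -, σ, hσ, hσt⟩ := isCompact_univ.tendsto_subseq (x := τ) fun n => mem_univ _
  have hσa := hσ.tendsto_atTop
  have hhσ : Tendsto (fun n => h (σ n)) atTop (𝓝 0) := hh0.comp hσa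
  let y : ℕ → H := fun n => p.1 (τ (σ n))
  have hy : Tendsto y atTop (𝓝 (p.1 t)) := (p.1.continuous.tendsto t).comp hσt
  have hwy : Tendsto (fun n => w (y n)) atTop (𝓝 (w (p.1 t))) := (hw.tendsto _).comp hy
  have hy' : Tendsto (fun n => y n - h (σ n) • w (y n)) atTop (𝓝 (p.1 t)) := by
    simpa using hy.sub (hhσ.smul hwy)
  have hkey : ∀ n, J (y n) - ε * h (σ n) ≤ J (y n - h (σ n) • w (y n)) := by
    intro n
    have h1 := hp (q (σ n))
    have h2 : Φ (q (σ n)) = J (y n - h (σ n) • w (y n)) := hτ (σ n)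
    have h3 := mul_le_mul_of_nonneg_left (hdist (σ n)) hε.le
    have h4 := hle p (τ (σ n))
    change J (y n) ≤ _ at h4
    linarith
  have hJt : J (p.1 t) = Φ p := by
    refine le_antisymm (hle p t) ?_
    have h1 : Tendsto (fun n => J (y n - h (σ n) • w (y n)) + ε * h (σ n)) atTop
        (𝓝 (J (p.1 t) + ε * 0)) := ((hJc.tendsto _).comp hy').add (hhσ.const_mul ε)
    rw [mul_zero, add_zero] at h1
    refine ge_of_tendsto' h1 fun n => ?_
    have h1 := hp (q (σ n))
    have h2 : Φ (q (σ n)) = J (y n - h (σ n) • w (y n)) := hτ (σ n)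
    have h3 := mul_le_mul_of_nonneg_left (hdist (σ n)) hε.le
    linarith
  refine ⟨p.1 t, hJt ▸ hΦge p, hJt ▸ hpp₀.trans hp₀, ?_⟩
  have hη : η (p.1 t) = 1 := hη1 _ (hJt ▸ hΦge p)
  have hin : inner ℝ (DJ (p.1 t)) (w (p.1 t)) ≤ ε := by
    -- Both points of the difference quotient move with `n`, so strict differentiability at the
    -- limit point is what is needed.
    have hs := (hJ (p.1 t)).isLittleO.comp_tendsto (hy'.prodMk_nhds hy)
    have hs' : (fun n => J (y n - h (σ n) • w (y n)) - J (y n)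
        - inner ℝ (DJ (p.1 t)) (-(h (σ n) • w (y n)))) =o[atTop] fun n => h (σ n) := by
      refine (hs.congr_left fun n => ?_).trans_isBigO ?_
      · simp [Function.comp]
      · refine Asymptotics.IsBigO.of_bound 1 (Eventually.of_forall fun n => ?_)
        simp only [Function.comp, sub_sub_cancel_left, norm_neg, norm_smul, one_mul]
        exact mul_le_of_le_one_right (norm_nonneg _) (hwn _)
    have h0 := hs'.tendsto_div_nhds_zero
    have hlim : Tendsto (fun n => inner ℝ (DJ (p.1 t)) (w (y n))
        - (J (y n - h (σ n) • w (y n)) - J (y n)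
        - inner ℝ (DJ (p.1 t)) (-(h (σ n) • w (y n)))) / h (σ n)) atTop
        (𝓝 (inner ℝ (DJ (p.1 t)) (w (p.1 t)) - 0)) :=
      (tendsto_const_nhds.inner hwy).sub h0
    rw [sub_zero] at hlim
    refine le_of_tendsto' hlim fun n => ?_
    have hpos := hh (σ n)
    rw [inner_neg_right, inner_smul_right (DJ (p.1 t)) (w (y n)) (h (σ n)), sub_div, neg_div,
      mul_div_cancel_left₀ _ hpos.ne']
    have h5 : (J (y n) - J (y n - h (σ n) • w (y n))) / h (σ n) ≤ ε := by
      rw [div_le_iff₀ hpos]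
      linarith [hkey n]
    have h6 : (J (y n - h (σ n) • w (y n)) - J (y n)) / h (σ n)
        = -((J (y n) - J (y n - h (σ n) • w (y n))) / h (σ n)) := by ring
    linarith
  -- If ‖DJ‖ > ε at this point, then `w` is the normalized gradient and its inner product with the
  -- gradient is ‖DJ‖, against the bound ε just proved.
  by_contra! hlt
  have hwt : w (p.1 t) = (1 / ‖DJ (p.1 t)‖) • DJ (p.1 t) := by
    simp [w, hη, max_eq_right hlt.le]
  have hpos : 0 < ‖DJ (p.1 t)‖ := hε.trans hlt
  rw [hwt, inner_smul_right, real_inner_self_eq_norm_sq, sq, ← mul_assoc,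
    one_div_mul_cancel hpos.ne', one_mul] at hin
  linarith

end

section

/-! ### Absolutely continuous curves, primitives and polynomial curves -/

/-- Euclidean space of dimension `N`. -/
abbrev Vec (N : ℕ) := EuclideanSpace ℝ (Fin N)

variable {N : ℕ} {a b : ℝ}

theorem norm_le_sum_abs (x : Vec N) : ‖x‖ ≤ ∑ i, |x i| := by
  conv_lhs => rw [← (EuclideanSpace.basisFun (Fin N) ℝ).sum_repr x]
  refine (norm_sum_le _ _).trans (Finset.sum_le_sum fun i _ => ?_)
  simp [norm_smul]

theorem abs_apply_le_norm (x : Vec N) (i : Fin N) : |x i| ≤ ‖x‖ := by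
  simpa using PiLp.norm_apply_le x i

theorem absolutelyContinuousOnInterval_apply {u : ℝ → Vec N}
    (hu : AbsolutelyContinuousOnInterval u a b) (i : Fin N) :
    AbsolutelyContinuousOnInterval (fun t => u t i) a b := by
  refine squeeze_zero (fun E => Finset.sum_nonneg fun _ _ => dist_nonneg) (fun E => ?_) hu
  refine Finset.sum_le_sum fun j _ => ?_
  rw [Real.dist_eq, dist_eq_norm]
  exact abs_apply_le_norm (u _ - u _) i

theorem absolutelyContinuousOnInterval_of_apply {u : ℝ → Vec N}
    (hu : ∀ i, AbsolutelyContinuousOnInterval (fun t => u t i) a b) :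
    AbsolutelyContinuousOnInterval u a b := by
  have h := tendsto_finsetSum Finset.univ fun i _ => hu i
  simp only [Finset.sum_const_zero] at h
  refine squeeze_zero (fun E => Finset.sum_nonneg fun _ _ => dist_nonneg) (fun E => ?_) h
  rw [Finset.sum_comm]
  refine Finset.sum_le_sum fun j _ => ?_
  rw [dist_eq_norm]
  exact (norm_le_sum_abs _).trans (le_of_eq (by simp [Real.dist_eq]))

theorem ae_differentiableAt_of_absolutelyContinuous (hab : a ≤ b) {u : ℝ → Vec N}
    (hu : AbsolutelyContinuousOnInterval u a b) :
    ∀ᵐ t ∂(volume.restrict (Icc a b)), DifferentiableAt ℝ u t := by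
  rw [ae_restrict_iff' measurableSet_Icc]
  have h : ∀ i, ∀ᵐ t : ℝ, t ∈ uIcc a b → DifferentiableAt ℝ (fun t => u t i) t := fun i =>
    (absolutelyContinuousOnInterval_apply hu i).ae_differentiableAt
  filter_upwards [ae_all_iff.2 h] with t ht htI
  rw [uIcc_of_le hab] at ht
  exact differentiableAt_euclidean.2 fun i => ht i htI

theorem deriv_apply {u : ℝ → Vec N} {t : ℝ} (hu : DifferentiableAt ℝ u t) (i : Fin N) :
    deriv u t i = deriv (fun s => u s i) t :=
  (((EuclideanSpace.proj (𝕜 := ℝ) i).hasFDerivAt.comp_hasDerivAt t hu.hasDerivAt).deriv).symm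

theorem ae_deriv_apply (hab : a ≤ b) {u : ℝ → Vec N}
    (hu : AbsolutelyContinuousOnInterval u a b) (i : Fin N) :
    (fun t => deriv u t i) =ᵐ[volume.restrict (Icc a b)] deriv fun s => u s i := by
  filter_upwards [ae_differentiableAt_of_absolutelyContinuous hab hu] with t ht
  exact deriv_apply ht i

theorem integrableOn_deriv_of_absolutelyContinuous (hab : a ≤ b) {u : ℝ → Vec N}
    (hu : AbsolutelyContinuousOnInterval u a b) : IntegrableOn (deriv u) (Icc a b) := by
  refine Integrable.of_eval_piLp fun i => ?_
  have h := (absolutelyContinuousOnInterval_apply hu i).intervalIntegrable_deriv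
  rw [intervalIntegrable_iff_integrableOn_Icc_of_le hab] at h
  exact Integrable.congr h (ae_deriv_apply hab hu i).symm

theorem setIntegral_Icc_eq_intervalIntegral {E : Type*} [NormedAddCommGroup E] [NormedSpace ℝ E]
    (hab : a ≤ b) (f : ℝ → E) : ∫ t in Icc a b, f t = ∫ t in a..b, f t := by
  rw [intervalIntegral.integral_of_le hab, integral_Icc_eq_integral_Ioc]

theorem integral_inner_eq_sum {ξ w : ℝ → Vec N}
    (h : ∀ i, IntegrableOn (fun t => ξ t i * w t i) (Icc a b)) :
    ∫ t in Icc a b, inner ℝ (ξ t) (w t) = ∑ i, ∫ t in Icc a b, ξ t i * w t i := by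
  rw [← integral_finsetSum _ fun i _ => h i]
  refine integral_congr_ae (Eventually.of_forall fun t => ?_)
  simp [PiLp.inner_apply, mul_comm]

/-- Integration by parts for absolutely continuous curves vanishing at the end points. -/
theorem integral_inner_deriv_eq_neg (hab : a ≤ b) {u ξ : ℝ → Vec N}
    (hu : AbsolutelyContinuousOnInterval u a b) (hξ : AbsolutelyContinuousOnInterval ξ a b)
    (ha : u a = 0) (hb : u b = 0) :
    ∫ t in Icc a b, inner ℝ (ξ t) (deriv u t) = -∫ t in Icc a b, inner ℝ (deriv ξ t) (u t) := by
  have hui := fun i => absolutelyContinuousOnInterval_apply hu i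
  have hξi := fun i => absolutelyContinuousOnInterval_apply hξ i
  have hdu := fun i => ae_deriv_apply hab hu i
  have hdξ := fun i => ae_deriv_apply hab hξ i
  have h1 : ∀ i, IntegrableOn (fun t => ξ t i * deriv (fun s => u s i) t) (Icc a b) := fun i => by
    rw [← intervalIntegrable_iff_integrableOn_Icc_of_le hab]
    exact (hui i).intervalIntegrable_deriv.continuousOn_mul (hξi i).continuousOn
  have h2 : ∀ i, IntegrableOn (fun t => deriv (fun s => ξ s i) t * u t i) (Icc a b) := fun i => by
    rw [← intervalIntegrable_iff_integrableOn_Icc_of_le hab]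
    exact (hξi i).intervalIntegrable_deriv.mul_continuousOn (hui i).continuousOn
  have e1 : ∀ i, (fun t => ξ t i * deriv u t i) =ᵐ[volume.restrict (Icc a b)]
      fun t => ξ t i * deriv (fun s => u s i) t := fun i => by
    filter_upwards [hdu i] with t ht
    rw [ht]
  have e2 : ∀ i, (fun t => deriv ξ t i * u t i) =ᵐ[volume.restrict (Icc a b)]
      fun t => deriv (fun s => ξ s i) t * u t i := fun i => by
    filter_upwards [hdξ i] with t ht
    rw [ht]
  rw [integral_inner_eq_sum fun i => (h1 i).congr (e1 i).symm,
    integral_inner_eq_sum fun i => (h2 i).congr (e2 i).symm, ← Finset.sum_neg_distrib]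
  refine Finset.sum_congr rfl fun i _ => ?_
  rw [integral_congr_ae (e1 i), integral_congr_ae (e2 i), setIntegral_Icc_eq_intervalIntegral hab,
    setIntegral_Icc_eq_intervalIntegral hab,
    (hξi i).integral_mul_deriv_eq_deriv_mul (hui i)]
  simp [ha, hb]

/-- The primitive of `w` vanishing at `a`. -/
def prim (a : ℝ) (w : ℝ → Vec N) (t : ℝ) : Vec N := ∫ s in a..t, w s

theorem prim_self (w : ℝ → Vec N) : prim a w a = 0 := by simp [prim]

theorem absolutelyContinuousOnInterval_prim (hab : a ≤ b) {w : ℝ → Vec N}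
    (hw : IntegrableOn w (Icc a b)) : AbsolutelyContinuousOnInterval (prim a w) a b := by
  refine absolutelyContinuousOnInterval_of_apply fun i => ?_
  have hwi : IntervalIntegrable (fun t => w t i) volume a b :=
    (intervalIntegrable_iff_integrableOn_Icc_of_le hab).2 (hw.eval_piLp i)
  refine (hwi.absolutelyContinuousOnInterval_intervalIntegral (c := a) left_mem_uIcc).congr' ?_
  -- Absolute continuity only sees families of intervals inside `[a, b]`, where a coordinate of the
  -- primitive is the primitive of the coordinate.
  have hmem : ∀ᶠ E in AbsolutelyContinuousOnInterval.totalLengthFilter ⊓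
      𝓟 (AbsolutelyContinuousOnInterval.disjWithin a b),
      E ∈ AbsolutelyContinuousOnInterval.disjWithin a b := eventually_inf_principal.2 (by simp)
  have key : ∀ t ∈ uIcc a b, ∫ s in a..t, w s i = prim a w t i := by
    intro t ht
    rw [uIcc_of_le hab] at ht
    rw [prim, intervalIntegral.integral_of_le ht.1, intervalIntegral.integral_of_le ht.1,
      eval_integral_piLp]
    exact fun j => (hw.eval_piLp j).mono_measure (Measure.restrict_mono
      (Ioc_subset_Icc_self.trans (Icc_subset_Icc_right ht.2)) le_rfl)
  filter_upwards [hmem] with E hE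
  refine Finset.sum_congr rfl fun j hj => ?_
  rw [key _ (hE.1 j hj).1, key _ (hE.1 j hj).2]

theorem ae_hasDerivAt_prim (hab : a ≤ b) {w : ℝ → Vec N} (hw : IntegrableOn w (Icc a b)) :
    ∀ᵐ t ∂(volume.restrict (Icc a b)), HasDerivAt (prim a w) (w t) t := by
  rw [ae_restrict_iff' measurableSet_Icc]
  filter_upwards [((intervalIntegrable_iff_integrableOn_Icc_of_le hab).2
    hw).ae_hasDerivAt_integral] with t ht htI
  exact ht (by rwa [uIcc_of_le hab]) a left_mem_uIcc

theorem prim_deriv (hab : a ≤ b) {u : ℝ → Vec N} (hu : AbsolutelyContinuousOnInterval u a b)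
    {t : ℝ} (ht : t ∈ Icc a b) : prim a (deriv u) t = u t - u a := by
  have hsub : uIcc a t ⊆ uIcc a b := by
    rw [uIcc_of_le ht.1, uIcc_of_le hab]
    exact Icc_subset_Icc_right ht.2
  have hu' := hu.mono hsub
  ext i
  have hint := integrableOn_deriv_of_absolutelyContinuous ht.1 hu'
  have := (absolutelyContinuousOnInterval_apply hu' i).integral_deriv_eq_sub
  rw [prim, ← setIntegral_Icc_eq_intervalIntegral ht.1, eval_integral_piLp fun j => hint.eval_piLp j,
    integral_congr_ae (ae_deriv_apply ht.1 hu' i), setIntegral_Icc_eq_intervalIntegral ht.1, this]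
  simp

theorem hasDerivAt_prim {w : ℝ → Vec N} (hw : Continuous w) (t : ℝ) :
    HasDerivAt (prim a w) (w t) t :=
  intervalIntegral.integral_hasDerivAt_right (hw.intervalIntegrable _ _)
    hw.aestronglyMeasurable.stronglyMeasurableAtFilter hw.continuousAt

theorem continuous_prim {w : ℝ → Vec N} (hw : Continuous w) : Continuous (prim a w) :=
  continuous_iff_continuousAt.2 fun t => (hasDerivAt_prim hw t).continuousAt

theorem norm_prim_sub_le {w w' : ℝ → Vec N} (hw : IntegrableOn w (Icc a b))
    (hw' : IntegrableOn w' (Icc a b)) {t : ℝ} (ht : t ∈ Icc a b) :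
    ‖prim a w t - prim a w' t‖ ≤ ∫ s in Icc a b, ‖w s - w' s‖ := by
  have hs : Icc a t ⊆ Icc a b := Icc_subset_Icc_right ht.2
  rw [prim, prim, ← setIntegral_Icc_eq_intervalIntegral ht.1,
    ← setIntegral_Icc_eq_intervalIntegral ht.1,
    ← integral_sub (hw.mono_set hs) (hw'.mono_set hs)]
  refine (norm_integral_le_integral_norm _).trans ?_
  exact setIntegral_mono_set (hw.sub hw').norm (Eventually.of_forall fun _ => norm_nonneg _)
    hs.eventuallyLE

theorem norm_prim_le {w : ℝ → Vec N} (hw : IntegrableOn w (Icc a b))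
    {t : ℝ} (ht : t ∈ Icc a b) : ‖prim a w t‖ ≤ ∫ s in Icc a b, ‖w s‖ := by
  have h := norm_prim_sub_le hw (w' := fun _ => 0) (integrable_zero _ _ _) ht
  simpa [prim] using h

/-- Polynomial curves. -/
def IsPolyCurve (p : ℝ → Vec N) : Prop :=
  ∃ (m : ℕ) (c : ℕ → Vec N), ∀ t, p t = ∑ i ∈ Finset.range m, t ^ i • c i

theorem IsPolyCurve.contDiff {p : ℝ → Vec N} (hp : IsPolyCurve p) : ContDiff ℝ 1 p := by
  obtain ⟨m, c, hc⟩ := hp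
  rw [show p = _ from funext hc]
  fun_prop

theorem IsPolyCurve.continuous {p : ℝ → Vec N} (hp : IsPolyCurve p) : Continuous p :=
  hp.contDiff.continuous

/-- Weierstrass approximation in each coordinate. The tolerance is divided by N + 1 rather than N so
that N = 0 needs no separate treatment. -/
theorem exists_polyCurve_near {ξ : ℝ → Vec N} (hξ : ContinuousOn ξ (Icc a b)) {ε : ℝ}
    (hε : 0 < ε) : ∃ p, IsPolyCurve p ∧ ∀ t ∈ Icc a b, ‖p t - ξ t‖ ≤ ε := by
  have hδ : 0 < ε / (N + 1) := by positivity
  have hξi : ∀ i, ContinuousOn (fun t => ξ t i) (Icc a b) := fun i =>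
    (EuclideanSpace.proj (𝕜 := ℝ) i).continuous.comp_continuousOn hξ
  choose q hq using fun i => exists_polynomial_near_of_continuousOn a b _ (hξi i) _ hδ
  refine ⟨fun t => WithLp.toLp 2 fun i => (q i).eval t, ?_, fun t ht => ?_⟩
  · refine ⟨(Finset.univ.sup fun i => (q i).natDegree) + 1,
      fun k => WithLp.toLp 2 fun i => (q i).coeff k, fun t => ?_⟩
    ext i
    have hlt : (q i).natDegree < (Finset.univ.sup fun i => (q i).natDegree) + 1 :=
      Nat.lt_succ_of_le (Finset.le_sup (f := fun i => (q i).natDegree) (Finset.mem_univ i))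
    simp [Polynomial.eval_eq_sum_range' hlt, mul_comm]
  · refine (norm_le_sum_abs _).trans ?_
    calc ∑ i, |((WithLp.toLp 2 fun i => (q i).eval t) - ξ t : Vec N) i|
        ≤ ∑ _i : Fin N, ε / (N + 1) := Finset.sum_le_sum fun i _ => (hq i t ht).le
      _ = N * (ε / (N + 1)) := by simp
      _ ≤ (N + 1) * (ε / (N + 1)) := by gcongr; linarith
      _ = ε := by field

/-- Bounded measurable curves are almost everywhere limits of uniformly bounded polynomial
curves. -/
theorem exists_polyCurve_tendsto_ae {v : ℝ → Vec N} {R : ℝ} (hR : 0 ≤ R)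
    (hv : AEStronglyMeasurable v (volume.restrict (Icc a b))) (hvR : ∀ t, ‖v t‖ ≤ R) :
    ∃ p : ℕ → ℝ → Vec N, (∀ k, IsPolyCurve (p k)) ∧ (∀ k, ∀ t ∈ Icc a b, ‖p k t‖ ≤ R + 2) ∧
      ∀ᵐ t ∂(volume.restrict (Icc a b)), Tendsto (fun k => p k t) atTop (𝓝 (v t)) := by
  have hvi : MemLp v 1 (volume.restrict (Icc a b)) :=
    MemLp.of_bound hv R (Eventually.of_forall hvR)
  have hex : ∀ k : ℕ, ∃ g : ℝ → Vec N, HasCompactSupport g ∧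
      eLpNorm (v - g) 1 (volume.restrict (Icc a b)) ≤ ((k : ENNReal) + 1)⁻¹ ∧ Continuous g ∧
      MemLp g 1 (volume.restrict (Icc a b)) := fun k =>
    hvi.exists_hasCompactSupport_eLpNorm_sub_le ENNReal.one_ne_top
      (ENNReal.inv_ne_zero.2 (by finiteness))
  choose g _ hg hgc hgm using hex
  have hlim : Tendsto (fun k => eLpNorm (g k - v) 1 (volume.restrict (Icc a b))) atTop (𝓝 0) := by
    have h0 : Tendsto (fun k : ℕ => ((k : ENNReal) + 1)⁻¹) atTop (𝓝 0) := by
      have := (tendsto_add_atTop_iff_nat 1).2 ENNReal.tendsto_inv_nat_nhds_zero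
      simpa using this
    refine tendsto_of_tendsto_of_tendsto_of_le_of_le tendsto_const_nhds h0
      (fun _ => zero_le) fun k => ?_
    rw [eLpNorm_sub_comm]
    exact hg k
  -- L¹ convergence of the continuous approximations gives convergence in measure, hence almost
  -- everywhere along a subsequence.
  obtain ⟨σ, -, hσ⟩ := (tendstoInMeasure_of_tendsto_eLpNorm one_ne_zero
    (fun k => (hgm k).aestronglyMeasurable) hv hlim).exists_seq_tendsto_ae
  -- A continuous retraction onto the ball of radius R + 1 that fixes the values of `v`. Composing
  -- with it makes the approximations bounded without losing their limit; the polynomial error, at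
  -- most 1, accounts for R + 2.
  let P : Vec N → Vec N := fun x => ((R + 1) / max (R + 1) ‖x‖) • x
  have hm : ∀ x : Vec N, 0 < max (R + 1) ‖x‖ := fun x => lt_max_of_lt_left (by linarith)
  have hP : Continuous P :=
    (continuous_const.div (continuous_const.max continuous_norm) fun x => (hm x).ne').smul
      continuous_id
  have hPn : ∀ x, ‖P x‖ ≤ R + 1 := fun x => by
    rw [norm_smul, Real.norm_of_nonneg (div_nonneg (by linarith) (hm x).le), div_mul_eq_mul_div,
      div_le_iff₀ (hm x)]
    exact mul_le_mul_of_nonneg_left (le_max_right _ _) (by linarith)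
  have hPv : ∀ t, P (v t) = v t := fun t => by
    have h := hvR t
    simp only [P]
    rw [max_eq_left (by linarith), div_self (by linarith), one_smul]
  choose p hp hpg using fun k : ℕ => exists_polyCurve_near (a := a) (b := b)
    (hP.comp (hgc (σ k))).continuousOn (Nat.one_div_pos_of_nat (n := k) (α := ℝ))
  refine ⟨p, hp, fun k t ht => ?_, ?_⟩
  · have h1 := norm_le_norm_add_norm_sub' (p k t) (P (g (σ k) t))
    have h2 := hpg k t ht
    have h3 : 1 / ((k : ℝ) + 1) ≤ 1 := by
      rw [div_le_one (by positivity)]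
      linarith [(Nat.cast_nonneg k : (0 : ℝ) ≤ k)]
    have h4 := hPn (g (σ k) t)
    simp only [Function.comp] at h2
    linarith
  · filter_upwards [hσ, ae_restrict_mem measurableSet_Icc] with t ht htI
    have h1 : Tendsto (fun k => P (g (σ k) t)) atTop (𝓝 (v t)) := by
      have := (hP.tendsto (v t)).comp ht
      rwa [hPv] at this
    have h2 : Tendsto (fun k => p k t - P (g (σ k) t)) atTop (𝓝 0) :=
      squeeze_zero_norm (fun k => hpg k t htI) tendsto_one_div_add_atTop_nhds_zero_nat
    simpa using h2.add h1

end

section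

/-! ### Weak compactness of bounded modulars -/

variable {N : ℕ} {a b : ℝ}

theorem integrableOn_of_continuous {E : Type*} [NormedAddCommGroup E] {f : ℝ → E}
    (hf : Continuous f) : IntegrableOn f (Icc a b) :=
  hf.continuousOn.integrableOn_compact isCompact_Icc

theorem integral_norm_le_of_superlinear (hab : a ≤ b) {G : Vec N → ℝ} {δ C K : ℝ}
    (hδ : 0 ≤ δ) (hC : ∀ v, ‖v‖ ≤ δ * G v + C) {w : ℝ → Vec N}
    (hw : IntegrableOn w (Icc a b)) (hGw : IntegrableOn (fun t => G (w t)) (Icc a b))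
    (hK : ∫ t in Icc a b, G (w t) ≤ K) :
    ∫ t in Icc a b, ‖w t‖ ≤ δ * K + C * (b - a) := by
  calc ∫ t in Icc a b, ‖w t‖ ≤ ∫ t in Icc a b, (δ * G (w t) + C) :=
        integral_mono hw.norm ((hGw.const_mul δ).add (integrable_const C)) fun t => hC _
    _ = δ * (∫ t in Icc a b, G (w t)) + C * (b - a) := by
        rw [integral_add (hGw.const_mul δ) (integrable_const C), integral_const_mul,
          setIntegral_const]
        simp [Real.volume_real_Icc_of_le hab, mul_comm]
    _ ≤ _ := by gcongr

/-- An estimate in the spirit of de la Vallée-Poussin: a family of disjoint intervals contributes at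
most δK, however it is chosen, plus C times its total length. Since δ can be made small, a modular
bound gives absolute continuity uniformly over all such curves. -/
theorem sum_dist_prim_le (hab : a ≤ b) {G : Vec N → ℝ} (hGc : Continuous G) (hG0 : ∀ v, 0 ≤ G v)
    {δ C K : ℝ} (hδ : 0 ≤ δ) (hC : ∀ v, ‖v‖ ≤ δ * G v + C) {w : ℝ → Vec N} (hw : Continuous w)
    (hK : ∫ t in Icc a b, G (w t) ≤ K) {E : ℕ × (ℕ → ℝ × ℝ)}
    (hE : E ∈ AbsolutelyContinuousOnInterval.disjWithin a b) :
    ∑ i ∈ Finset.range E.1, dist (prim a w (E.2 i).1) (prim a w (E.2 i).2) ≤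
      δ * K + C * ∑ i ∈ Finset.range E.1, dist (E.2 i).1 (E.2 i).2 := by
  have hint : ∀ s t : ℝ, IntegrableOn (fun t => G (w t)) (uIoc s t) := fun s t =>
    ((hGc.comp hw).continuousOn.integrableOn_compact isCompact_uIcc).mono_set uIoc_subset_uIcc
  have h1 : ∀ s t : ℝ, dist (prim a w s) (prim a w t) ≤
      δ * (∫ r in uIoc s t, G (w r)) + C * dist s t := by
    intro s t
    rw [dist_comm, dist_eq_norm, prim, prim,
      intervalIntegral.integral_interval_sub_left (hw.intervalIntegrable _ _)
        (hw.intervalIntegrable _ _)]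
    refine (intervalIntegral.norm_integral_le_integral_norm_uIoc).trans ?_
    have hwi : IntegrableOn (fun r => ‖w r‖) (uIoc s t) :=
      (hw.norm.continuousOn.integrableOn_compact isCompact_uIcc).mono_set uIoc_subset_uIcc
    have hci : IntegrableOn (fun _ : ℝ => C) (uIoc s t) :=
      (continuous_const.continuousOn.integrableOn_compact isCompact_uIcc).mono_set
        uIoc_subset_uIcc
    calc ∫ r in uIoc s t, ‖w r‖ ≤ ∫ r in uIoc s t, (δ * G (w r) + C) :=
          integral_mono hwi (((hint s t).const_mul δ).add hci) fun r => hC _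
      _ = _ := by
          rw [integral_add ((hint s t).const_mul δ) hci, integral_const_mul, setIntegral_const]
          congr 1
          rw [smul_eq_mul, mul_comm, uIoc, Real.volume_real_Ioc_of_le min_le_max, dist_comm,
            Real.dist_eq, max_sub_min_eq_abs]
  have hsub : (⋃ i ∈ Finset.range E.1, uIoc (E.2 i).1 (E.2 i).2) ⊆ Icc a b := by
    refine iUnion₂_subset fun i hi => uIoc_subset_uIcc.trans ?_
    rw [← uIcc_of_le hab]
    exact uIcc_subset_uIcc (hE.1 i hi).1 (hE.1 i hi).2
  have h2 : ∑ i ∈ Finset.range E.1, ∫ r in uIoc (E.2 i).1 (E.2 i).2, G (w r) ≤ K := by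
    rw [← integral_biUnion_finset _ (by simp [uIoc]) hE.2 fun i _ => hint _ _]
    exact (setIntegral_mono_set (integrableOn_of_continuous (hGc.comp hw))
      (Eventually.of_forall fun _ => hG0 _) hsub.eventuallyLE).trans hK
  calc ∑ i ∈ Finset.range E.1, dist (prim a w (E.2 i).1) (prim a w (E.2 i).2)
      ≤ ∑ i ∈ Finset.range E.1, (δ * (∫ r in uIoc (E.2 i).1 (E.2 i).2, G (w r))
        + C * dist (E.2 i).1 (E.2 i).2) := Finset.sum_le_sum fun i _ => h1 _ _
    _ = δ * (∑ i ∈ Finset.range E.1, ∫ r in uIoc (E.2 i).1 (E.2 i).2, G (w r))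
        + C * ∑ i ∈ Finset.range E.1, dist (E.2 i).1 (E.2 i).2 := by
        rw [Finset.sum_add_distrib, Finset.mul_sum, Finset.mul_sum]
    _ ≤ _ := by gcongr

theorem dist_prim_le (hab : a ≤ b) {G : Vec N → ℝ} (hGc : Continuous G) (hG0 : ∀ v, 0 ≤ G v)
    {δ C K : ℝ} (hδ : 0 ≤ δ) (hC : ∀ v, ‖v‖ ≤ δ * G v + C) {w : ℝ → Vec N} (hw : Continuous w)
    (hK : ∫ t in Icc a b, G (w t) ≤ K) {s t : ℝ} (hs : s ∈ Icc a b) (ht : t ∈ Icc a b) :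
    dist (prim a w s) (prim a w t) ≤ δ * K + C * dist s t := by
  have h := sum_dist_prim_le hab hGc hG0 hδ hC hw hK (E := (1, fun _ => (s, t))) ⟨by
    rw [uIcc_of_le hab]
    exact fun _ _ => ⟨hs, ht⟩, by simp⟩
  simpa using h

theorem tendsto_setIntegral_of_bounded {f : ℕ → ℝ → ℝ} {g : ℝ → ℝ} {M : ℝ}
    (hf : ∀ n, AEStronglyMeasurable (f n) (volume.restrict (Icc a b)))
    (hM : ∀ᶠ n in atTop, ∀ t ∈ Icc a b, |f n t| ≤ M)
    (hlim : ∀ t ∈ Icc a b, Tendsto (fun n => f n t) atTop (𝓝 (g t))) :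
    Tendsto (fun n => ∫ t in Icc a b, f n t) atTop (𝓝 (∫ t in Icc a b, g t)) := by
  refine tendsto_integral_filter_of_dominated_convergence (fun _ => M)
    (Eventually.of_forall hf) ?_ (integrable_const M) ?_
  · filter_upwards [hM] with n hn
    filter_upwards [ae_restrict_mem measurableSet_Icc] with t ht using hn t ht
  · filter_upwards [ae_restrict_mem measurableSet_Icc] with t ht using hlim t ht

theorem abs_integral_inner_le {ξ w : ℝ → Vec N} {ε : ℝ} (hw : IntegrableOn w (Icc a b))
    (hξ : ∀ t ∈ Icc a b, ‖ξ t‖ ≤ ε) :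
    |∫ t in Icc a b, inner ℝ (ξ t) (w t)| ≤ ε * ∫ t in Icc a b, ‖w t‖ := by
  rw [← integral_const_mul, ← Real.norm_eq_abs]
  refine norm_integral_le_of_norm_le (hw.norm.const_mul ε) ?_
  filter_upwards [ae_restrict_mem measurableSet_Icc] with t ht
  exact (norm_inner_le_norm _ _).trans (mul_le_mul_of_nonneg_right (hξ t ht) (norm_nonneg _))

theorem integrableOn_inner {ξ w : ℝ → Vec N} (hξ : Continuous ξ) (hw : IntegrableOn w (Icc a b)) :
    IntegrableOn (fun t => inner ℝ (ξ t) (w t)) (Icc a b) := by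
  obtain ⟨C, hC⟩ := (isCompact_Icc (a := a) (b := b)).exists_bound_of_continuousOn hξ.continuousOn
  refine (hw.norm.const_mul C).mono' (hξ.aestronglyMeasurable.inner hw.aestronglyMeasurable) ?_
  filter_upwards [ae_restrict_mem measurableSet_Icc] with t ht
  exact (norm_inner_le_norm _ _).trans (mul_le_mul_of_nonneg_right (hC t ht) (norm_nonneg _))

/-- Compactness: curves with bounded superlinear energy have a subsequence which converges
uniformly, and whose derivatives converge weakly against continuous functions. -/
theorem exists_weak_limit (hab : a < b) {G : Vec N → ℝ} (hGc : Continuous G) (hG0 : ∀ v, 0 ≤ G v)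
    (hsup : ∀ δ > 0, ∃ C, ∀ v, ‖v‖ ≤ δ * G v + C) {w : ℕ → ℝ → Vec N}
    (hw : ∀ m, Continuous (w m)) (hwb : ∀ m, prim a (w m) b = 0) {K : ℝ}
    (hK : ∀ m, ∫ t in Icc a b, G (w m t) ≤ K) :
    ∃ (σ : ℕ → ℕ) (u : ℝ → Vec N), StrictMono σ ∧ Continuous u ∧
      AbsolutelyContinuousOnInterval u a b ∧ u a = 0 ∧ u b = 0 ∧
      TendstoUniformlyOn (fun m => prim a (w (σ m))) u atTop (Icc a b) ∧
      ∀ ξ : ℝ → Vec N, Continuous ξ → Tendsto (fun m => ∫ t in Icc a b, inner ℝ (ξ t) (w (σ m) t))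
        atTop (𝓝 (∫ t in Icc a b, inner ℝ (ξ t) (deriv u t))) := by
  have hK0 : 0 ≤ K := le_trans (integral_nonneg fun t => hG0 (w 0 t)) (hK 0)
  -- Half of ε pays for the superlinear term and a quarter for the length term. Replacing `C` by
  -- `max C 1` and `K` by `K + 1` avoids division by zero.
  have hmod : ∀ ε > 0, ∃ δ > 0, ∃ C > 0, (∀ v, ‖v‖ ≤ (ε / (2 * (K + 1))) * G v + C) ∧
      ε / (2 * (K + 1)) * K + C * δ < ε := by
    intro ε hε
    obtain ⟨C, hC⟩ := hsup (ε / (2 * (K + 1))) (by positivity)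
    have hC' : 0 < max C 1 := by positivity
    refine ⟨ε / (4 * max C 1), by positivity, max C 1, hC',
      fun v => (hC v).trans (by gcongr; exact le_max_left _ _), ?_⟩
    have h1 : ε / (2 * (K + 1)) * K ≤ ε / 2 := by
      rw [div_mul_eq_mul_div, div_le_div_iff₀ (by positivity) (by positivity)]
      nlinarith
    have h2 : max C 1 * (ε / (4 * max C 1)) = ε / 4 := by field
    linarith
  obtain ⟨C₁, hC₁⟩ := hsup 1 one_pos
  set M := 1 * K + C₁ * (b - a) with hM
  have hwi : ∀ m, IntegrableOn (w m) (Icc a b) := fun m => integrableOn_of_continuous (hw m)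
  have hGwi : ∀ m, IntegrableOn (fun t => G (w m t)) (Icc a b) := fun m =>
    integrableOn_of_continuous (hGc.comp (hw m))
  have hL1 : ∀ m, ∫ t in Icc a b, ‖w m t‖ ≤ M := fun m =>
    integral_norm_le_of_superlinear hab.le zero_le_one hC₁ (hwi m) (hGwi m) (hK m)
  have hM0 : 0 ≤ M := (integral_nonneg fun t => norm_nonneg (w 0 t)).trans (hL1 0)
  -- The primitives as functions on the compact interval, to which Arzelà–Ascoli applies.
  let p : ℕ → BoundedContinuousFunction (Icc a b) (Vec N) := fun m =>
    BoundedContinuousFunction.mkOfCompact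
      ⟨fun t => prim a (w m) t, (continuous_prim (hw m)).comp continuous_subtype_val⟩
  have hcomp : IsCompact (closure (range p)) := by
    refine BoundedContinuousFunction.arzela_ascoli (Metric.closedBall 0 M)
      (isCompact_closedBall 0 M) _ ?_ ?_
    · rintro _ t ⟨m, rfl⟩
      rw [mem_closedBall_zero_iff]
      exact (norm_prim_le (hwi m) t.2).trans (hL1 m)
    · intro s
      rw [Metric.equicontinuousAt_iff]
      intro ε hε
      obtain ⟨δ, hδ, C, hC, hv, hε'⟩ := hmod ε hε
      refine ⟨δ, hδ, ?_⟩
      rintro t ht ⟨_, m, rfl⟩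
      refine (dist_prim_le hab.le hGc hG0 (by positivity) hv (hw m) (hK m)
        s.2 t.2).trans_lt (lt_of_le_of_lt ?_ hε')
      rw [dist_comm]
      gcongr
      exact ht.le
  obtain ⟨f, -, σ, hσ, hf⟩ := hcomp.tendsto_subseq (x := p) fun m => subset_closure ⟨m, rfl⟩
  -- The limit is extended by its end values, which makes it continuous on the whole line.
  let u : ℝ → Vec N := fun t => f (projIcc a b hab.le t)
  have huc : Continuous u := f.continuous.comp continuous_projIcc
  have hunif : TendstoUniformlyOn (fun m => prim a (w (σ m))) u atTop (Icc a b) := by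
    have h := BoundedContinuousFunction.tendsto_iff_tendstoUniformly.1 hf
    rw [Metric.tendstoUniformlyOn_iff]
    intro ε hε
    filter_upwards [Metric.tendstoUniformly_iff.1 h ε hε] with m hm t ht
    have := hm ⟨t, ht⟩
    simp only [u, projIcc_of_mem hab.le ht]
    exact this
  have hpt : ∀ t ∈ Icc a b, Tendsto (fun m => prim a (w (σ m)) t) atTop (𝓝 (u t)) :=
    fun t ht => hunif.tendsto_at ht
  have hua : u a = 0 :=
    tendsto_nhds_unique (hpt a (left_mem_Icc.2 hab.le)) (by simp [prim_self])
  have hub : u b = 0 :=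
    tendsto_nhds_unique (hpt b (right_mem_Icc.2 hab.le)) (by simp [hwb])
  have huac : AbsolutelyContinuousOnInterval u a b := by
    rw [absolutelyContinuousOnInterval_iff]
    intro ε hε
    obtain ⟨δ, hδ, C, hC, hv, hε'⟩ := hmod ε hε
    refine ⟨δ, hδ, fun E hE hlt => lt_of_le_of_lt ?_ hε'⟩
    have hl : Tendsto (fun m => ∑ i ∈ Finset.range E.1,
        dist (prim a (w (σ m)) (E.2 i).1) (prim a (w (σ m)) (E.2 i).2)) atTop
        (𝓝 (∑ i ∈ Finset.range E.1, dist (u (E.2 i).1) (u (E.2 i).2))) := by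
      refine tendsto_finsetSum _ fun i hi => ?_
      have hm := hE.1 i hi
      rw [uIcc_of_le hab.le] at hm
      exact (hpt _ hm.1).dist (hpt _ hm.2)
    refine le_of_tendsto' hl fun m => ?_
    refine (sum_dist_prim_le hab.le hGc hG0 (by positivity) hv (hw _) (hK _)
      hE).trans ?_
    gcongr
  refine ⟨σ, u, hσ, huc, huac, hua, hub, hunif, ?_⟩
  have hdu := integrableOn_deriv_of_absolutelyContinuous hab.le huac
  -- Against a smooth test curve the derivative can be moved to the test curve, and uniform
  -- convergence of the primitives suffices.
  have hpoly : ∀ ξ : ℝ → Vec N, IsPolyCurve ξ →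
      Tendsto (fun m => ∫ t in Icc a b, inner ℝ (ξ t) (w (σ m) t))
        atTop (𝓝 (∫ t in Icc a b, inner ℝ (ξ t) (deriv u t))) := by
    intro ξ hξ
    have hξac : AbsolutelyContinuousOnInterval ξ a b :=
      hξ.contDiff.contDiffOn.absolutelyContinuousOnInterval
    have hdξ : Continuous (deriv ξ) := hξ.contDiff.continuous_deriv le_rfl
    rw [integral_inner_deriv_eq_neg hab.le huac hξac hua hub]
    have e : ∀ m, ∫ t in Icc a b, inner ℝ (ξ t) (w (σ m) t) =
        -∫ t in Icc a b, inner ℝ (deriv ξ t) (prim a (w (σ m)) t) := by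
      intro m
      rw [← integral_inner_deriv_eq_neg hab.le
        (absolutelyContinuousOnInterval_prim hab.le (hwi _)) hξac (prim_self _) (hwb _)]
      simp only [fun t => (hasDerivAt_prim (a := a) (hw (σ m)) t).deriv]
    simp only [e]
    obtain ⟨B, hB⟩ := (isCompact_Icc (a := a) (b := b)).exists_bound_of_continuousOn
      hdξ.continuousOn
    refine (tendsto_setIntegral_of_bounded (M := B * M)
      (fun m => (hdξ.inner (continuous_prim (hw _))).aestronglyMeasurable)
      (Eventually.of_forall fun m t ht => ?_)
      fun t ht => tendsto_const_nhds.inner (hpt t ht)).neg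
    rw [← Real.norm_eq_abs]
    exact (norm_inner_le_norm _ _).trans (mul_le_mul (hB t ht)
      ((norm_prim_le (hwi _) ht).trans (hL1 _)) (norm_nonneg _) ((norm_nonneg _).trans (hB t ht)))
  intro ξ hξ
  rw [Metric.tendsto_atTop]
  intro ε hε
  set D := ∫ t in Icc a b, ‖deriv u t‖
  have hD : 0 ≤ D := integral_nonneg fun _ => norm_nonneg _
  -- A continuous test curve is replaced by a polynomial one; the error is controlled by the L¹
  -- bounds on the velocities and on the derivative of the limit.
  obtain ⟨q, hq, hqξ⟩ := exists_polyCurve_near (a := a) (b := b) hξ.continuousOn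
    (show 0 < ε / (4 * (M + D + 1)) by positivity)
  obtain ⟨n, hn⟩ := Metric.tendsto_atTop.1 (hpoly q hq) (ε / 2) (by positivity)
  refine ⟨n, fun m hm => ?_⟩
  have h0 := hn m hm
  have hsub : ∀ z : ℝ → Vec N, IntegrableOn z (Icc a b) →
      |(∫ t in Icc a b, inner ℝ (q t) (z t)) - ∫ t in Icc a b, inner ℝ (ξ t) (z t)| ≤
        ε / (4 * (M + D + 1)) * ∫ t in Icc a b, ‖z t‖ := by
    intro z hz
    rw [← integral_sub (integrableOn_inner hq.continuous hz) (integrableOn_inner hξ hz)]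
    simp only [← inner_sub_left]
    exact abs_integral_inner_le hz hqξ
  have h1 := hsub _ (hwi (σ m))
  have h2 := hsub _ hdu
  have h3 : ε / (4 * (M + D + 1)) * (∫ t in Icc a b, ‖w (σ m) t‖) + ε / (4 * (M + D + 1)) * D
      ≤ ε / 4 := by
    calc _ ≤ ε / (4 * (M + D + 1)) * M + ε / (4 * (M + D + 1)) * D := by gcongr; exact hL1 _
      _ = ε / 4 * ((M + D) / (M + D + 1)) := by field
      _ ≤ ε / 4 * 1 := by
        gcongr
        rw [div_le_one (by positivity)]
        linarith
      _ = ε / 4 := mul_one _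
  rw [Real.dist_eq] at h0 ⊢
  rw [abs_lt] at h0 ⊢
  rw [abs_le] at h1 h2
  constructor <;> linarith [h1.1, h1.2, h2.1, h2.2]

end

section

/-! ### Convex integrands and lower semicontinuity -/

variable {N : ℕ} {a b : ℝ}

/-- The properties of the growth function `G` which are used in the compactness arguments. -/
structure IsGrowthFunction (G : Vec N → ℝ) : Prop where
  cont : Continuous G
  nonneg : ∀ v, 0 ≤ G v
  zero : G 0 = 0
  superlinear : ∀ δ > 0, ∃ C, ∀ v, ‖v‖ ≤ δ * G v + C
  shift : ∀ M, ∃ A, 0 ≤ A ∧ ∀ v z, ‖z‖ ≤ M → G (v + z) ≤ A * (1 + G v)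

/-- Nonnegative integrands `H(t,v)`, convex and differentiable in `v`, with `H(t,0) = 0`. -/
structure IsConvexIntegrand (H : ℝ → Vec N → ℝ) (Hv : ℝ → Vec N → Vec N) : Prop where
  cont : Continuous fun p : ℝ × Vec N => H p.1 p.2
  contGrad : Continuous fun p : ℝ × Vec N => Hv p.1 p.2
  hasGrad : ∀ t v, HasGradientAt (H t) (Hv t v) v
  convex : ∀ t, ConvexOn ℝ univ (H t)
  nonneg : ∀ t v, 0 ≤ H t v
  zero : ∀ t, H t 0 = 0

/-- On the line through `v` and `w` the function is convex in one variable, and its slope over [0,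
1] is at least its derivative at 0. -/
theorem tangent_le_of_convexOn {h : Vec N → ℝ} (hc : ConvexOn ℝ univ h) {v g : Vec N}
    (hg : HasGradientAt h g v) (w : Vec N) : h v + inner ℝ g (w - v) ≤ h w := by
  have hl : HasDerivAt (fun s : ℝ => AffineMap.lineMap (k := ℝ) v w s) (w - v) 0 :=
    AffineMap.hasDerivAt_lineMap
  have hg' : HasFDerivAt h (InnerProductSpace.toDual ℝ _ g) (AffineMap.lineMap (k := ℝ) v w (0 : ℝ)) := by
    simpa using hg.hasFDerivAt
  have hd := hg'.comp_hasDerivAt (0 : ℝ) hl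
  have hcl : ConvexOn ℝ univ (h ∘ (AffineMap.lineMap (k := ℝ) v w)) := by
    simpa using hc.comp_affineMap (AffineMap.lineMap (k := ℝ) v w)
  have h1 := hcl.le_slope_of_hasDerivAt (mem_univ 0) (mem_univ 1) one_pos hd
  simp [slope_def_field] at h1
  linarith

variable {H : ℝ → Vec N → ℝ} {Hv : ℝ → Vec N → Vec N}

theorem IsConvexIntegrand.tangent_le (hH : IsConvexIntegrand H Hv) (t : ℝ) (v w : Vec N) :
    H t v + inner ℝ (Hv t v) (w - v) ≤ H t w :=
  tangent_le_of_convexOn (hH.convex t) (hH.hasGrad t v) w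

/-- The origin is a global minimum of `H t`. -/
theorem IsConvexIntegrand.grad_zero (hH : IsConvexIntegrand H Hv) (t : ℝ) : Hv t 0 = 0 := by
  have hm : IsLocalMin (H t) 0 := Eventually.of_forall fun v => by
    rw [hH.zero]
    exact hH.nonneg t v
  simpa using hm.hasFDerivAt_eq_zero (hH.hasGrad t 0).hasFDerivAt

/-- The integral of the tangent minorant of `H` at the curve `v`, evaluated along `w`. -/
def tangentValue (a b : ℝ) (H : ℝ → Vec N → ℝ) (Hv : ℝ → Vec N → Vec N) (v w : ℝ → Vec N) : ℝ :=
  ∫ t in Icc a b, (H t (v t) + inner ℝ (Hv t (v t)) (w t - v t))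

theorem IsConvexIntegrand.continuous_comp (hH : IsConvexIntegrand H Hv) {v : ℝ → Vec N}
    (hv : Continuous v) : Continuous fun t => H t (v t) :=
  hH.cont.comp (continuous_id.prodMk hv)

theorem IsConvexIntegrand.continuous_grad_comp (hH : IsConvexIntegrand H Hv) {v : ℝ → Vec N}
    (hv : Continuous v) : Continuous fun t => Hv t (v t) :=
  hH.contGrad.comp (continuous_id.prodMk hv)

theorem IsConvexIntegrand.measurable_comp (hH : IsConvexIntegrand H Hv) {v : ℝ → Vec N}
    (hv : Measurable v) : Measurable fun t => H t (v t) :=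
  hH.cont.measurable.comp (measurable_id.prodMk hv)

theorem IsConvexIntegrand.integrableOn_tangent (hH : IsConvexIntegrand H Hv) {v w : ℝ → Vec N}
    (hv : Continuous v) (hw : IntegrableOn w (Icc a b)) :
    IntegrableOn (fun t => H t (v t) + inner ℝ (Hv t (v t)) (w t - v t)) (Icc a b) :=
  (integrableOn_of_continuous (hH.continuous_comp hv)).add
    (integrableOn_inner (hH.continuous_grad_comp hv) (hw.sub (integrableOn_of_continuous hv)))

theorem IsConvexIntegrand.tangentValue_le (hH : IsConvexIntegrand H Hv) {v w : ℝ → Vec N}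
    (hv : Continuous v) (hw : IntegrableOn w (Icc a b))
    (hHw : IntegrableOn (fun t => H t (w t)) (Icc a b)) :
    tangentValue a b H Hv v w ≤ ∫ t in Icc a b, H t (w t) :=
  integral_mono (hH.integrableOn_tangent hv hw) hHw fun t => hH.tangent_le t _ _

/-- Weak convergence of curves, tested against continuous functions. -/
def WeakTendsto (a b : ℝ) (w : ℕ → ℝ → Vec N) (w' : ℝ → Vec N) : Prop :=
  ∀ ξ : ℝ → Vec N, Continuous ξ → Tendsto (fun m => ∫ t in Icc a b, inner ℝ (ξ t) (w m t))
    atTop (𝓝 (∫ t in Icc a b, inner ℝ (ξ t) (w' t)))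

/-- At a continuous curve the tangent minorant is affine in `w` with a continuous coefficient, so
weak convergence passes to the limit in it. Lower semicontinuity follows by taking such minorants
close to the energy. -/
theorem IsConvexIntegrand.tendsto_tangentValue (hH : IsConvexIntegrand H Hv)
    {w : ℕ → ℝ → Vec N} {w' v : ℝ → Vec N} (hv : Continuous v)
    (hw : ∀ m, IntegrableOn (w m) (Icc a b)) (hw' : IntegrableOn w' (Icc a b))
    (hlim : WeakTendsto a b w w') :
    Tendsto (fun m => tangentValue a b H Hv v (w m)) atTop (𝓝 (tangentValue a b H Hv v w')) := by
  have key : ∀ z : ℝ → Vec N, IntegrableOn z (Icc a b) → tangentValue a b H Hv v z =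
      (∫ t in Icc a b, (H t (v t) - inner ℝ (Hv t (v t)) (v t))) +
        ∫ t in Icc a b, inner ℝ (Hv t (v t)) (z t) := by
    intro z hz
    have h1 : IntegrableOn (fun t => H t (v t) - inner ℝ (Hv t (v t)) (v t)) (Icc a b) :=
      integrableOn_of_continuous
        ((hH.continuous_comp hv).sub ((hH.continuous_grad_comp hv).inner hv))
    rw [← integral_add h1 (integrableOn_inner (hH.continuous_grad_comp hv) hz)]
    refine integral_congr_ae (Eventually.of_forall fun t => ?_)
    simp only [inner_sub_right]
    ring
  simp only [key _ (hw _), key _ hw']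
  exact (hlim _ (hH.continuous_grad_comp hv)).const_add _

/-- Truncation of a curve at height `R`. -/
def trunc (R : ℝ) (w : ℝ → Vec N) (t : ℝ) : Vec N := {t | ‖w t‖ ≤ R}.indicator w t

theorem norm_trunc_le {R : ℝ} (hR : 0 ≤ R) (w : ℝ → Vec N) (t : ℝ) : ‖trunc R w t‖ ≤ R := by
  by_cases h : ‖w t‖ ≤ R <;> simp [trunc, indicator, h, hR]

theorem norm_trunc_le_norm (R : ℝ) (w : ℝ → Vec N) (t : ℝ) : ‖trunc R w t‖ ≤ ‖w t‖ := by
  by_cases h : ‖w t‖ ≤ R <;> simp [trunc, indicator, h]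

theorem measurable_trunc (R : ℝ) {w : ℝ → Vec N} (hw : Measurable w) : Measurable (trunc R w) :=
  hw.indicator (measurableSet_le hw.norm measurable_const)

theorem eventually_trunc_eq (w : ℝ → Vec N) (t : ℝ) :
    ∀ᶠ n : ℕ in atTop, trunc (n : ℝ) w t = w t := by
  filter_upwards [tendsto_natCast_atTop_atTop.eventually_ge_atTop ‖w t‖] with n hn
  simp [trunc, indicator, hn]

theorem exists_bound_of_continuous_comp {f : ℝ → Vec N → ℝ}
    (hf : Continuous fun p : ℝ × Vec N => f p.1 p.2) (a b R : ℝ) :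
    ∃ C, 0 ≤ C ∧ ∀ t ∈ Icc a b, ∀ v, ‖v‖ ≤ R → ‖f t v‖ ≤ C := by
  obtain ⟨C, hC⟩ := ((isCompact_Icc (a := a) (b := b)).prod
    (isCompact_closedBall (0 : Vec N) R)).exists_bound_of_continuousOn hf.continuousOn
  refine ⟨max C 0, le_max_right _ _, fun t ht v hv => (hC (t, v) ⟨ht, ?_⟩).trans (le_max_left _ _)⟩
  simpa using hv

/-- The truncated energy is approximated from below by tangent values at continuous curves. -/
theorem IsConvexIntegrand.exists_trunc_le_tangentValue (hH : IsConvexIntegrand H Hv)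
    {w : ℝ → Vec N} (hw : IntegrableOn w (Icc a b)) (hwm : Measurable w) {R ε : ℝ} (hR : 0 ≤ R)
    (hε : 0 < ε) :
    ∃ v, Continuous v ∧ (∫ t in Icc a b, H t (trunc R w t)) - ε ≤ tangentValue a b H Hv v w := by
  obtain ⟨p, hp, hpR, hlim⟩ := exists_polyCurve_tendsto_ae (a := a) (b := b) hR
    (measurable_trunc R hwm).aestronglyMeasurable (norm_trunc_le hR w)
  obtain ⟨C, hC, hCb⟩ := exists_bound_of_continuous_comp hH.cont a b (R + 2)
  obtain ⟨C', hC', hCb'⟩ := exists_bound_of_continuous_comp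
    (f := fun t v => ‖Hv t v‖) hH.contGrad.norm a b (R + 2)
  -- At each `t` either the truncation changes nothing, or it is 0 and the gradient there vanishes.
  -- Hence the added correction is zero, and the truncated energy is the tangent value at the
  -- truncated curve.
  have hval : ∫ t in Icc a b, H t (trunc R w t) = ∫ t in Icc a b, (H t (trunc R w t) +
      inner ℝ (Hv t (trunc R w t)) (w t - trunc R w t)) := by
    refine integral_congr_ae (Eventually.of_forall fun t => ?_)
    by_cases h : ‖w t‖ ≤ R <;> simp [trunc, indicator, h, hH.grad_zero]
  have ht : Tendsto (fun k => tangentValue a b H Hv (p k) w) atTop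
      (𝓝 (∫ t in Icc a b, H t (trunc R w t))) := by
    rw [hval]
    refine tendsto_integral_of_dominated_convergence (fun t => C + C' * (‖w t‖ + (R + 2)))
      (fun k => (hH.integrableOn_tangent (hp k).continuous hw).aestronglyMeasurable)
      ((integrable_const C).add ((hw.norm.add (integrable_const _)).const_mul C'))
      (fun k => ?_) ?_
    · filter_upwards [ae_restrict_mem measurableSet_Icc] with t ht
      have h1 := hCb t ht _ (hpR k t ht)
      have h2 := hCb' t ht _ (hpR k t ht)
      rw [norm_norm] at h2
      have h3 : ‖w t - p k t‖ ≤ ‖w t‖ + (R + 2) := (norm_sub_le _ _).trans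
        (by linarith [hpR k t ht])
      refine (norm_add_le _ _).trans (add_le_add h1 ((norm_inner_le_norm _ _).trans ?_))
      exact mul_le_mul h2 h3 (norm_nonneg _) hC'
    · filter_upwards [hlim] with t ht
      have hpt : Tendsto (fun k => (t, p k t)) atTop (𝓝 (t, trunc R w t)) :=
        tendsto_const_nhds.prodMk_nhds ht
      exact ((hH.cont.tendsto _).comp hpt).add
        (((hH.contGrad.tendsto _).comp hpt).inner (tendsto_const_nhds.sub ht))
  obtain ⟨k, hk⟩ := (ht.eventually (lt_mem_nhds (sub_lt_self _ hε))).exists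
  exact ⟨p k, (hp k).continuous, hk.le⟩

theorem IsConvexIntegrand.trunc_le (hH : IsConvexIntegrand H Hv) (R : ℝ) (w : ℝ → Vec N)
    (t : ℝ) : H t (trunc R w t) ≤ H t (w t) := by
  by_cases h : ‖w t‖ ≤ R <;> simp [trunc, indicator, h, hH.zero, hH.nonneg]

theorem IsConvexIntegrand.integrableOn_trunc (hH : IsConvexIntegrand H Hv) {w : ℝ → Vec N}
    (hwm : Measurable w) {R : ℝ} (hR : 0 ≤ R) :
    IntegrableOn (fun t => H t (trunc R w t)) (Icc a b) := by
  obtain ⟨C, -, hCb⟩ := exists_bound_of_continuous_comp hH.cont a b R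
  refine (integrable_const C).mono'
    (hH.measurable_comp (measurable_trunc R hwm)).aestronglyMeasurable ?_
  filter_upwards [ae_restrict_mem measurableSet_Icc] with t ht
  exact hCb t ht _ (norm_trunc_le hR w t)

/-- Lower semicontinuity, including the integrability of the limit. -/
theorem IsConvexIntegrand.integrableOn_of_weakTendsto (hH : IsConvexIntegrand H Hv)
    {w : ℕ → ℝ → Vec N} {w' : ℝ → Vec N} (hw : ∀ m, IntegrableOn (w m) (Icc a b))
    (hw' : IntegrableOn w' (Icc a b)) (hwm : Measurable w') (hlim : WeakTendsto a b w w')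
    (hHw : ∀ m, IntegrableOn (fun t => H t (w m t)) (Icc a b)) {K : ℝ}
    (hK : ∀ m, ∫ t in Icc a b, H t (w m t) ≤ K) :
    IntegrableOn (fun t => H t (w' t)) (Icc a b) := by
  -- A truncated energy is within ε of a tangent value at the limit, and that is a limit of tangent
  -- values lying below energies at most `K`.
  have hbound : ∀ n : ℕ, ∫ t in Icc a b, H t (trunc n w' t) ≤ K := by
    intro n
    refine le_of_forall_pos_sub_le fun ε hε => ?_
    obtain ⟨v, hv, hle⟩ := hH.exists_trunc_le_tangentValue hw' hwm (Nat.cast_nonneg n) hε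
    exact hle.trans (le_of_tendsto' (hH.tendsto_tangentValue hv hw hw' hlim) fun m =>
      (hH.tangentValue_le hv (hw m) (hHw m)).trans (hK m))
  -- Fatou's lemma removes the truncation.
  refine integrable_of_tendsto (G := fun (n : ℕ) t => H t (trunc n w' t))
    (Eventually.of_forall fun t => tendsto_const_nhds.congr' ?_)
    (fun n => (hH.measurable_comp (measurable_trunc _ hwm)).aestronglyMeasurable) ?_
  · filter_upwards [eventually_trunc_eq w' t] with n hn
    rw [hn]
  · refine ne_top_of_le_ne_top (b := ENNReal.ofReal K) ENNReal.ofReal_ne_top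
      (liminf_le_of_le (by isBoundedDefault) fun c hc => ?_)
    obtain ⟨n, hn⟩ := hc.exists
    refine hn.trans ?_
    have h := hH.integrableOn_trunc (a := a) (b := b) hwm (Nat.cast_nonneg (α := ℝ) n)
    rw [← ofReal_integral_norm_eq_lintegral_enorm h]
    refine ENNReal.ofReal_le_ofReal (le_trans (le_of_eq ?_) (hbound n))
    simp only [Real.norm_of_nonneg (hH.nonneg _ _)]

/-- When the energy is finite, truncations approximate it by dominated convergence, with the
integrand itself as majorant; truncated energies are already approximated by tangent values. -/
theorem IsConvexIntegrand.exists_le_tangentValue (hH : IsConvexIntegrand H Hv)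
    {w : ℝ → Vec N} (hw : IntegrableOn w (Icc a b)) (hwm : Measurable w)
    (hHw : IntegrableOn (fun t => H t (w t)) (Icc a b)) {ε : ℝ} (hε : 0 < ε) :
    ∃ v, Continuous v ∧ (∫ t in Icc a b, H t (w t)) - ε ≤ tangentValue a b H Hv v w := by
  have ht : Tendsto (fun n : ℕ => ∫ t in Icc a b, H t (trunc n w t)) atTop
      (𝓝 (∫ t in Icc a b, H t (w t))) := by
    refine tendsto_integral_of_dominated_convergence (fun t => H t (w t))
      (fun n => (hH.measurable_comp (measurable_trunc _ hwm)).aestronglyMeasurable) hHw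
      (fun n => Eventually.of_forall fun t => ?_)
      (Eventually.of_forall fun t => tendsto_const_nhds.congr' ?_)
    · rw [Real.norm_of_nonneg (hH.nonneg _ _)]
      exact hH.trunc_le _ _ _
    · filter_upwards [eventually_trunc_eq w t] with n hn
      rw [hn]
  obtain ⟨n, hn⟩ := (ht.eventually (lt_mem_nhds (sub_lt_self _ (half_pos hε)))).exists
  obtain ⟨v, hv, hle⟩ := hH.exists_trunc_le_tangentValue hw hwm (Nat.cast_nonneg n) (half_pos hε)
  exact ⟨v, hv, by linarith⟩

/-- The mean value of a curve over `[a, b]`. -/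
def mean (a b : ℝ) (w : ℝ → Vec N) : Vec N := (b - a)⁻¹ • ∫ t in Icc a b, w t

theorem tendsto_mean {v : ℕ → ℝ → Vec N} {w : ℝ → Vec N} {g : ℝ → ℝ}
    (hv : ∀ n, AEStronglyMeasurable (v n) (volume.restrict (Icc a b)))
    (hg : IntegrableOn g (Icc a b))
    (hb : ∀ n, ∀ t ∈ Icc a b, ‖v n t‖ ≤ g t)
    (hlim : ∀ᵐ t ∂(volume.restrict (Icc a b)), Tendsto (fun n => v n t) atTop (𝓝 (w t))) :
    Tendsto (fun n => mean a b (v n)) atTop (𝓝 (mean a b w)) := by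
  refine (tendsto_integral_of_dominated_convergence g hv hg (fun n => ?_) hlim).const_smul _
  filter_upwards [ae_restrict_mem measurableSet_Icc] with t ht using hb n t ht

theorem norm_mean_le (hab : a ≤ b) (w : ℝ → Vec N) :
    ‖mean a b w‖ ≤ (b - a)⁻¹ * ∫ t in Icc a b, ‖w t‖ := by
  rw [mean, norm_smul, Real.norm_of_nonneg (inv_nonneg.2 (sub_nonneg.2 hab))]
  exact mul_le_mul_of_nonneg_left (norm_integral_le_integral_norm _)
    (inv_nonneg.2 (sub_nonneg.2 hab))

/-- Bounded curves are approximated in energy by polynomial curves, up to subtracting means. -/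
theorem exists_polyCurve_sub_mean_of_bounded (hab : a < b)
    (hH : Continuous fun p : ℝ × Vec N => H p.1 p.2) {v : ℝ → Vec N} (hv : Measurable v) {R : ℝ}
    (hR : 0 ≤ R) (hvR : ∀ t, ‖v t‖ ≤ R) {ε : ℝ} (hε : 0 < ε) :
    ∃ p, IsPolyCurve p ∧ (∫ t in Icc a b, ‖(p t - mean a b p) - (v t - mean a b v)‖ ≤ ε) ∧
      ∫ t in Icc a b, H t (p t - mean a b p) ≤ (∫ t in Icc a b, H t (v t - mean a b v)) + ε := by
  obtain ⟨p, hp, hpR, hlim⟩ := exists_polyCurve_tendsto_ae (a := a) (b := b) hR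
    hv.aestronglyMeasurable hvR
  have hmean := tendsto_mean (fun n => (hp n).continuous.aestronglyMeasurable)
    (integrableOn_of_continuous continuous_const) hpR hlim
  have hpm : ∀ k, ‖mean a b (p k)‖ ≤ R + 2 := by
    intro k
    refine (norm_mean_le hab.le _).trans ?_
    have h1 : ∫ t in Icc a b, ‖p k t‖ ≤ ∫ _t in Icc a b, (R + 2) :=
      setIntegral_mono_on (integrableOn_of_continuous (hp k).continuous.norm)
        (integrable_const _) measurableSet_Icc (hpR k)
    rw [setIntegral_const, Real.volume_real_Icc_of_le hab.le, smul_eq_mul] at h1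
    rw [inv_mul_le_iff₀ (sub_pos.2 hab)]
    exact h1
  have hvm : ‖mean a b v‖ ≤ R + 2 :=
    le_of_tendsto' hmean.norm hpm
  have hz : ∀ k, ∀ t ∈ Icc a b, ‖p k t - mean a b (p k)‖ ≤ 2 * (R + 2) := fun k t ht =>
    (norm_sub_le _ _).trans (by linarith [hpm k, hpR k t ht])
  have hzc : ∀ k, Continuous fun t => p k t - mean a b (p k) := fun k =>
    (hp k).continuous.sub continuous_const
  obtain ⟨C, hC, hCb⟩ := exists_bound_of_continuous_comp hH a b (2 * (R + 2))
  have h1 : Tendsto (fun k => ∫ t in Icc a b, H t (p k t - mean a b (p k))) atTop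
      (𝓝 (∫ t in Icc a b, H t (v t - mean a b v))) := by
    refine tendsto_integral_of_dominated_convergence (fun _ => C)
      (fun k => (hH.comp (continuous_id.prodMk (hzc k))).aestronglyMeasurable)
      (integrable_const C) (fun k => ?_) ?_
    · filter_upwards [ae_restrict_mem measurableSet_Icc] with t ht
      exact hCb t ht _ (hz k t ht)
    · filter_upwards [hlim] with t ht
      exact (hH.tendsto _).comp (tendsto_const_nhds.prodMk_nhds (ht.sub hmean))
  have h2 : Tendsto (fun k => ∫ t in Icc a b, ‖(p k t - mean a b (p k)) - (v t - mean a b v)‖)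
      atTop (𝓝 (∫ _t in Icc a b, (0 : ℝ))) := by
    refine tendsto_integral_of_dominated_convergence (fun _ => 4 * (R + 2))
      (fun k => ((hzc k).measurable.sub (hv.sub_const _)).norm.aestronglyMeasurable)
      (integrable_const _) (fun k => ?_) ?_
    · filter_upwards [ae_restrict_mem measurableSet_Icc] with t ht
      rw [norm_norm]
      have h3 : ‖v t - mean a b v‖ ≤ 2 * (R + 2) :=
        (norm_sub_le _ _).trans (by linarith [hvR t])
      exact (norm_sub_le _ _).trans (by linarith [hz k t ht])
    · filter_upwards [hlim] with t ht
      have := ((ht.sub hmean).sub (tendsto_const_nhds (x := v t - mean a b v))).norm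
      simpa using this
  rw [integral_zero] at h2
  obtain ⟨k, hk1, hk2⟩ := ((h1.eventually (gt_mem_nhds (lt_add_of_pos_right _ hε))).and
    (h2.eventually (gt_mem_nhds hε))).exists
  exact ⟨p k, hp k, hk2.le, hk1.le⟩

theorem integral_norm_sub_le {u v w : ℝ → Vec N} (hu : IntegrableOn u (Icc a b))
    (hv : IntegrableOn v (Icc a b)) (hw : IntegrableOn w (Icc a b)) :
    ∫ t in Icc a b, ‖u t - w t‖ ≤
      (∫ t in Icc a b, ‖u t - v t‖) + ∫ t in Icc a b, ‖v t - w t‖ := by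
  have h1 : IntegrableOn (fun t => ‖u t - v t‖) (Icc a b) := (hu.sub hv).norm
  have h2 : IntegrableOn (fun t => ‖v t - w t‖) (Icc a b) := (hv.sub hw).norm
  rw [← integral_add h1 h2]
  exact integral_mono (hu.sub hw).norm (h1.add h2)
    fun t => norm_sub_le_norm_sub_add_norm_sub _ _ _

/-- Curves of finite energy with mean zero are approximated in energy by polynomial curves with
mean zero. -/
theorem exists_polyCurve_sub_mean (hab : a < b) {G : Vec N → ℝ} (hG : IsGrowthFunction G)
    (hH : Continuous fun p : ℝ × Vec N => H p.1 p.2) {β : ℝ → ℝ} {A : ℝ} (hA : 0 ≤ A)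
    (hβ : IntegrableOn β (Icc a b)) (hgr : ∀ t v, ‖H t v‖ ≤ β t + A * G v)
    {w : ℝ → Vec N} (hw : IntegrableOn w (Icc a b)) (hwm : Measurable w)
    (hGw : IntegrableOn (fun t => G (w t)) (Icc a b)) (hmean : mean a b w = 0)
    {ε : ℝ} (hε : 0 < ε) :
    ∃ p, IsPolyCurve p ∧ (∫ t in Icc a b, ‖(p t - mean a b p) - w t‖ ≤ ε) ∧
      ∫ t in Icc a b, H t (p t - mean a b p) ≤ (∫ t in Icc a b, H t (w t)) + ε := by
  have htm : ∀ n : ℕ, Measurable (trunc n w) := fun n => measurable_trunc _ hwm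
  have hti : ∀ n : ℕ, IntegrableOn (trunc (n : ℝ) w) (Icc a b) := fun n =>
    hw.norm.mono' (htm n).aestronglyMeasurable
      (Eventually.of_forall fun t => norm_trunc_le_norm _ _ _)
  have hlim : ∀ t, Tendsto (fun n : ℕ => trunc n w t) atTop (𝓝 (w t)) := fun t =>
    tendsto_const_nhds.congr' (by filter_upwards [eventually_trunc_eq w t] with n hn; rw [hn])
  have hml := tendsto_mean (fun n => (htm n).aestronglyMeasurable) hw.norm
    (fun n t _ => norm_trunc_le_norm _ w t) (Eventually.of_forall hlim)
  rw [hmean] at hml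
  set M := (b - a)⁻¹ * ∫ t in Icc a b, ‖w t‖
  have hM : ∀ n : ℕ, ‖mean a b (trunc n w)‖ ≤ M := fun n => by
    refine (norm_mean_le hab.le _).trans (mul_le_mul_of_nonneg_left ?_
      (inv_nonneg.2 (sub_nonneg.2 hab.le)))
    exact integral_mono (hti n).norm hw.norm fun t => norm_trunc_le_norm _ w t
  -- The means subtracted from the truncations stay bounded, so by the shift property they change
  -- the growth bound only by a constant factor. This gives an integrable majorant.
  obtain ⟨A', hA', hsh⟩ := hG.shift M
  have hGt : ∀ (n : ℕ) t, G (trunc n w t) ≤ G (w t) := fun n t => by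
    by_cases h : ‖w t‖ ≤ n <;> simp [trunc, indicator, h, hG.zero, hG.nonneg]
  have h1 : Tendsto (fun n : ℕ => ∫ t in Icc a b, H t (trunc n w t - mean a b (trunc n w))) atTop
      (𝓝 (∫ t in Icc a b, H t (w t))) := by
    refine tendsto_integral_of_dominated_convergence
      (fun t => β t + A * (A' * (1 + G (w t))))
      (fun n => (hH.measurable.comp (measurable_id.prodMk
        ((htm n).sub_const _))).aestronglyMeasurable)
      (hβ.add ((((integrable_const 1).add hGw).const_mul A').const_mul A))
      (fun n => Eventually.of_forall fun t => ?_) (Eventually.of_forall fun t => ?_)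
    · refine (hgr _ _).trans ?_
      gcongr
      rw [sub_eq_add_neg]
      refine (hsh _ _ (by rw [norm_neg]; exact hM n)).trans ?_
      gcongr
      exact hGt n t
    · have := (hlim t).sub hml
      rw [sub_zero] at this
      exact (hH.tendsto _).comp (tendsto_const_nhds.prodMk_nhds this)
  have h2 : Tendsto (fun n : ℕ => ∫ t in Icc a b, ‖(trunc n w t - mean a b (trunc n w)) - w t‖)
      atTop (𝓝 (∫ _t in Icc a b, (0 : ℝ))) := by
    refine tendsto_integral_of_dominated_convergence (fun t => 2 * ‖w t‖ + M)
      (fun n => (((htm n).sub_const _).sub hwm).norm.aestronglyMeasurable)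
      ((hw.norm.const_mul 2).add (integrable_const _))
      (fun n => Eventually.of_forall fun t => ?_) (Eventually.of_forall fun t => ?_)
    · rw [norm_norm]
      have h3 := norm_sub_le (trunc n w t - mean a b (trunc n w)) (w t)
      have h4 := norm_sub_le (trunc n w t) (mean a b (trunc n w))
      linarith [hM n, norm_trunc_le_norm n w t]
    · have := (((hlim t).sub hml).sub (tendsto_const_nhds (x := w t))).norm
      simpa using this
  rw [integral_zero] at h2
  obtain ⟨n, hn1, hn2⟩ := ((h1.eventually (gt_mem_nhds (lt_add_of_pos_right _ (half_pos hε)))).and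
    (h2.eventually (gt_mem_nhds (half_pos hε)))).exists
  obtain ⟨p, hp, hp1, hp2⟩ := exists_polyCurve_sub_mean_of_bounded hab hH (htm n)
    (Nat.cast_nonneg n) (norm_trunc_le (Nat.cast_nonneg n) w) (half_pos hε)
  refine ⟨p, hp, ?_, by linarith⟩
  refine (integral_norm_sub_le (u := fun t => p t - mean a b p)
    (v := fun t => trunc n w t - mean a b (trunc n w))
    (integrableOn_of_continuous (hp.continuous.sub continuous_const))
    ((hti n).sub (integrable_const _)) hw).trans ?_
  linarith

end

section

/-! ### The kinetic energy -/

variable {N : ℕ} {a b Λ : ℝ} {G : Vec N → ℝ}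
  {F : ℝ → Vec N → Vec N → ℝ} {Fx Fv : ℝ → Vec N → Vec N → Vec N}

/-- The kinetic part `F(t,x,v)` of the Lagrangian, with partial gradients `Fx` and `Fv`. -/
structure IsKinetic (a b : ℝ) (G : Vec N → ℝ) (Λ : ℝ) (F : ℝ → Vec N → Vec N → ℝ)
    (Fx Fv : ℝ → Vec N → Vec N → Vec N) : Prop where
  cont : Continuous fun p : ℝ × Vec N × Vec N => F p.1 p.2.1 p.2.2
  contX : Continuous fun p : ℝ × Vec N × Vec N => Fx p.1 p.2.1 p.2.2
  contV : Continuous fun p : ℝ × Vec N × Vec N => Fv p.1 p.2.1 p.2.2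
  hasFDeriv : ∀ t x v, HasFDerivAt (fun q : Vec N × Vec N => F t q.1 q.2)
    ((innerSL ℝ (Fx t x v)).coprod (innerSL ℝ (Fv t x v))) (x, v)
  convex : ∀ t x, ConvexOn ℝ univ (F t x)
  zero : ∀ t x, F t x 0 = 0
  pos : 0 < Λ
  lower : ∀ t x v, Λ * G v ≤ F t x v
  growth : ∀ M : ℝ, ∃ (β : ℝ → ℝ) (A : ℝ), IntegrableOn β (Icc a b) ∧ (∀ t, 0 ≤ β t) ∧ 0 ≤ A ∧
    ∀ t x v, ‖x‖ ≤ M → ‖F t x v‖ ≤ β t + A * G v ∧ ‖Fx t x v‖ ≤ β t + A * G v ∧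
      ‖Fv t x v‖ ≤ β t + A * G v

theorem IsKinetic.hasGradV (hF : IsKinetic a b G Λ F Fx Fv) (t : ℝ) (x v : Vec N) :
    HasGradientAt (F t x) (Fv t x v) v := by
  rw [hasGradientAt_iff_hasFDerivAt]
  have h := (hF.hasFDeriv t x v).comp v (hasFDerivAt_prodMk_right (𝕜 := ℝ) x v)
  refine h.congr_fderiv ?_
  ext z
  simp

theorem IsKinetic.hasGradX (hF : IsKinetic a b G Λ F Fx Fv) (t : ℝ) (x v : Vec N) :
    HasGradientAt (fun y => F t y v) (Fx t x v) x := by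
  rw [hasGradientAt_iff_hasFDerivAt]
  have h := (hF.hasFDeriv t x v).comp x (hasFDerivAt_prodMk_left (𝕜 := ℝ) x v)
  refine h.congr_fderiv ?_
  ext z
  simp

/-- Freezing the positions along a continuous curve makes the lower semicontinuity results for
convex integrands available. -/
theorem IsKinetic.slice (hF : IsKinetic a b G Λ F Fx Fv) (hG : IsGrowthFunction G)
    {u : ℝ → Vec N} (hu : Continuous u) :
    IsConvexIntegrand (fun t v => F t (u t) v) (fun t v => Fv t (u t) v) where
  cont := hF.cont.comp (continuous_fst.prodMk ((hu.comp continuous_fst).prodMk continuous_snd))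
  contGrad := hF.contV.comp
    (continuous_fst.prodMk ((hu.comp continuous_fst).prodMk continuous_snd))
  hasGrad t v := hF.hasGradV t (u t) v
  convex t := hF.convex t (u t)
  nonneg t v := (mul_nonneg hF.pos.le (hG.nonneg v)).trans (hF.lower t (u t) v)
  zero t := hF.zero t (u t)

/-- The kinetic energy along the curve `u` with velocity `w`. -/
def kin (a b : ℝ) (F : ℝ → Vec N → Vec N → ℝ) (u w : ℝ → Vec N) : ℝ :=
  ∫ t in Icc a b, F t (u t) (w t)

/-- The differential of the kinetic energy in the direction `φ` with velocity `ψ`. -/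
def dkin (a b : ℝ) (Fx Fv : ℝ → Vec N → Vec N → Vec N) (u w φ ψ : ℝ → Vec N) : ℝ :=
  ∫ t in Icc a b, (inner ℝ (Fx t (u t) (w t)) (φ t) + inner ℝ (Fv t (u t) (w t)) (ψ t))

theorem IsKinetic.abs_sub_le {t M B : ℝ} {x y v : Vec N}
    (hF : IsKinetic a b G Λ F Fx Fv) (hB : ∀ x, ‖x‖ ≤ M → ‖Fx t x v‖ ≤ B)
    (hx : ‖x‖ ≤ M) (hy : ‖y‖ ≤ M) : |F t x v - F t y v| ≤ B * ‖x - y‖ := by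
  have h := (convex_closedBall (0 : Vec N) M).norm_image_sub_le_of_norm_hasFDerivWithin_le
    (f := fun y => F t y v) (f' := fun y => InnerProductSpace.toDual ℝ _ (Fx t y v)) (C := B)
    (fun z _ => (hF.hasGradX t z v).hasFDerivAt.hasFDerivWithinAt)
    (fun z hz => by rw [LinearIsometryEquiv.norm_map]; exact hB z (by simpa using hz))
    (x := y) (y := x) (by simpa using hy) (by simpa using hx)
  simpa using h

theorem IsKinetic.continuous_comp (hF : IsKinetic a b G Λ F Fx Fv) {u w : ℝ → Vec N}
    (hu : Continuous u) (hw : Continuous w) : Continuous fun t => F t (u t) (w t) :=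
  hF.cont.comp (continuous_id.prodMk (hu.prodMk hw))

theorem integrableOn_growth {β : ℝ → ℝ} {A : ℝ} {w : ℝ → Vec N} (hβ : IntegrableOn β (Icc a b))
    (hGw : IntegrableOn (fun t => G (w t)) (Icc a b)) :
    IntegrableOn (fun t => β t + A * G (w t)) (Icc a b) :=
  hβ.add (hGw.const_mul A)

theorem IsKinetic.integrableOn (hF : IsKinetic a b G Λ F Fx Fv) {u w : ℝ → Vec N}
    (hu : Continuous u) (hw : Measurable w) (hGw : IntegrableOn (fun t => G (w t)) (Icc a b)) :
    IntegrableOn (fun t => F t (u t) (w t)) (Icc a b) := by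
  obtain ⟨M, hM⟩ := (isCompact_Icc (a := a) (b := b)).exists_bound_of_continuousOn hu.continuousOn
  obtain ⟨β, A, hβ, -, -, hb⟩ := hF.growth M
  refine (integrableOn_growth (A := A) hβ hGw).mono' (hF.cont.measurable.comp
    (measurable_id.prodMk (hu.measurable.prodMk hw))).aestronglyMeasurable ?_
  filter_upwards [ae_restrict_mem measurableSet_Icc] with t ht using (hb t _ _ (hM t ht)).1

theorem IsKinetic.integrableOn_gradX (hF : IsKinetic a b G Λ F Fx Fv) {u w : ℝ → Vec N}
    (hu : Continuous u) (hw : Measurable w) (hGw : IntegrableOn (fun t => G (w t)) (Icc a b)) :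
    IntegrableOn (fun t => Fx t (u t) (w t)) (Icc a b) := by
  obtain ⟨M, hM⟩ := (isCompact_Icc (a := a) (b := b)).exists_bound_of_continuousOn hu.continuousOn
  obtain ⟨β, A, hβ, -, -, hb⟩ := hF.growth M
  refine (integrableOn_growth (A := A) hβ hGw).mono' (hF.contX.measurable.comp
    (measurable_id.prodMk (hu.measurable.prodMk hw))).aestronglyMeasurable ?_
  filter_upwards [ae_restrict_mem measurableSet_Icc] with t ht using (hb t _ _ (hM t ht)).2.1

theorem IsKinetic.integrableOn_gradV (hF : IsKinetic a b G Λ F Fx Fv) {u w : ℝ → Vec N}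
    (hu : Continuous u) (hw : Measurable w) (hGw : IntegrableOn (fun t => G (w t)) (Icc a b)) :
    IntegrableOn (fun t => Fv t (u t) (w t)) (Icc a b) := by
  obtain ⟨M, hM⟩ := (isCompact_Icc (a := a) (b := b)).exists_bound_of_continuousOn hu.continuousOn
  obtain ⟨β, A, hβ, -, -, hb⟩ := hF.growth M
  refine (integrableOn_growth (A := A) hβ hGw).mono' (hF.contV.measurable.comp
    (measurable_id.prodMk (hu.measurable.prodMk hw))).aestronglyMeasurable ?_
  filter_upwards [ae_restrict_mem measurableSet_Icc] with t ht using (hb t _ _ (hM t ht)).2.2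

theorem integrableOn_inner_right {ξ w : ℝ → Vec N} (hξ : IntegrableOn ξ (Icc a b))
    (hw : Continuous w) : IntegrableOn (fun t => inner ℝ (ξ t) (w t)) (Icc a b) := by
  simpa only [real_inner_comm] using integrableOn_inner hw hξ

theorem IsKinetic.integrableOn_dkin (hF : IsKinetic a b G Λ F Fx Fv) {u w φ ψ : ℝ → Vec N}
    (hu : Continuous u) (hw : Measurable w) (hGw : IntegrableOn (fun t => G (w t)) (Icc a b))
    (hφ : Continuous φ) (hψ : Continuous ψ) :
    IntegrableOn (fun t => inner ℝ (Fx t (u t) (w t)) (φ t) + inner ℝ (Fv t (u t) (w t)) (ψ t))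
      (Icc a b) :=
  (integrableOn_inner_right (hF.integrableOn_gradX hu hw hGw) hφ).add
    (integrableOn_inner_right (hF.integrableOn_gradV hu hw hGw) hψ)

/-- The shift property, a consequence of Δ₂, makes finiteness of the modular stable under bounded
perturbations of the velocity. -/
theorem IsGrowthFunction.integrableOn_add (hG : IsGrowthFunction G) {w ψ : ℝ → Vec N}
    (hw : Measurable w) (hGw : IntegrableOn (fun t => G (w t)) (Icc a b)) (hψ : Continuous ψ) :
    IntegrableOn (fun t => G (w t + ψ t)) (Icc a b) := by
  obtain ⟨M, hM⟩ := (isCompact_Icc (a := a) (b := b)).exists_bound_of_continuousOn hψ.continuousOn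
  obtain ⟨A, -, hA⟩ := hG.shift M
  refine (((integrable_const 1).add hGw).const_mul A).mono'
    (hG.cont.measurable.comp (hw.add hψ.measurable)).aestronglyMeasurable ?_
  filter_upwards [ae_restrict_mem measurableSet_Icc] with t ht
  rw [Real.norm_of_nonneg (hG.nonneg _)]
  exact hA _ _ (hM t ht)

/-- Replacing the positions by their uniform limit does not change the kinetic energy in the
limit, when the velocities have bounded energy. -/
theorem IsKinetic.tendsto_kin_sub (hF : IsKinetic a b G Λ F Fx Fv) (hG : IsGrowthFunction G)
    {x : ℕ → ℝ → Vec N} {y : ℝ → Vec N} {v : ℕ → ℝ → Vec N} {M K : ℝ}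
    (hx : ∀ m, Continuous (x m)) (hy : Continuous y) (hv : ∀ m, Continuous (v m))
    (hxM : ∀ m, ∀ t ∈ Icc a b, ‖x m t‖ ≤ M) (hyM : ∀ t ∈ Icc a b, ‖y t‖ ≤ M)
    (hlim : TendstoUniformlyOn x y atTop (Icc a b))
    (hK : ∀ m, ∫ t in Icc a b, G (v m t) ≤ K) :
    Tendsto (fun m => kin a b F (x m) (v m) - kin a b F y (v m)) atTop (𝓝 0) := by
  obtain ⟨β, A, hβ, hβ0, hA, hb⟩ := hF.growth M
  -- `B` bounds the integral over `[a, b]` of β + A·G(v_m), which is a Lipschitz constant of F in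
  -- the position at time `t`.
  set B := (∫ t in Icc a b, β t) + A * K with hB
  have hK0 : 0 ≤ K := (integral_nonneg fun t => hG.nonneg (v 0 t)).trans (hK 0)
  have hB0 : 0 ≤ B := add_nonneg (integral_nonneg hβ0) (mul_nonneg hA hK0)
  rw [Metric.tendsto_atTop]
  intro ε hε
  obtain ⟨n, hn⟩ := eventually_atTop.1
    (Metric.tendstoUniformlyOn_iff.1 hlim (ε / (B + 1)) (by positivity))
  refine ⟨n, fun m hm => ?_⟩
  have hGi : IntegrableOn (fun t => G (v m t)) (Icc a b) :=
    integrableOn_of_continuous (hG.cont.comp (hv m))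
  rw [dist_zero_right, kin, kin, ← integral_sub
    (integrableOn_of_continuous (hF.continuous_comp (hx m) (hv m)))
    (integrableOn_of_continuous (hF.continuous_comp hy (hv m)))]
  have h1 : ‖∫ t in Icc a b, (F t (x m t) (v m t) - F t (y t) (v m t))‖ ≤
      ∫ t in Icc a b, (β t + A * G (v m t)) * (ε / (B + 1)) := by
    refine norm_integral_le_of_norm_le ((integrableOn_growth hβ hGi).mul_const _) ?_
    filter_upwards [ae_restrict_mem measurableSet_Icc] with t ht
    refine (hF.abs_sub_le (fun z hz => (hb t z _ hz).2.1) (hxM m t ht) (hyM t ht)).trans ?_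
    have h2 := (hn m hm t ht).le
    rw [dist_comm, dist_eq_norm] at h2
    exact mul_le_mul_of_nonneg_left h2 (add_nonneg (hβ0 t) (mul_nonneg hA (hG.nonneg _)))
  refine h1.trans_lt ?_
  rw [integral_mul_const, integral_add hβ (hGi.const_mul A), integral_const_mul]
  calc ((∫ t in Icc a b, β t) + A * ∫ t in Icc a b, G (v m t)) * (ε / (B + 1))
      ≤ B * (ε / (B + 1)) := by
        gcongr
        rw [hB]
        gcongr
        exact hK m
    _ < (B + 1) * (ε / (B + 1)) := by gcongr; linarith
    _ = ε := by field

/-- The growth bound cut off on velocities of norm at most `L`. -/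
def excess (G : Vec N → ℝ) (β : ℝ → ℝ) (A L t : ℝ) (v : Vec N) : ℝ :=
  if ‖v‖ ≤ L then 0 else β t + A * G v

/-- Mean value inequality for θ ↦ F(t, x + θφ, v + θψ) minus its linear part: the derivative pairs
the increments of the two gradients with φ and ψ. -/
theorem IsKinetic.abs_remainder_le (hF : IsKinetic a b G Λ F Fx Fv) {t s D Q : ℝ}
    {x v φ ψ : Vec N} (hs : 0 ≤ s) (hφ : ‖φ‖ ≤ Q) (hψ : ‖ψ‖ ≤ Q)
    (hX : ∀ θ ∈ Icc (0 : ℝ) s, ‖Fx t (x + θ • φ) (v + θ • ψ) - Fx t x v‖ ≤ D)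
    (hV : ∀ θ ∈ Icc (0 : ℝ) s, ‖Fv t (x + θ • φ) (v + θ • ψ) - Fv t x v‖ ≤ D) :
    |F t (x + s • φ) (v + s • ψ) - F t x v
      - s * (inner ℝ (Fx t x v) φ + inner ℝ (Fv t x v) ψ)| ≤ s * (2 * D * Q) := by
  have hQ : 0 ≤ Q := (norm_nonneg _).trans hφ
  set l := inner ℝ (Fx t x v) φ + inner ℝ (Fv t x v) ψ with hl
  have hd : ∀ θ : ℝ, HasDerivAt
      (fun θ : ℝ => F t (x + θ • φ) (v + θ • ψ) - θ * l)
      ((inner ℝ (Fx t (x + θ • φ) (v + θ • ψ)) φ + inner ℝ (Fv t (x + θ • φ) (v + θ • ψ)) ψ)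
        - l) θ := by
    intro θ
    have h1 : HasDerivAt (fun θ : ℝ => x + θ • φ) φ θ := by
      simpa using ((hasDerivAt_id θ).smul_const φ).const_add x
    have h2 : HasDerivAt (fun θ : ℝ => v + θ • ψ) ψ θ := by
      simpa using ((hasDerivAt_id θ).smul_const ψ).const_add v
    have h3 := (hF.hasFDeriv t (x + θ • φ) (v + θ • ψ)).comp_hasDerivAt θ (h1.prodMk h2)
    have h4 := h3.fun_sub ((hasDerivAt_id θ).mul_const l)
    simpa [Function.comp_def] using h4
  have h := norm_image_sub_le_of_norm_deriv_le_segment' (a := 0) (b := s) (C := 2 * D * Q)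
    (fun θ _ => (hd θ).hasDerivWithinAt) (fun θ hθ => ?_) s ⟨hs, le_rfl⟩
  · simp only [Real.norm_eq_abs, zero_smul, add_zero, zero_mul, sub_zero] at h
    rw [mul_comm s (2 * D * Q)]
    convert h using 2
    ring
  · have hθ' := Ico_subset_Icc_self hθ
    have e : (inner ℝ (Fx t (x + θ • φ) (v + θ • ψ)) φ
        + inner ℝ (Fv t (x + θ • φ) (v + θ • ψ)) ψ) - l =
        inner ℝ (Fx t (x + θ • φ) (v + θ • ψ) - Fx t x v) φ
        + inner ℝ (Fv t (x + θ • φ) (v + θ • ψ) - Fv t x v) ψ := by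
      rw [hl, inner_sub_left, inner_sub_left]
      ring
    rw [e]
    have hD : 0 ≤ D := (norm_nonneg _).trans (hX θ hθ')
    have h1 := (norm_inner_le_norm (𝕜 := ℝ) (Fx t (x + θ • φ) (v + θ • ψ) - Fx t x v) φ).trans
      (mul_le_mul (hX θ hθ') hφ (norm_nonneg _) hD)
    have h2 := (norm_inner_le_norm (𝕜 := ℝ) (Fv t (x + θ • φ) (v + θ • ψ) - Fv t x v) ψ).trans
      (mul_le_mul (hV θ hθ') hψ (norm_nonneg _) hD)
    exact (norm_add_le _ _).trans (by linarith)

theorem exists_delta_of_continuous {f : ℝ → Vec N → Vec N → Vec N}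
    (hf : Continuous fun p : ℝ × Vec N × Vec N => f p.1 p.2.1 p.2.2) (a b R : ℝ) {ε : ℝ}
    (hε : 0 < ε) : ∃ δ > 0, ∀ t ∈ Icc a b, ∀ x v x' v' : Vec N, ‖x‖ ≤ R → ‖v‖ ≤ R → ‖x'‖ ≤ R →
      ‖v'‖ ≤ R → ‖x' - x‖ < δ → ‖v' - v‖ < δ → ‖f t x' v' - f t x v‖ ≤ ε := by
  have hu := ((isCompact_Icc (a := a) (b := b)).prod ((isCompact_closedBall (0 : Vec N) R).prod
    (isCompact_closedBall (0 : Vec N) R))).uniformContinuousOn_of_continuous hf.continuousOn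
  obtain ⟨δ, hδ, h⟩ := Metric.uniformContinuousOn_iff.1 hu ε hε
  refine ⟨δ, hδ, fun t ht x v x' v' hx hv hx' hv' h1 h2 => ?_⟩
  have := h (t, x', v') ⟨ht, by simpa using hx', by simpa using hv'⟩ (t, x, v)
    ⟨ht, by simpa using hx, by simpa using hv⟩ (by
      simp only [Prod.dist_eq, dist_self]
      rw [dist_eq_norm, dist_eq_norm]
      exact max_lt hδ (max_lt h1 h2))
  rw [dist_eq_norm] at this
  exact this.le

/-- The first order remainder of `F` is small, uniformly up to an excess at large velocities. -/
theorem IsKinetic.exists_remainder_le (hF : IsKinetic a b G Λ F Fx Fv) (hG : IsGrowthFunction G)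
    {M Q : ℝ} (hM : 0 ≤ M) (hQ : 0 ≤ Q) :
    ∃ (β : ℝ → ℝ) (A : ℝ), IntegrableOn β (Icc a b) ∧ (∀ t, 0 ≤ β t) ∧ 0 ≤ A ∧
      ∀ L ε : ℝ, 0 < ε → ∃ s₀ : ℝ, 0 < s₀ ∧ ∀ s, 0 ≤ s → s ≤ s₀ → ∀ t ∈ Icc a b,
        ∀ x v φ ψ : Vec N, ‖x‖ ≤ M → ‖φ‖ ≤ Q → ‖ψ‖ ≤ Q →
        |F t (x + s • φ) (v + s • ψ) - F t x v
          - s * (inner ℝ (Fx t x v) φ + inner ℝ (Fv t x v) ψ)| ≤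
          s * (ε + excess G β A L t v) := by
  obtain ⟨β, A, hβ, hβ0, hA, hb⟩ := hF.growth (M + Q)
  obtain ⟨A', hA', hsh⟩ := hG.shift Q
  -- These come from the crude bound for large velocities, where both gradients are estimated by
  -- growth at `v` and at the shifted velocity. They do not depend on `L`, which matters because `L`
  -- is later chosen in terms of them.
  refine ⟨fun t => (2 * Q) * (2 * β t + A * A'), (2 * Q) * (A * A' + A),
    ((hβ.const_mul 2).add (integrable_const _)).const_mul _, fun t => ?_, by positivity,
    fun L ε hε => ?_⟩
  · have := hβ0 t
    positivity
  have hη : 0 < ε / (2 * (Q + 1)) := by positivity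
  have hR : 0 ≤ M + Q + (max L 0 + Q) := by positivity
  obtain ⟨δ₁, hδ₁, h₁⟩ := exists_delta_of_continuous hF.contX a b (M + Q + (max L 0 + Q)) hη
  obtain ⟨δ₂, hδ₂, h₂⟩ := exists_delta_of_continuous hF.contV a b (M + Q + (max L 0 + Q)) hη
  -- The step is small enough that positions and velocities move by less than both moduli of
  -- continuity, and at most 1 so that they move by at most `Q`.
  refine ⟨min 1 (min δ₁ δ₂ / (2 * (Q + 1))), by positivity,
    fun s hs hs₀ t ht x v φ ψ hx hφ hψ => ?_⟩
  have hs1 : s ≤ 1 := hs₀.trans (min_le_left _ _)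
  have hsm : ∀ θ ∈ Icc (0 : ℝ) s, ∀ z : Vec N, ‖z‖ ≤ Q → ‖θ • z‖ ≤ Q ∧ ‖θ • z‖ < min δ₁ δ₂ := by
    intro θ hθ z hz
    rw [norm_smul, Real.norm_of_nonneg hθ.1]
    constructor
    · calc θ * ‖z‖ ≤ 1 * Q := mul_le_mul (hθ.2.trans hs1) hz (norm_nonneg _) zero_le_one
        _ = Q := one_mul Q
    · have hmin : 0 < min δ₁ δ₂ := lt_min hδ₁ hδ₂
      calc θ * ‖z‖ ≤ (min δ₁ δ₂ / (2 * (Q + 1))) * (Q + 1) :=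
            mul_le_mul (hθ.2.trans (hs₀.trans (min_le_right _ _))) (by linarith)
              (norm_nonneg _) (by positivity)
        _ = min δ₁ δ₂ / 2 := by field
        _ < _ := half_lt_self hmin
  have hxθ : ∀ θ ∈ Icc (0 : ℝ) s, ‖x + θ • φ‖ ≤ M + Q := fun θ hθ =>
    (norm_add_le _ _).trans (add_le_add hx (hsm θ hθ φ hφ).1)
  -- Below the level everything stays in a compact set and uniform continuity gives ε; above it the
  -- excess pays for the growth bound.
  by_cases hv : ‖v‖ ≤ L
  · have hL0 : L ≤ max L 0 := le_max_left _ _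
    have hL1 : 0 ≤ max L 0 := le_max_right _ _
    have hvθ : ∀ θ ∈ Icc (0 : ℝ) s, ‖v + θ • ψ‖ ≤ max L 0 + Q := fun θ hθ =>
      (norm_add_le _ _).trans (add_le_add (hv.trans hL0) (hsm θ hθ ψ hψ).1)
    refine (hF.abs_remainder_le hs hφ hψ (D := ε / (2 * (Q + 1))) (fun θ hθ => ?_)
      (fun θ hθ => ?_)).trans ?_
    · refine h₁ t ht _ _ _ _ (by linarith) (by linarith)
        ((hxθ θ hθ).trans (by linarith)) ((hvθ θ hθ).trans (by linarith)) ?_ ?_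
      · rw [add_sub_cancel_left]
        exact (hsm θ hθ φ hφ).2.trans_le (min_le_left _ _)
      · rw [add_sub_cancel_left]
        exact (hsm θ hθ ψ hψ).2.trans_le (min_le_left _ _)
    · refine h₂ t ht _ _ _ _ (by linarith) (by linarith)
        ((hxθ θ hθ).trans (by linarith)) ((hvθ θ hθ).trans (by linarith)) ?_ ?_
      · rw [add_sub_cancel_left]
        exact (hsm θ hθ φ hφ).2.trans_le (min_le_right _ _)
      · rw [add_sub_cancel_left]
        exact (hsm θ hθ ψ hψ).2.trans_le (min_le_right _ _)
    · rw [excess, if_pos hv, add_zero]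
      refine mul_le_mul_of_nonneg_left ?_ hs
      calc 2 * (ε / (2 * (Q + 1))) * Q ≤ 2 * (ε / (2 * (Q + 1))) * (Q + 1) := by
            gcongr
            linarith
        _ = ε := by field
  · have hGθ : ∀ θ ∈ Icc (0 : ℝ) s, G (v + θ • ψ) ≤ A' * (1 + G v) := fun θ hθ =>
      hsh _ _ (hsm θ hθ ψ hψ).1
    have hbd : ∀ {p q : Vec N} {θ : ℝ}, θ ∈ Icc (0 : ℝ) s →
        ‖p‖ ≤ β t + A * G (v + θ • ψ) → ‖q‖ ≤ β t + A * G v →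
        ‖p - q‖ ≤ 2 * β t + A * A' + (A * A' + A) * G v := by
      intro p q θ hθ hp hq
      have h3 := mul_le_mul_of_nonneg_left (hGθ θ hθ) hA
      refine (norm_sub_le _ _).trans ?_
      linarith
    refine (hF.abs_remainder_le hs hφ hψ
      (D := 2 * β t + A * A' + (A * A' + A) * G v) (fun θ hθ => ?_)
      (fun θ hθ => ?_)).trans ?_
    · exact hbd hθ (hb t _ _ (hxθ θ hθ)).2.1 (hb t _ _ (by linarith)).2.1
    · exact hbd hθ (hb t _ _ (hxθ θ hθ)).2.2 (hb t _ _ (by linarith)).2.2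
    · rw [excess, if_neg hv]
      refine mul_le_mul_of_nonneg_left ?_ hs
      linarith

theorem integrableOn_excess {β : ℝ → ℝ} {A L : ℝ} {w : ℝ → Vec N}
    (hβ : IntegrableOn β (Icc a b)) (hw : Measurable w)
    (hGw : IntegrableOn (fun t => G (w t)) (Icc a b)) :
    IntegrableOn (fun t => excess G β A L t (w t)) (Icc a b) := by
  have h : (fun t => excess G β A L t (w t)) =
      {t | ‖w t‖ ≤ L}ᶜ.indicator fun t => β t + A * G (w t) := by
    ext t
    by_cases ht : ‖w t‖ ≤ L <;> simp [excess, indicator, ht]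
  rw [h]
  exact (integrableOn_growth hβ hGw).indicator (measurableSet_le hw.norm measurable_const).compl

/-- First order expansion of the kinetic energy, up to the integrated excess. -/
theorem IsKinetic.abs_kin_remainder_le (hF : IsKinetic a b G Λ F Fx Fv)
    (hG : IsGrowthFunction G) (hab : a ≤ b) {β : ℝ → ℝ} {A L ε s M Q : ℝ}
    (hβ : IntegrableOn β (Icc a b))
    (hrem : ∀ t ∈ Icc a b, ∀ x v φ ψ : Vec N, ‖x‖ ≤ M → ‖φ‖ ≤ Q → ‖ψ‖ ≤ Q →
        |F t (x + s • φ) (v + s • ψ) - F t x v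
          - s * (inner ℝ (Fx t x v) φ + inner ℝ (Fv t x v) ψ)| ≤
          s * (ε + excess G β A L t v))
    {u w φ ψ : ℝ → Vec N} (hu : Continuous u) (huM : ∀ t ∈ Icc a b, ‖u t‖ ≤ M)
    (hw : Measurable w) (hGw : IntegrableOn (fun t => G (w t)) (Icc a b))
    (hφ : Continuous φ) (hψ : Continuous ψ) (hφQ : ∀ t ∈ Icc a b, ‖φ t‖ ≤ Q)
    (hψQ : ∀ t ∈ Icc a b, ‖ψ t‖ ≤ Q) :
    |kin a b F (fun t => u t + s • φ t) (fun t => w t + s • ψ t) - kin a b F u w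
      - s * dkin a b Fx Fv u w φ ψ| ≤
      s * (ε * (b - a) + ∫ t in Icc a b, excess G β A L t (w t)) := by
  have h1 : IntegrableOn (fun t => F t (u t + s • φ t) (w t + s • ψ t)) (Icc a b) :=
    hF.integrableOn (hu.add (hφ.const_smul s)) (hw.add (hψ.const_smul s).measurable)
      (hG.integrableOn_add hw hGw (hψ.const_smul s))
  have h2 := hF.integrableOn hu hw hGw
  have h3 := (hF.integrableOn_dkin hu hw hGw hφ hψ).const_mul s
  have h4 := integrableOn_excess (A := A) (L := L) hβ hw hGw
  have h12 : IntegrableOn (fun t => F t (u t + s • φ t) (w t + s • ψ t) - F t (u t) (w t))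
    (Icc a b) := h1.sub h2
  rw [kin, kin, dkin, ← integral_const_mul, ← integral_sub h1 h2, ← integral_sub h12 h3]
  have e : s * (ε * (b - a) + ∫ t in Icc a b, excess G β A L t (w t)) =
      ∫ t in Icc a b, s * (ε + excess G β A L t (w t)) := by
    rw [integral_const_mul, integral_add (integrable_const ε) h4, setIntegral_const,
      Real.volume_real_Icc_of_le hab, smul_eq_mul, mul_comm ε]
  rw [e, ← Real.norm_eq_abs]
  refine norm_integral_le_of_norm_le (((integrable_const ε).add h4).const_mul s) ?_
  filter_upwards [ae_restrict_mem measurableSet_Icc] with t ht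
  exact hrem t ht _ _ _ _ (huM t ht) (hφQ t ht) (hψQ t ht)

end

section

/-! ### Convergence of energies -/

variable {N : ℕ} {a b Λ : ℝ} {G : Vec N → ℝ}
  {F : ℝ → Vec N → Vec N → ℝ} {Fx Fv : ℝ → Vec N → Vec N → Vec N}
  {V : ℝ → Vec N → ℝ} {Vx : ℝ → Vec N → Vec N} {f : ℝ → Vec N}

/-- The potential energy along the curve `u`, with forcing term `f`. -/
def pot (a b : ℝ) (V : ℝ → Vec N → ℝ) (f u : ℝ → Vec N) : ℝ :=
  ∫ t in Icc a b, (V t (u t) + inner ℝ (f t) (u t))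

/-- The differential of the potential energy in the direction `φ`. -/
def dpot (a b : ℝ) (Vx : ℝ → Vec N → Vec N) (f u φ : ℝ → Vec N) : ℝ :=
  ∫ t in Icc a b, inner ℝ (Vx t (u t) + f t) (φ t)

theorem tendsto_pot (hV : Continuous fun p : ℝ × Vec N => V p.1 p.2)
    (hf : IntegrableOn f (Icc a b)) {x : ℕ → ℝ → Vec N} {y : ℝ → Vec N} {M : ℝ}
    (hx : ∀ m, Continuous (x m)) (hxM : ∀ m, ∀ t ∈ Icc a b, ‖x m t‖ ≤ M)
    (hlim : ∀ t ∈ Icc a b, Tendsto (fun m => x m t) atTop (𝓝 (y t))) :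
    Tendsto (fun m => pot a b V f (x m)) atTop (𝓝 (pot a b V f y)) := by
  obtain ⟨C, hC, hCb⟩ := exists_bound_of_continuous_comp hV a b M
  refine tendsto_integral_of_dominated_convergence (fun t => C + ‖f t‖ * M)
    (fun m => ((hV.comp (continuous_id.prodMk (hx m))).aestronglyMeasurable).add
      (hf.aestronglyMeasurable.inner (hx m).aestronglyMeasurable))
    ((integrable_const C).add (hf.norm.mul_const M)) (fun m => ?_) ?_
  · filter_upwards [ae_restrict_mem measurableSet_Icc] with t ht
    refine (norm_add_le _ _).trans (add_le_add (hCb t ht _ (hxM m t ht)) ?_)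
    exact (norm_inner_le_norm _ _).trans
      (mul_le_mul_of_nonneg_left (hxM m t ht) (norm_nonneg _))
  · filter_upwards [ae_restrict_mem measurableSet_Icc] with t ht
    exact ((hV.tendsto _).comp (tendsto_const_nhds.prodMk_nhds (hlim t ht))).add
      (tendsto_const_nhds.inner (hlim t ht))

theorem tendsto_dpot (hV : Continuous fun p : ℝ × Vec N => Vx p.1 p.2)
    (hf : IntegrableOn f (Icc a b)) {x : ℕ → ℝ → Vec N} {y φ : ℝ → Vec N} {M : ℝ}
    (hx : ∀ m, Continuous (x m)) (hφ : Continuous φ) (hxM : ∀ m, ∀ t ∈ Icc a b, ‖x m t‖ ≤ M)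
    (hlim : ∀ t ∈ Icc a b, Tendsto (fun m => x m t) atTop (𝓝 (y t))) :
    Tendsto (fun m => dpot a b Vx f (x m) φ) atTop (𝓝 (dpot a b Vx f y φ)) := by
  obtain ⟨C, hC, hCb⟩ := exists_bound_of_continuous_comp (f := fun t x => ‖Vx t x‖) hV.norm a b M
  obtain ⟨D, hD⟩ := (isCompact_Icc (a := a) (b := b)).exists_bound_of_continuousOn hφ.continuousOn
  refine tendsto_integral_of_dominated_convergence (fun t => (C + ‖f t‖) * D)
    (fun m => (((hV.comp (continuous_id.prodMk (hx m))).aestronglyMeasurable).add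
      hf.aestronglyMeasurable).inner hφ.aestronglyMeasurable)
    (((integrable_const C).add hf.norm).mul_const D) (fun m => ?_) ?_
  · filter_upwards [ae_restrict_mem measurableSet_Icc] with t ht
    have h1 := hCb t ht _ (hxM m t ht)
    rw [norm_norm] at h1
    refine (norm_inner_le_norm _ _).trans (mul_le_mul
      ((norm_add_le _ _).trans (add_le_add h1 le_rfl)) (hD t ht) (norm_nonneg _) (by positivity))
  · filter_upwards [ae_restrict_mem measurableSet_Icc] with t ht
    exact ((((hV.tendsto _).comp (tendsto_const_nhds.prodMk_nhds (hlim t ht))).add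
      tendsto_const_nhds).inner tendsto_const_nhds)

/-- Uniform smallness of the integral of `β` over the set where a curve is large. -/
theorem exists_level_integral_le {β : ℝ → ℝ} (hβ : IntegrableOn β (Icc a b)) (M : ℝ) {ε : ℝ}
    (hε : 0 < ε) : ∃ L₀ : ℝ, ∀ L, L₀ ≤ L → ∀ w : ℝ → Vec N, Measurable w →
      IntegrableOn w (Icc a b) → ∫ t in Icc a b, ‖w t‖ ≤ M →
      ∫ t in Icc a b, {t | ‖w t‖ ≤ L}ᶜ.indicator β t ≤ ε := by
  -- Absolute continuity of the integral, stated for all sets of small measure at once; Chebyshev's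
  -- inequality bounds the measure of the set where ‖w‖ exceeds L by M/L.
  have h := hβ.tendsto_setIntegral_nhds_zero (l := comap (volume.restrict (Icc a b)) (𝓝 0))
    (s := id) tendsto_comap
  obtain ⟨U, hU, hUs⟩ := mem_comap.1 (h.eventually (gt_mem_nhds hε))
  obtain ⟨δ, hδ, hδU⟩ := ENNReal.nhds_zero_basis.mem_iff.1 hU
  have hl : Tendsto (fun L : ℝ => ENNReal.ofReal (M / L)) atTop (𝓝 0) := by
    have := ENNReal.tendsto_ofReal (tendsto_const_nhds (x := M).div_atTop tendsto_id)
    simpa using this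
  obtain ⟨L₁, hL₁⟩ := eventually_atTop.1 (hl.eventually (gt_mem_nhds hδ))
  refine ⟨max L₁ 1, fun L hL w hwm hw hM => ?_⟩
  have hLpos : 0 < L := lt_of_lt_of_le one_pos ((le_max_right _ _).trans hL)
  have hmeas : MeasurableSet {t | ‖w t‖ ≤ L}ᶜ := (measurableSet_le hwm.norm measurable_const).compl
  rw [integral_indicator hmeas]
  have hmem : {t | ‖w t‖ ≤ L}ᶜ ∈ {s | ∫ x in id s, β x ∂(volume.restrict (Icc a b)) < ε} := by
    refine hUs (hδU ?_)
    refine lt_of_le_of_lt ?_ (hL₁ L ((le_max_left _ _).trans hL))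
    have hch := mul_meas_ge_le_integral_of_nonneg (μ := volume.restrict (Icc a b))
      (Eventually.of_forall fun t => norm_nonneg (w t)) hw.norm L
    have hsub : {t | ‖w t‖ ≤ L}ᶜ ⊆ {t | L ≤ ‖w t‖} := fun t ht => by
      simp only [mem_compl_iff, mem_ofPred_eq, not_le] at ht ⊢
      exact ht.le
    refine (measure_mono hsub).trans ?_
    rw [← ofReal_measureReal]
    refine ENNReal.ofReal_le_ofReal ?_
    rw [le_div_iff₀ hLpos, mul_comm]
    exact hch.trans hM
  exact le_of_lt hmem

theorem integral_excess_eq {β : ℝ → ℝ} {A L : ℝ} {w : ℝ → Vec N}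
    (hβ : IntegrableOn β (Icc a b)) (hw : Measurable w)
    (hGw : IntegrableOn (fun t => G (w t)) (Icc a b)) :
    ∫ t in Icc a b, excess G β A L t (w t) =
      (∫ t in Icc a b, {t | ‖w t‖ ≤ L}ᶜ.indicator β t) +
      A * ∫ t in Icc a b, {t | ‖w t‖ ≤ L}ᶜ.indicator (fun t => G (w t)) t := by
  have hmeas : MeasurableSet {t | ‖w t‖ ≤ L}ᶜ := (measurableSet_le hw.norm measurable_const).compl
  rw [← integral_const_mul, ← integral_add (hβ.indicator hmeas)
    ((hGw.indicator hmeas).const_mul A)]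
  refine integral_congr_ae (Eventually.of_forall fun t => ?_)
  by_cases ht : ‖w t‖ ≤ L <;> simp [excess, indicator, ht]

/-- Lower semicontinuity of the kinetic energy in the velocities. -/
theorem IsKinetic.eventually_kin_le (hF : IsKinetic a b G Λ F Fx Fv) (hG : IsGrowthFunction G)
    {z : ℝ → Vec N} (hz : Continuous z) {v : ℕ → ℝ → Vec N} {v' : ℝ → Vec N}
    (hv : ∀ m, Continuous (v m)) (hv' : IntegrableOn v' (Icc a b)) (hvm : Measurable v')
    (hGv : IntegrableOn (fun t => G (v' t)) (Icc a b)) (hlim : WeakTendsto a b v v') {ε : ℝ}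
    (hε : 0 < ε) : ∀ᶠ m in atTop, kin a b F z v' ≤ kin a b F z (v m) + ε := by
  have hH := hF.slice hG hz
  obtain ⟨q, hq, hle⟩ := hH.exists_le_tangentValue hv' hvm (hF.integrableOn hz hvm hGv)
    (half_pos hε)
  have ht := hH.tendsto_tangentValue hq (fun m => integrableOn_of_continuous (hv m)) hv' hlim
  filter_upwards [ht.eventually (lt_mem_nhds (sub_lt_self _ (half_pos hε)))] with m hm
  have h := hH.tangentValue_le (a := a) (b := b) hq (integrableOn_of_continuous (hv m))
    (integrableOn_of_continuous (hF.continuous_comp hz (hv m)))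
  simp only [kin]
  linarith

/-- If the kinetic energies do not exceed that of the limit, then the energies of the velocities
are uniformly integrable. -/
theorem IsKinetic.exists_level_energy_le (hF : IsKinetic a b G Λ F Fx Fv)
    (hG : IsGrowthFunction G) {u : ℝ → Vec N} (hu : Continuous u) {w : ℕ → ℝ → Vec N}
    {w' : ℝ → Vec N} (hw : ∀ m, Continuous (w m)) (hw' : IntegrableOn w' (Icc a b))
    (hwm : Measurable w') (hGw : IntegrableOn (fun t => G (w' t)) (Icc a b))
    (hlim : WeakTendsto a b w w')
    (hsup : ∀ ε > 0, ∀ᶠ m in atTop, kin a b F u (w m) ≤ kin a b F u w' + ε) {ε : ℝ}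
    (hε : 0 < ε) : ∃ L₀ : ℝ, ∀ L, L₀ ≤ L → ∀ᶠ m in atTop,
      ∫ t in Icc a b, {t | ‖w m t‖ ≤ L}ᶜ.indicator (fun t => G (w m t)) t ≤ ε := by
  have hH := hF.slice hG hu
  have hΛ := hF.pos
  have hε' : 0 < Λ * ε / 6 := by positivity
  obtain ⟨q, hq, hle⟩ := hH.exists_le_tangentValue hw' hwm (hF.integrableOn hu hwm hGw) hε'
  have ht := hH.tendsto_tangentValue hq (fun m => integrableOn_of_continuous (hw m)) hw' hlim
  obtain ⟨C₁, hC₁⟩ := (isCompact_Icc (a := a) (b := b)).exists_bound_of_continuousOn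
    (f := fun t => F t (u t) (q t) - inner ℝ (Fv t (u t) (q t)) (q t))
    ((hH.continuous_comp hq).sub ((hH.continuous_grad_comp hq).inner hq)).continuousOn
  obtain ⟨C₂, hC₂⟩ := (isCompact_Icc (a := a) (b := b)).exists_bound_of_continuousOn
    (hH.continuous_grad_comp hq).continuousOn
  set C := max (max C₁ C₂) 1
  have hC : 0 < C := lt_max_of_lt_right one_pos
  -- With this slope, ‖w‖ ≥ 2D gives C‖w‖ ≤ (Λ/4)·G(w). If also ‖w‖ ≥ 1, the constant and the linear
  -- part of the tangent together cost at most (Λ/2)·G(w).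
  obtain ⟨D, hD⟩ := hG.superlinear (Λ / (8 * C)) (by positivity)
  refine ⟨max 1 (2 * D), fun L hL => ?_⟩
  filter_upwards [ht.eventually (lt_mem_nhds (sub_lt_self _ hε')), hsup _ hε'] with m hm1 hm2
  have hTi := hH.integrableOn_tangent (a := a) (b := b) hq (integrableOn_of_continuous (hw m))
  have hFi : IntegrableOn (fun t => F t (u t) (w m t)) (Icc a b) :=
    integrableOn_of_continuous (hF.continuous_comp hu (hw m))
  -- Three errors of size Λε/6: the tangent value at the limit, its weak convergence, and the
  -- assumed upper bound on the energies.
  have hint : (∫ t in Icc a b, F t (u t) (w m t)) -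
      tangentValue a b (fun t v => F t (u t) v) (fun t v => Fv t (u t) v) q (w m) ≤
      3 * (Λ * ε / 6) := by
    simp only [kin] at hm2
    linarith
  rw [tangentValue, ← integral_sub hFi hTi] at hint
  have hmeas : MeasurableSet {t | ‖w m t‖ ≤ L}ᶜ :=
    (measurableSet_le (hw m).measurable.norm measurable_const).compl
  have hGi : IntegrableOn (fun t => G (w m t)) (Icc a b) :=
    integrableOn_of_continuous (hG.cont.comp (hw m))
  -- The gap between F and its tangent minorant is nonnegative everywhere. At large velocities it
  -- exceeds (Λ/2)·G, since the tangent grows only linearly. A small total gap thus leaves little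
  -- G-energy at high levels.
  have hmain : ∫ t in Icc a b, (Λ / 2) * {t | ‖w m t‖ ≤ L}ᶜ.indicator (fun t => G (w m t)) t ≤
      ∫ t in Icc a b, (F t (u t) (w m t) - (F t (u t) (q t) +
        inner ℝ (Fv t (u t) (q t)) (w m t - q t))) := by
    refine setIntegral_mono_on ((hGi.indicator hmeas).const_mul _) (hFi.sub hTi)
      measurableSet_Icc fun t htI => ?_
    by_cases hwL : ‖w m t‖ ≤ L
    · simp only [indicator, mem_compl_iff, mem_ofPred_eq, hwL, not_true_eq_false, if_false, mul_zero]
      exact sub_nonneg.2 (hH.tangent_le t (q t) (w m t))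
    · simp only [indicator, mem_compl_iff, mem_ofPred_eq, hwL, not_false_eq_true, if_true]
      have h1 := hF.lower t (u t) (w m t)
      have h2 := (le_abs_self _).trans ((hC₁ t htI).trans
        ((le_max_left C₁ C₂).trans (le_max_left _ (1 : ℝ))))
      have h3 : inner ℝ (Fv t (u t) (q t)) (w m t) ≤ C * ‖w m t‖ :=
        (real_inner_le_norm _ _).trans (mul_le_mul_of_nonneg_right ((hC₂ t htI).trans
          ((le_max_right C₁ C₂).trans (le_max_left _ (1 : ℝ)))) (norm_nonneg _))
      have h4 := hD (w m t)
      have h5 : 1 ≤ ‖w m t‖ := ((le_max_left _ _).trans hL).trans (not_le.1 hwL).le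
      have h6 : 2 * D ≤ ‖w m t‖ := ((le_max_right _ _).trans hL).trans (not_le.1 hwL).le
      have h7 : C * ‖w m t‖ ≤ (Λ / 4) * G (w m t) := by
        have h8 : ‖w m t‖ ≤ 2 * (Λ / (8 * C) * G (w m t)) := by linarith
        calc C * ‖w m t‖ ≤ C * (2 * (Λ / (8 * C) * G (w m t))) := by gcongr
          _ = _ := by field
      have h9 : C ≤ C * ‖w m t‖ := le_mul_of_one_le_right hC.le h5
      rw [inner_sub_right]
      linarith
  rw [integral_const_mul] at hmain
  have h10 := hmain.trans hint
  have h11 : Λ * (∫ t in Icc a b, {t | ‖w m t‖ ≤ L}ᶜ.indicator (fun t => G (w m t)) t) ≤ Λ * ε := by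
    linarith
  exact le_of_mul_le_mul_left h11 hΛ

/-- Both the integrated excess of a weakly convergent sequence of velocities and that of the limit
are small at high levels. -/
theorem IsKinetic.exists_level_excess_le (hF : IsKinetic a b G Λ F Fx Fv)
    (hG : IsGrowthFunction G) {u : ℝ → Vec N} (hu : Continuous u) {w : ℕ → ℝ → Vec N}
    {w' : ℝ → Vec N} (hw : ∀ m, Continuous (w m)) (hw' : IntegrableOn w' (Icc a b))
    (hwm : Measurable w') (hGw : IntegrableOn (fun t => G (w' t)) (Icc a b))
    (hlim : WeakTendsto a b w w')
    (hsup : ∀ ε > 0, ∀ᶠ m in atTop, kin a b F u (w m) ≤ kin a b F u w' + ε)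
    {M : ℝ} (hM : ∀ m, ∫ t in Icc a b, ‖w m t‖ ≤ M)
    {β : ℝ → ℝ} (hβ : IntegrableOn β (Icc a b)) {A : ℝ} (hA : 0 ≤ A)
    {ε : ℝ} (hε : 0 < ε) : ∃ L : ℝ, ∫ t in Icc a b, excess G β A L t (w' t) ≤ ε ∧
      ∀ᶠ m in atTop, ∫ t in Icc a b, excess G β A L t (w m t) ≤ ε := by
  have hε1 : 0 < ε / 2 := half_pos hε
  have hε2 : 0 < ε / (2 * (A + 1)) := by positivity
  have hAε : A * (ε / (2 * (A + 1))) ≤ ε / 2 := by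
    calc A * (ε / (2 * (A + 1))) ≤ (A + 1) * (ε / (2 * (A + 1))) := by gcongr; linarith
      _ = ε / 2 := by field
  obtain ⟨L₁, hL₁⟩ := exists_level_integral_le (N := N) hβ
    (max M (∫ t in Icc a b, ‖w' t‖)) hε1
  obtain ⟨L₂, hL₂⟩ := exists_level_integral_le (N := N) hGw (∫ t in Icc a b, ‖w' t‖) hε2
  obtain ⟨L₃, hL₃⟩ := hF.exists_level_energy_le hG hu hw hw' hwm hGw hlim hsup hε2
  refine ⟨max L₁ (max L₂ L₃), ?_, ?_⟩
  · rw [integral_excess_eq hβ hwm hGw]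
    have h1 := hL₁ _ (le_max_left L₁ (max L₂ L₃)) w' hwm hw' (le_max_right _ _)
    have h2 := hL₂ _ ((le_max_left L₂ L₃).trans (le_max_right L₁ _)) w' hwm hw' le_rfl
    have h3 := mul_le_mul_of_nonneg_left h2 hA
    linarith
  · filter_upwards [hL₃ _ ((le_max_right L₂ L₃).trans (le_max_right L₁ _))] with m hm
    rw [integral_excess_eq hβ (hw m).measurable
      (integrableOn_of_continuous (hG.cont.comp (hw m)))]
    have h1 := hL₁ _ (le_max_left L₁ (max L₂ L₃)) (w m) (hw m).measurable
      (integrableOn_of_continuous (hw m)) ((hM m).trans (le_max_left _ _))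
    have h3 := mul_le_mul_of_nonneg_left hm hA
    linarith

/-- Almost critical points tested against approximations of the limit: the kinetic energies do not
exceed that of the weak limit. -/
theorem IsKinetic.eventually_kin_le_of_almost_critical (hF : IsKinetic a b G Λ F Fx Fv)
    (hG : IsGrowthFunction G) (hab : a < b)
    (hVx : Continuous fun p : ℝ × Vec N => Vx p.1 p.2) (hf : IntegrableOn f (Icc a b))
    {x w : ℕ → ℝ → Vec N} {u w' : ℝ → Vec N} {M K : ℝ}
    (hx : ∀ m, Continuous (x m)) (hw : ∀ m, Continuous (w m)) (hu : Continuous u)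
    (hxM : ∀ m, ∀ t ∈ Icc a b, ‖x m t‖ ≤ M) (huM : ∀ t ∈ Icc a b, ‖u t‖ ≤ M)
    (hunif : TendstoUniformlyOn x u atTop (Icc a b))
    (hK : ∀ m, ∫ t in Icc a b, G (w m t) ≤ K)
    (hw' : IntegrableOn w' (Icc a b)) (hwm : Measurable w')
    (hGw : IntegrableOn (fun t => G (w' t)) (Icc a b)) (hmean : mean a b w' = 0)
    (huw : ∀ t ∈ Icc a b, prim a w' t = u t)
    (hcrit : ∀ p : ℝ → Vec N, IsPolyCurve p → Tendsto (fun m =>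
      dkin a b Fx Fv (x m) (w m) (fun t => prim a (fun t => p t - mean a b p) t - x m t)
        (fun t => (p t - mean a b p) - w m t) +
      dpot a b Vx f (x m) (fun t => prim a (fun t => p t - mean a b p) t - x m t))
      atTop (𝓝 0)) {ε : ℝ} (hε : 0 < ε) :
    ∀ᶠ m in atTop, kin a b F (x m) (w m) ≤ kin a b F u w' + ε := by
  obtain ⟨β, A, hβ, hβ0, hA, hb⟩ := hF.growth M
  obtain ⟨C, hC, hCb⟩ := exists_bound_of_continuous_comp (f := fun t x => ‖Vx t x‖) hVx.norm a b M
  have hK0 : 0 ≤ K := (integral_nonneg fun t => hG.nonneg (w 0 t)).trans (hK 0)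
  have hf0 : 0 ≤ ∫ t in Icc a b, ‖f t‖ := integral_nonneg fun _ => norm_nonneg _
  have hβi : 0 ≤ ∫ t in Icc a b, β t := integral_nonneg hβ0
  have hab' : 0 < b - a := sub_pos.2 hab
  set B := (∫ t in Icc a b, β t) + A * K with hB
  set B' := C * (b - a) + ∫ t in Icc a b, ‖f t‖ with hB'
  have hB0 : 0 ≤ B := by positivity
  have hB'0 : 0 ≤ B' := by positivity
  -- Three errors of size η arise from the approximation of the energy, the change of positions and
  -- almost criticality; the terms with Fx and with the potential cost 2ηB and 2ηB'.
  set η := ε / (3 + 2 * (B + B')) with hη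
  have hη0 : 0 < η := by positivity
  -- The approximation lemma asks for a growth bound at every real `t`, but `u` is bounded by `M`
  -- only on `[a, b]`; hence the projection of `t`. The norm changes nothing on `[a, b]`, where F ≥
  -- 0.
  obtain ⟨p, hp, hpw, hpF⟩ := exists_polyCurve_sub_mean hab hG
    (H := fun t v => ‖F t (u (projIcc a b hab.le t)) v‖)
    (hF.cont.comp (continuous_fst.prodMk
      ((hu.comp (continuous_subtype_val.comp
        (continuous_projIcc.comp continuous_fst))).prodMk continuous_snd))).norm hA hβ
    (fun t v => by
      rw [norm_norm]
      exact (hb t _ v (huM _ (projIcc a b hab.le t).2)).1) hw' hwm hGw hmean hη0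
  set z : ℝ → Vec N := fun t => p t - mean a b p with hz
  have hzc : Continuous z := hp.continuous.sub continuous_const
  have hzi : IntegrableOn z (Icc a b) := integrableOn_of_continuous hzc
  have hnormF : ∀ v : ℝ → Vec N,
      ∫ t in Icc a b, ‖F t (u (projIcc a b hab.le t)) (v t)‖ = kin a b F u v := by
    intro v
    refine setIntegral_congr_fun measurableSet_Icc fun t ht => ?_
    simp only [projIcc_of_mem hab.le ht]
    exact Real.norm_of_nonneg ((mul_nonneg hF.pos.le (hG.nonneg _)).trans (hF.lower _ _ _))
  have hpF' : kin a b F u z ≤ kin a b F u w' + η := by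
    rw [← hnormF, ← hnormF]
    exact hpF
  have hzlim := hF.tendsto_kin_sub hG hx hu (v := fun _ => z) (fun _ => hzc) hxM huM hunif
    (K := ∫ t in Icc a b, G (z t)) fun _ => le_rfl
  filter_upwards [(hcrit p hp).eventually (lt_mem_nhds (neg_lt_zero.2 hη0)),
    hzlim.eventually (gt_mem_nhds hη0), Metric.tendstoUniformlyOn_iff.1 hunif η hη0]
    with m hm1 hm2 hm3
  have hGi : IntegrableOn (fun t => G (w m t)) (Icc a b) :=
    integrableOn_of_continuous (hG.cont.comp (hw m))
  have hdiff : ∀ t ∈ Icc a b, ‖prim a z t - x m t‖ ≤ 2 * η := by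
    intro t ht
    have h1 := norm_prim_sub_le hzi hw' ht
    rw [huw t ht] at h1
    have h2 := (hm3 t ht).le
    rw [dist_eq_norm] at h2
    exact (norm_sub_le_norm_sub_add_norm_sub _ (u t) _).trans (by linarith)
  have hφc : Continuous fun t => prim a z t - x m t := (continuous_prim hzc).sub (hx m)
  have hψc : Continuous fun t => z t - w m t := hzc.sub (hw m)
  have hi1 : IntegrableOn (fun t => inner ℝ (Fx t (x m t) (w m t)) (prim a z t - x m t))
      (Icc a b) := integrableOn_inner_right (hF.integrableOn_gradX (hx m) (hw m).measurable hGi) hφc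
  have hi2 : IntegrableOn (fun t => inner ℝ (Fv t (x m t) (w m t)) (z t - w m t))
      (Icc a b) := integrableOn_inner_right (hF.integrableOn_gradV (hx m) (hw m).measurable hGi) hψc
  have hbX : ∫ t in Icc a b, inner ℝ (Fx t (x m t) (w m t)) (prim a z t - x m t) ≤
      B * (2 * η) := by
    calc ∫ t in Icc a b, inner ℝ (Fx t (x m t) (w m t)) (prim a z t - x m t)
        ≤ ∫ t in Icc a b, (β t + A * G (w m t)) * (2 * η) := by
          refine setIntegral_mono_on hi1 ((integrableOn_growth hβ hGi).mul_const _)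
            measurableSet_Icc fun t ht => (real_inner_le_norm _ _).trans ?_
          exact mul_le_mul (hb t _ _ (hxM m t ht)).2.1 (hdiff t ht) (norm_nonneg _)
            (add_nonneg (hβ0 t) (mul_nonneg hA (hG.nonneg _)))
      _ = ((∫ t in Icc a b, β t) + A * ∫ t in Icc a b, G (w m t)) * (2 * η) := by
          rw [integral_mul_const, integral_add hβ (hGi.const_mul A), integral_const_mul]
      _ ≤ B * (2 * η) := by
          rw [hB]
          gcongr
          exact hK m
  have hVi : IntegrableOn (fun t => Vx t (x m t) + f t) (Icc a b) :=
    (integrableOn_of_continuous (hVx.comp (continuous_id.prodMk (hx m)))).add hf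
  have hbV : dpot a b Vx f (x m) (fun t => prim a z t - x m t) ≤ B' * (2 * η) := by
    calc dpot a b Vx f (x m) (fun t => prim a z t - x m t)
        ≤ ∫ t in Icc a b, (C + ‖f t‖) * (2 * η) := by
          refine setIntegral_mono_on (integrableOn_inner_right hVi hφc)
            (((integrable_const C).add hf.norm).mul_const _)
            measurableSet_Icc fun t ht => (real_inner_le_norm _ _).trans ?_
          have h1 := hCb t ht _ (hxM m t ht)
          rw [norm_norm] at h1
          exact mul_le_mul ((norm_add_le _ _).trans (add_le_add h1 le_rfl)) (hdiff t ht)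
            (norm_nonneg _) (by positivity)
      _ = B' * (2 * η) := by
          rw [integral_mul_const, integral_add (integrable_const C) hf.norm, setIntegral_const,
            Real.volume_real_Icc_of_le hab.le, smul_eq_mul, mul_comm (b - a)]
  have hFz : IntegrableOn (fun t => F t (x m t) (z t)) (Icc a b) :=
    integrableOn_of_continuous (hF.continuous_comp (hx m) hzc)
  have hFw : IntegrableOn (fun t => F t (x m t) (w m t)) (Icc a b) :=
    integrableOn_of_continuous (hF.continuous_comp (hx m) (hw m))
  -- Convexity in the velocity turns the pairing of Fv with z − w_m into a comparison of energies,
  -- so no convergence of Fv is needed.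
  have hconv : kin a b F (x m) (w m) +
      ∫ t in Icc a b, inner ℝ (Fv t (x m t) (w m t)) (z t - w m t) ≤ kin a b F (x m) z := by
    rw [kin, kin, ← integral_add hFw hi2]
    exact integral_mono (hFw.add hi2) hFz fun t => tangent_le_of_convexOn (hF.convex t _)
      (hF.hasGradV t _ _) _
  have hd : dkin a b Fx Fv (x m) (w m) (fun t => prim a z t - x m t) (fun t => z t - w m t) =
      (∫ t in Icc a b, inner ℝ (Fx t (x m t) (w m t)) (prim a z t - x m t)) +
      ∫ t in Icc a b, inner ℝ (Fv t (x m t) (w m t)) (z t - w m t) := integral_add hi1 hi2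
  have hηe : η * (3 + 2 * (B + B')) = ε := by rw [hη]; field
  linarith

end

section

/-! ### Criticality of weak limits -/

variable {N : ℕ} {a b Λ : ℝ} {G : Vec N → ℝ}
  {F : ℝ → Vec N → Vec N → ℝ} {Fx Fv : ℝ → Vec N → Vec N → Vec N}
  {V : ℝ → Vec N → ℝ} {Vx : ℝ → Vec N → Vec N} {f : ℝ → Vec N}

theorem WeakTendsto.add_const_smul {w : ℕ → ℝ → Vec N} {w' ψ : ℝ → Vec N}
    (h : WeakTendsto a b w w') (hw : ∀ m, Continuous (w m)) (hw' : IntegrableOn w' (Icc a b))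
    (hψ : Continuous ψ) (s : ℝ) :
    WeakTendsto a b (fun m t => w m t + s • ψ t) (fun t => w' t + s • ψ t) := by
  intro ξ hξ
  have key : ∀ z : ℝ → Vec N, IntegrableOn z (Icc a b) →
      ∫ t in Icc a b, inner ℝ (ξ t) (z t + s • ψ t) =
      (∫ t in Icc a b, inner ℝ (ξ t) (z t)) + ∫ t in Icc a b, inner ℝ (ξ t) (s • ψ t) := by
    intro z hz
    have hsψ : Continuous fun t => s • ψ t := hψ.const_smul s
    rw [← integral_add (integrableOn_inner hξ hz)
      (integrableOn_inner hξ (integrableOn_of_continuous hsψ))]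
    simp only [inner_add_right]
  simp only [key _ (integrableOn_of_continuous (hw _)), key _ hw']
  exact (h ξ hξ).add_const _

theorem TendstoUniformlyOn.add_fixed {x : ℕ → ℝ → Vec N} {u : ℝ → Vec N} {S : Set ℝ}
    (h : TendstoUniformlyOn x u atTop S) (φ : ℝ → Vec N) :
    TendstoUniformlyOn (fun m t => x m t + φ t) (fun t => u t + φ t) atTop S := by
  rw [Metric.tendstoUniformlyOn_iff] at h ⊢
  intro ε hε
  filter_upwards [h ε hε] with m hm t ht
  rw [dist_add_right]
  exact hm t ht

/-- The one-sided first order condition for weak limits of almost critical points. -/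
theorem IsKinetic.first_variation_le (hF : IsKinetic a b G Λ F Fx Fv)
    (hG : IsGrowthFunction G) (hab : a < b)
    (hVx : Continuous fun p : ℝ × Vec N => Vx p.1 p.2) (hf : IntegrableOn f (Icc a b))
    {x w : ℕ → ℝ → Vec N} {u w' : ℝ → Vec N} {M K : ℝ} (hM0 : 0 ≤ M)
    (hx : ∀ m, Continuous (x m)) (hw : ∀ m, Continuous (w m)) (hu : Continuous u)
    (hxM : ∀ m, ∀ t ∈ Icc a b, ‖x m t‖ ≤ M) (huM : ∀ t ∈ Icc a b, ‖u t‖ ≤ M)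
    (hwM : ∀ m, ∫ t in Icc a b, ‖w m t‖ ≤ M)
    (hunif : TendstoUniformlyOn x u atTop (Icc a b))
    (hK : ∀ m, ∫ t in Icc a b, G (w m t) ≤ K)
    (hw' : IntegrableOn w' (Icc a b)) (hwm : Measurable w')
    (hGw : IntegrableOn (fun t => G (w' t)) (Icc a b))
    (hlim : WeakTendsto a b w w')
    (hsup : ∀ ε > 0, ∀ᶠ m in atTop, kin a b F (x m) (w m) ≤ kin a b F u w' + ε)
    {φ ψ : ℝ → Vec N} (hφ : Continuous φ) (hψ : Continuous ψ)
    (hcrit : Tendsto (fun m => dkin a b Fx Fv (x m) (w m) φ ψ + dpot a b Vx f (x m) φ)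
      atTop (𝓝 0)) :
    dkin a b Fx Fv u w' φ ψ + dpot a b Vx f u φ ≤ 0 := by
  obtain ⟨Q₁, hQ₁⟩ := (isCompact_Icc (a := a) (b := b)).exists_bound_of_continuousOn
    hφ.continuousOn
  obtain ⟨Q₂, hQ₂⟩ := (isCompact_Icc (a := a) (b := b)).exists_bound_of_continuousOn
    hψ.continuousOn
  set Q := max Q₁ Q₂
  have hφQ : ∀ t ∈ Icc a b, ‖φ t‖ ≤ Q := fun t ht => (hQ₁ t ht).trans (le_max_left _ _)
  have hψQ : ∀ t ∈ Icc a b, ‖ψ t‖ ≤ Q := fun t ht => (hQ₂ t ht).trans (le_max_right _ _)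
  have hQ0 : 0 ≤ Q := (norm_nonneg _).trans (hφQ a (left_mem_Icc.2 hab.le))
  -- The moving positions are replaced by the limit, as the uniform integrability lemma requires.
  have hsup' : ∀ ε > 0, ∀ᶠ m in atTop, kin a b F u (w m) ≤ kin a b F u w' + ε := by
    intro ε hε
    filter_upwards [hsup _ (half_pos hε), (hF.tendsto_kin_sub hG hx hu hw hxM huM hunif
      hK).eventually (lt_mem_nhds (neg_lt_zero.2 (half_pos hε)))] with m h1 h2
    linarith
  obtain ⟨β, A, hβ, hβ0, hA, hrem⟩ := hF.exists_remainder_le hG hM0 hQ0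
  refine le_of_forall_pos_le_add fun ε hε => ?_
  have hη : 0 < ε / 8 := by positivity
  obtain ⟨L, hL1, hL2⟩ := hF.exists_level_excess_le hG hu hw hw' hwm hGw hlim hsup' hwM hβ hA hη
  have hab' : 0 < b - a := sub_pos.2 hab
  -- The level `L` makes the excess small for all large `m`. The step `s` is chosen after `L`, and
  -- only then the index `m`, whose errors must be small compared with `s`.
  obtain ⟨s, hs, hs₀⟩ := hrem L (ε / 8 / (b - a)) (by positivity)
  have hr := hs₀ s hs.le le_rfl
  have hsη : 0 < s * (ε / 8) := by positivity
  have hGi : ∀ m, IntegrableOn (fun t => G (w m t)) (Icc a b) := fun m =>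
    integrableOn_of_continuous (hG.cont.comp (hw m))
  have hsψ : Continuous fun t => s • ψ t := hψ.const_smul s
  have hsφ : Continuous fun t => s • φ t := hφ.const_smul s
  have hbd : ∀ y : ℝ → Vec N, (∀ t ∈ Icc a b, ‖y t‖ ≤ M) → ∀ t ∈ Icc a b,
      ‖y t + s • φ t‖ ≤ M + s * Q := by
    intro y hy t ht
    refine (norm_add_le _ _).trans (add_le_add (hy t ht) ?_)
    rw [norm_smul, Real.norm_of_nonneg hs.le]
    exact mul_le_mul_of_nonneg_left (hφQ t ht) hs.le
  obtain ⟨A', hA', hsh⟩ := hG.shift (s * Q)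
  have hKs : ∀ m, ∫ t in Icc a b, G (w m t + s • ψ t) ≤ A' * ((b - a) + K) := by
    intro m
    calc ∫ t in Icc a b, G (w m t + s • ψ t) ≤ ∫ t in Icc a b, A' * (1 + G (w m t)) := by
          refine setIntegral_mono_on (integrableOn_of_continuous
            (hG.cont.comp ((hw m).add hsψ))) (((integrable_const 1).add (hGi m)).const_mul A')
            measurableSet_Icc fun t ht => hsh _ _ ?_
          rw [norm_smul, Real.norm_of_nonneg hs.le]
          exact mul_le_mul_of_nonneg_left (hψQ t ht) hs.le
      _ = A' * ((b - a) + ∫ t in Icc a b, G (w m t)) := by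
          rw [integral_const_mul, integral_add (integrable_const 1) (hGi m), setIntegral_const,
            Real.volume_real_Icc_of_le hab.le, smul_eq_mul, mul_one]
      _ ≤ _ := by
          gcongr
          exact hK m
  have hk2 : Tendsto (fun m => kin a b F (fun t => x m t + s • φ t) (fun t => w m t + s • ψ t)
      - kin a b F (fun t => u t + s • φ t) fun t => w m t + s • ψ t) atTop (𝓝 0) :=
    hF.tendsto_kin_sub hG (fun m => (hx m).add hsφ) (hu.add hsφ)
    (fun m => (hw m).add hsψ) (fun m => hbd _ (hxM m)) (hbd _ huM)
    (TendstoUniformlyOn.add_fixed hunif fun t => s • φ t) hKs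
  have hlsc : ∀ᶠ m in atTop, kin a b F (fun t => u t + s • φ t) (fun t => w' t + s • ψ t) ≤
      kin a b F (fun t => u t + s • φ t) (fun t => w m t + s • ψ t) + s * (ε / 8) / 2 :=
    hF.eventually_kin_le hG (hu.add hsφ) (fun m => (hw m).add hsψ)
    (hw'.add (integrableOn_of_continuous hsψ)) (hwm.add hsψ.measurable)
    (hG.integrableOn_add hwm hGw hsψ) (hlim.add_const_smul hw hw' hψ s) (half_pos hsη)
  have hdp := tendsto_dpot hVx hf hx hφ hxM fun t ht => hunif.tendsto_at ht
  obtain ⟨m, hm1, hm2, hm3, hm4, hm5, hm6⟩ := (hL2.and ((hk2.eventually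
    (lt_mem_nhds (neg_lt_zero.2 (half_pos hsη)))).and (hlsc.and ((hsup _ hsη).and
    ((hcrit.eventually (gt_mem_nhds hη)).and
    (hdp.eventually (lt_mem_nhds (sub_lt_self _ hη)))))))).exists
  have e1 := abs_le.1 (hF.abs_kin_remainder_le hG hab.le hβ hr hu huM hwm hGw hφ hψ hφQ hψQ)
  have e2 := abs_le.1 (hF.abs_kin_remainder_le hG hab.le hβ hr (hx m) (hxM m)
    (hw m).measurable (hGi m) hφ hψ hφQ hψQ)
  have hε1 : ε / 8 / (b - a) * (b - a) = ε / 8 := by field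
  rw [hε1] at e1 e2
  have f1 := mul_le_mul_of_nonneg_left hL1 hs.le
  have f2 := mul_le_mul_of_nonneg_left hm1 hs.le
  -- The increment of the limit energy is at most that of the approximations up to small errors: the
  -- shifted energy is lower semicontinuous, and the unshifted ones do not exceed the limit.
  -- Expanding both increments and using almost criticality adds up to eight errors of size ε/8.
  have key : s * dkin a b Fx Fv u w' φ ψ ≤ s * (ε - dpot a b Vx f u φ) := by
    have f3 : s * dkin a b Fx Fv (x m) (w m) φ ψ ≤ s * (ε / 8 - (dpot a b Vx f u φ - ε / 8)) :=
      mul_le_mul_of_nonneg_left (by linarith) hs.le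
    linarith [e1.1, e2.2]
  have := le_of_mul_le_mul_left key hs
  linarith

theorem prim_add_smul {w z : ℝ → Vec N} (hw : Continuous w) (hz : Continuous z) (c : ℝ) (t : ℝ) :
    prim a (w + c • z) t = prim a w t + c • prim a z t := by
  simp only [prim, Pi.add_apply, Pi.smul_apply]
  have hcz : Continuous fun s => c • z s := hz.const_smul c
  rw [intervalIntegral.integral_add (hw.intervalIntegrable _ _)
    (hcz.intervalIntegrable _ _), intervalIntegral.integral_smul]

theorem dkin_neg (u w φ ψ : ℝ → Vec N) :
    dkin a b Fx Fv u w (fun t => -φ t) (fun t => -ψ t) = -dkin a b Fx Fv u w φ ψ := by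
  simp only [dkin, inner_neg_right, ← neg_add, integral_neg]

theorem dpot_neg (u φ : ℝ → Vec N) :
    dpot a b Vx f u (fun t => -φ t) = -dpot a b Vx f u φ := by
  simp only [dpot, inner_neg_right, integral_neg]

/-- Weak limits of Galerkin approximations of bounded energy are critical, and their level is not
below that of the approximations. -/
theorem IsKinetic.exists_critical_of_galerkin (hF : IsKinetic a b G Λ F Fx Fv)
    (hG : IsGrowthFunction G) {Gg : Vec N → Vec N}
    (hGc : IsConvexIntegrand (fun _ => G) fun _ => Gg) (hab : a < b)
    (hV : Continuous fun p : ℝ × Vec N => V p.1 p.2)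
    (hVx : Continuous fun p : ℝ × Vec N => Vx p.1 p.2) (hf : IntegrableOn f (Icc a b))
    {X : ℕ → Submodule ℝ (ℝ → Vec N)} (hX : Monotone X) (hXc : ∀ m, ∀ z ∈ X m, Continuous z)
    (hXb : ∀ m, ∀ z ∈ X m, prim a z b = 0)
    (hXd : ∀ p : ℝ → Vec N, IsPolyCurve p → ∃ m, (fun t => p t - mean a b p) ∈ X m)
    {w : ℕ → ℝ → Vec N} (hw : ∀ m, w m ∈ X m) {K γ₀ : ℝ}
    (hK : ∀ m, ∫ t in Icc a b, G (w m t) ≤ K)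
    (hcrit : ∀ m, ∀ z ∈ X m, |dkin a b Fx Fv (prim a (w m)) (w m) (prim a z) z +
      dpot a b Vx f (prim a (w m)) (prim a z)| ≤ 1 / ((m : ℝ) + 1) * ∫ t in Icc a b, ‖z t‖)
    (hlev : ∀ m, γ₀ ≤ kin a b F (prim a (w m)) (w m) + pot a b V f (prim a (w m))) :
    ∃ u : ℝ → Vec N, Continuous u ∧ AbsolutelyContinuousOnInterval u a b ∧ u a = 0 ∧ u b = 0 ∧
      IntegrableOn (fun t => G (deriv u t)) (Icc a b) ∧
      γ₀ ≤ kin a b F u (deriv u) + pot a b V f u ∧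
      ∀ m, ∀ z ∈ X m, dkin a b Fx Fv u (deriv u) (prim a z) z + dpot a b Vx f u (prim a z) = 0 := by
  have hwc : ∀ m, Continuous (w m) := fun m => hXc m _ (hw m)
  obtain ⟨σ, u, hσ, huc, huac, hua, hub, hunif, hlim⟩ := exists_weak_limit hab hG.cont hG.nonneg
    hG.superlinear hwc (fun m => hXb m _ (hw m)) hK
  obtain ⟨D, hD⟩ := hG.superlinear 1 one_pos
  set M := 1 * K + D * (b - a)
  have hwM : ∀ m, ∫ t in Icc a b, ‖w m t‖ ≤ M := fun m =>
    integral_norm_le_of_superlinear hab.le zero_le_one hD (integrableOn_of_continuous (hwc m))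
      (integrableOn_of_continuous (hG.cont.comp (hwc m))) (hK m)
  have hM0 : 0 ≤ M := (integral_nonneg fun _ => norm_nonneg _).trans (hwM 0)
  have hxM : ∀ m, ∀ t ∈ Icc a b, ‖prim a (w m) t‖ ≤ M := fun m t ht =>
    (norm_prim_le (integrableOn_of_continuous (hwc m)) ht).trans (hwM m)
  have huM : ∀ t ∈ Icc a b, ‖u t‖ ≤ M := fun t ht =>
    le_of_tendsto' (hunif.tendsto_at ht).norm fun m => hxM _ t ht
  have hwc' : ∀ m, Continuous (w (σ m)) := fun m => hwc _
  have hxc : ∀ m, Continuous (prim a (w (σ m))) := fun m => continuous_prim (hwc _)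
  have hdi := integrableOn_deriv_of_absolutelyContinuous hab.le huac
  have hdm : Measurable (deriv u) := measurable_deriv u
  have hGd : IntegrableOn (fun t => G (deriv u t)) (Icc a b) :=
    hGc.integrableOn_of_weakTendsto (fun m => integrableOn_of_continuous (hwc' m)) hdi hdm hlim
      (fun m => integrableOn_of_continuous (hG.cont.comp (hwc' m))) fun m => hK (σ m)
  have hmean : mean a b (deriv u) = 0 := by
    have h := prim_deriv hab.le huac (right_mem_Icc.2 hab.le)
    rw [prim, ← setIntegral_Icc_eq_intervalIntegral hab.le, hua, hub, sub_zero] at h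
    rw [mean, h, smul_zero]
  have huw : ∀ t ∈ Icc a b, prim a (deriv u) t = u t := fun t ht => by
    rw [prim_deriv hab.le huac ht, hua, sub_zero]
  -- The directions z + c·w_m are admissible because the spaces increase. The value c = −1 serves
  -- the energy comparison and c = 0 the first variation.
  have hcr0 : ∀ c : ℝ, ∀ k, ∀ z ∈ X k, Tendsto (fun m =>
      dkin a b Fx Fv (prim a (w (σ m))) (w (σ m)) (fun t => prim a z t + c • prim a (w (σ m)) t)
        (fun t => z t + c • w (σ m) t) +
      dpot a b Vx f (prim a (w (σ m))) (fun t => prim a z t + c • prim a (w (σ m)) t))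
      atTop (𝓝 0) := by
    intro c k z hz
    have hzc := hXc k z hz
    have h0 : Tendsto (fun m => 1 / ((σ m : ℝ) + 1) * ((∫ t in Icc a b, ‖z t‖) + |c| * M)) atTop
        (𝓝 0) := by
      have := (tendsto_one_div_add_atTop_nhds_zero_nat.comp hσ.tendsto_atTop).mul_const
        ((∫ t in Icc a b, ‖z t‖) + |c| * M)
      simpa using this
    refine squeeze_zero_norm' ?_ h0
    filter_upwards [eventually_ge_atTop k] with m hm
    have hmem : z + c • w (σ m) ∈ X (σ m) := Submodule.add_mem _
      (hX (hm.trans (hσ.id_le m)) hz) (Submodule.smul_mem _ _ (hw _))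
    have h1 := hcrit (σ m) _ hmem
    have h2 : prim a (z + c • w (σ m)) = fun t => prim a z t + c • prim a (w (σ m)) t :=
      funext fun t => prim_add_smul hzc (hwc' m) c t
    rw [h2] at h1
    refine h1.trans (mul_le_mul_of_nonneg_left ?_ (by positivity))
    have h3 : ∫ t in Icc a b, ‖(z + c • w (σ m)) t‖ ≤
        ∫ t in Icc a b, (‖z t‖ + |c| * ‖w (σ m) t‖) := by
      refine integral_mono
        (integrableOn_of_continuous (hzc.add ((hwc' m).const_smul c)).norm)
        (integrableOn_of_continuous (hzc.norm.add ((hwc' m).norm.const_mul |c|)))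
        fun t => (norm_add_le _ _).trans (le_of_eq ?_)
      rw [Pi.smul_apply, norm_smul, Real.norm_eq_abs]
    refine h3.trans ?_
    rw [integral_add (integrableOn_of_continuous hzc.norm)
      (integrableOn_of_continuous ((hwc' m).norm.const_mul |c|)), integral_const_mul]
    gcongr
    exact hwM _
  have hsup : ∀ ε > 0, ∀ᶠ m in atTop, kin a b F (prim a (w (σ m))) (w (σ m)) ≤
      kin a b F u (deriv u) + ε := by
    intro ε hε
    refine hF.eventually_kin_le_of_almost_critical (f := f) hG hab hVx hf hxc hwc' huc
      (fun m => hxM _) huM hunif (fun m => hK _) hdi hdm hGd hmean huw (fun p hp => ?_) hε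
    obtain ⟨k, hk⟩ := hXd p hp
    simpa only [neg_smul, one_smul, ← sub_eq_add_neg] using hcr0 (-1) k _ hk
  refine ⟨u, huc, huac, hua, hub, hGd, ?_, ?_⟩
  -- Potential energies converge and kinetic energies do not exceed the limit, so the level cannot
  -- drop.
  · refine le_of_forall_pos_le_add fun ε hε => ?_
    have hp := tendsto_pot hV hf hxc (fun m => hxM _) fun t ht => hunif.tendsto_at ht
    obtain ⟨m, h1, h2⟩ := ((hsup _ (half_pos hε)).and
      (hp.eventually (gt_mem_nhds (lt_add_of_pos_right _ (half_pos hε))))).exists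
    linarith [hlev (σ m)]
  · have hle : ∀ k, ∀ z ∈ X k,
        dkin a b Fx Fv u (deriv u) (prim a z) z + dpot a b Vx f u (prim a z) ≤ 0 := by
      intro k z hz
      refine hF.first_variation_le hG hab hVx hf hM0 hxc hwc' huc (fun m => hxM _) huM
        (fun m => hwM _) hunif (fun m => hK _) hdi hdm hGd hlim hsup
        (continuous_prim (hXc k z hz)) (hXc k z hz) ?_
      simpa only [zero_smul, add_zero] using hcr0 0 k z hz
    intro k z hz
    refine le_antisymm (hle k z hz) ?_
    -- The one-sided condition in the opposite direction gives equality.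
    have h1 := hle k (-z) (Submodule.neg_mem _ hz)
    have h2 : prim a (-z) = fun t => -prim a z t := funext fun t => by
      simp [prim, intervalIntegral.integral_neg]
    have h3 := dkin_neg (a := a) (b := b) (Fx := Fx) (Fv := Fv) u (deriv u) (prim a z) z
    have h4 := dpot_neg (a := a) (b := b) (Vx := Vx) (f := f) u (prim a z)
    rw [h2] at h1
    change dkin a b Fx Fv u (deriv u) (fun t => -prim a z t) (fun t => -z t) + _ ≤ 0 at h1
    rw [h3, h4] at h1
    linarith

end

section

/-! ### The energy on finite dimensional spaces of velocities -/

variable {N : ℕ} {a b Λ : ℝ} {G : Vec N → ℝ}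
  {F : ℝ → Vec N → Vec N → ℝ} {Fx Fv : ℝ → Vec N → Vec N → Vec N}
  {V : ℝ → Vec N → ℝ} {Vx : ℝ → Vec N → Vec N} {f : ℝ → Vec N}
  {H : Type*} [NormedAddCommGroup H] [InnerProductSpace ℝ H]

/-- Differentiation under the integral; the majorant is the maximum of the derivative over the
closed unit ball around `c` times `[a, b]`, which is compact because `H` is proper. -/
theorem hasFDerivAt_setIntegral_of_continuous [ProperSpace H] {g : H → ℝ → ℝ}
    {g' : H → ℝ → H →L[ℝ] ℝ} (hg : Continuous g.uncurry) (hg' : Continuous g'.uncurry)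
    (hd : ∀ c t, HasFDerivAt (fun c => g c t) (g' c t) c) (c : H) :
    HasFDerivAt (fun c => ∫ t in Icc a b, g c t) (∫ t in Icc a b, g' c t) c := by
  obtain ⟨K, hK⟩ := ((isCompact_closedBall c 1).prod
    (isCompact_Icc (a := a) (b := b))).exists_bound_of_continuousOn hg'.continuousOn
  refine hasFDerivAt_integral_of_dominated_of_fderiv_le (bound := fun _ => K)
    (Metric.closedBall_mem_nhds c one_pos)
    (Eventually.of_forall fun x => (hg.comp (.prodMk_right x)).aestronglyMeasurable)
    (integrableOn_of_continuous (hg.comp (.prodMk_right c)))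
    (hg'.comp (.prodMk_right c)).aestronglyMeasurable ?_ (integrable_const K)
    (Eventually.of_forall fun t x _ => hd x t)
  filter_upwards [ae_restrict_mem measurableSet_Icc] with t ht x hx using hK (x, t) ⟨hx, ht⟩

/-- The primitive vanishing at `a` of a curve of linear maps. -/
def primMap (a : ℝ) (W : ℝ → H →L[ℝ] Vec N) (t : ℝ) : H →L[ℝ] Vec N := ∫ s in a..t, W s

theorem primMap_apply {W : ℝ → H →L[ℝ] Vec N} (hW : Continuous W) (t : ℝ) (c : H) :
    primMap a W t c = prim a (fun s => W s c) t :=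
  ContinuousLinearMap.intervalIntegral_apply (hW.intervalIntegrable _ _) c

theorem continuous_primMap {W : ℝ → H →L[ℝ] Vec N} (hW : Continuous W) :
    Continuous (primMap a W) :=
  intervalIntegral.continuous_primitive (fun _ _ => hW.intervalIntegrable _ _) a

/-- The energy of the curve with velocity `w` starting from the origin. -/
def energy (a b : ℝ) (F : ℝ → Vec N → Vec N → ℝ) (V : ℝ → Vec N → ℝ) (f w : ℝ → Vec N) : ℝ :=
  kin a b F (prim a w) w + pot a b V f (prim a w)

/-- The differential of the energy at the velocity `w` in the direction of the velocity `z`. -/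
def denergy (a b : ℝ) (Fx Fv : ℝ → Vec N → Vec N → Vec N) (Vx : ℝ → Vec N → Vec N)
    (f w z : ℝ → Vec N) : ℝ :=
  dkin a b Fx Fv (prim a w) w (prim a z) z + dpot a b Vx f (prim a w) (prim a z)

/-- The derivative of the integrand of the energy, without the forcing term. -/
def energyDeriv (a : ℝ) (Fx Fv : ℝ → Vec N → Vec N → Vec N) (Vx : ℝ → Vec N → Vec N)
    (W : ℝ → H →L[ℝ] Vec N) (c : H) (t : ℝ) : H →L[ℝ] ℝ :=
  (innerSL ℝ (Fx t (primMap a W t c) (W t c))).comp (primMap a W t) +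
    (innerSL ℝ (Fv t (primMap a W t c) (W t c))).comp (W t) +
    (innerSL ℝ (Vx t (primMap a W t c))).comp (primMap a W t)

theorem IsKinetic.continuous_energyDeriv (hF : IsKinetic a b G Λ F Fx Fv)
    (hVx : Continuous fun p : ℝ × Vec N => Vx p.1 p.2) {W : ℝ → H →L[ℝ] Vec N}
    (hW : Continuous W) : Continuous (energyDeriv a Fx Fv Vx W).uncurry := by
  have hU := continuous_primMap (a := a) hW
  have h1 : Continuous fun q : H × ℝ => primMap a W q.2 q.1 :=
    (hU.comp continuous_snd).clm_apply continuous_fst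
  have h2 : Continuous fun q : H × ℝ => W q.2 q.1 := (hW.comp continuous_snd).clm_apply continuous_fst
  have h3 := (innerSL ℝ (E := Vec N)).continuous.comp
    (hF.contX.comp (continuous_snd.prodMk (h1.prodMk h2)))
  have h4 := (innerSL ℝ (E := Vec N)).continuous.comp
    (hF.contV.comp (continuous_snd.prodMk (h1.prodMk h2)))
  have h5 := (innerSL ℝ (E := Vec N)).continuous.comp (hVx.comp (continuous_snd.prodMk h1))
  exact ((h3.clm_comp (hU.comp continuous_snd)).add (h4.clm_comp (hW.comp continuous_snd))).add
    (h5.clm_comp (hU.comp continuous_snd))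

/-- The forcing is merely integrable in time, so it is kept apart from the continuous part of the
integrand. It enters linearly and contributes a constant derivative. -/
theorem integrableOn_forcing {W : ℝ → H →L[ℝ] Vec N} (hW : Continuous W)
    (hf : IntegrableOn f (Icc a b)) :
    IntegrableOn (fun t => (innerSL ℝ (f t)).comp (primMap a W t)) (Icc a b) := by
  have hU := continuous_primMap (a := a) hW
  obtain ⟨K, hK⟩ := (isCompact_Icc (a := a) (b := b)).exists_bound_of_continuousOn hU.continuousOn
  refine (hf.norm.mul_const K).mono'
    ((ContinuousLinearMap.compL ℝ H (Vec N) ℝ).aestronglyMeasurable_comp₂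
      ((innerSL ℝ (E := Vec N)).continuous.comp_aestronglyMeasurable hf.aestronglyMeasurable)
      hU.aestronglyMeasurable) ?_
  filter_upwards [ae_restrict_mem measurableSet_Icc] with t ht
  refine (ContinuousLinearMap.opNorm_comp_le _ _).trans ?_
  rw [innerSL_apply_norm]
  exact mul_le_mul_of_nonneg_left (hK t ht) (norm_nonneg _)

theorem IsKinetic.denergy_eq (hF : IsKinetic a b G Λ F Fx Fv)
    (hVx : Continuous fun p : ℝ × Vec N => Vx p.1 p.2) (hf : IntegrableOn f (Icc a b))
    {W : ℝ → H →L[ℝ] Vec N} (hW : Continuous W) (c d : H) :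
    denergy a b Fx Fv Vx f (fun t => W t c) (fun t => W t d) =
      ((∫ t in Icc a b, energyDeriv a Fx Fv Vx W c t) +
        ∫ t in Icc a b, (innerSL ℝ (f t)).comp (primMap a W t)) d := by
  have hU := continuous_primMap (a := a) hW
  have hUe : ∀ c, prim a (fun s => W s c) = fun t => primMap a W t c :=
    fun c => funext fun t => (primMap_apply hW t c).symm
  have hWc : ∀ c, Continuous fun t => W t c := fun c => hW.clm_apply continuous_const
  have hUc : ∀ c, Continuous fun t => primMap a W t c := fun c => hU.clm_apply continuous_const
  have hgc : Continuous (energyDeriv a Fx Fv Vx W c) :=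
    (hF.continuous_energyDeriv hVx hW).uncurry_left c
  have e1 : IntegrableOn (energyDeriv a Fx Fv Vx W c) (Icc a b) := integrableOn_of_continuous hgc
  have hVc : Continuous fun t => Vx t (primMap a W t c) :=
    hVx.comp (continuous_id.prodMk (hUc c))
  have e2 : IntegrableOn (fun t => inner ℝ (Vx t (primMap a W t c)) (primMap a W t d)) (Icc a b) :=
    integrableOn_inner_right (integrableOn_of_continuous hVc) (hUc d)
  have e3 : IntegrableOn (fun t => inner ℝ (Fx t (primMap a W t c) (W t c)) (primMap a W t d) +
      inner ℝ (Fv t (primMap a W t c) (W t c)) (W t d)) (Icc a b) := by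
    have hXc : Continuous fun t => Fx t (primMap a W t c) (W t c) :=
      hF.contX.comp (continuous_id.prodMk ((hUc c).prodMk (hWc c)))
    have hVc : Continuous fun t => Fv t (primMap a W t c) (W t c) :=
      hF.contV.comp (continuous_id.prodMk ((hUc c).prodMk (hWc c)))
    exact (integrableOn_inner_right (integrableOn_of_continuous hXc) (hUc d)).add
      (integrableOn_inner_right (integrableOn_of_continuous hVc) (hWc d))
  rw [denergy, dkin, dpot, hUe, hUe, add_apply,
    ContinuousLinearMap.integral_apply e1,
    ContinuousLinearMap.integral_apply (integrableOn_forcing hW hf)]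
  have e4 : (∫ t in Icc a b, inner ℝ (Vx t (primMap a W t c) + f t) (primMap a W t d)) =
      (∫ t in Icc a b, inner ℝ (Vx t (primMap a W t c)) (primMap a W t d)) +
      ∫ t in Icc a b, inner ℝ (f t) (primMap a W t d) := by
    simp only [inner_add_left]
    exact integral_add e2 (integrableOn_inner_right hf (hUc d))
  rw [e4, ← add_assoc, ← integral_add e3 e2]
  simp [energyDeriv]

/-- The energy is continuously differentiable along finite dimensional spaces of velocities. -/
theorem IsKinetic.hasStrictFDerivAt_energy [FiniteDimensional ℝ H]
    (hF : IsKinetic a b G Λ F Fx Fv)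
    (hV : Continuous fun p : ℝ × Vec N => V p.1 p.2)
    (hVx : Continuous fun p : ℝ × Vec N => Vx p.1 p.2)
    (hVd : ∀ t x, HasGradientAt (V t) (Vx t x) x) (hf : IntegrableOn f (Icc a b))
    {W : ℝ → H →L[ℝ] Vec N} (hW : Continuous W) :
    ∃ DJ : H → H, Continuous DJ ∧
      (∀ c, HasStrictFDerivAt (fun c => energy a b F V f fun t => W t c) (innerSL ℝ (DJ c)) c) ∧
      ∀ c d, inner ℝ (DJ c) d = denergy a b Fx Fv Vx f (fun t => W t c) (fun t => W t d) := by
  have : ProperSpace H := FiniteDimensional.proper_real H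
  have hU := continuous_primMap (a := a) hW
  have hUe : ∀ c, prim a (fun s => W s c) = fun t => primMap a W t c :=
    fun c => funext fun t => (primMap_apply hW t c).symm
  have hWc : ∀ c, Continuous fun t => W t c := fun c => hW.clm_apply continuous_const
  have hUc : ∀ c, Continuous fun t => primMap a W t c := fun c => hU.clm_apply continuous_const
  have h1 : Continuous fun q : H × ℝ => primMap a W q.2 q.1 :=
    (hU.comp continuous_snd).clm_apply continuous_fst
  have h2 : Continuous fun q : H × ℝ => W q.2 q.1 := (hW.comp continuous_snd).clm_apply continuous_fst
  let g : H → ℝ → ℝ := fun c t => F t (primMap a W t c) (W t c) + V t (primMap a W t c)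
  have hg : Continuous g.uncurry :=
    (hF.cont.comp (continuous_snd.prodMk (h1.prodMk h2))).add (hV.comp (continuous_snd.prodMk h1))
  have hg' := hF.continuous_energyDeriv hVx hW
  have hgd : ∀ c t, HasFDerivAt (fun c => g c t) (energyDeriv a Fx Fv Vx W c t) c := by
    intro c t
    have h := ((hF.hasFDeriv t (primMap a W t c) (W t c)).comp c
      ((primMap a W t).hasFDerivAt.prodMk (W t).hasFDerivAt)).add
      ((hVd t (primMap a W t c)).hasFDerivAt.comp c (primMap a W t).hasFDerivAt)
    refine h.congr_fderiv ?_
    ext d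
    simp [energyDeriv]
  let l : ℝ → H →L[ℝ] ℝ := fun t => (innerSL ℝ (f t)).comp (primMap a W t)
  have hl : IntegrableOn l (Icc a b) := integrableOn_forcing hW hf
  let J' : H → H →L[ℝ] ℝ := fun c => (∫ t in Icc a b, energyDeriv a Fx Fv Vx W c t) +
    ∫ t in Icc a b, l t
  have hJ'c : Continuous J' :=
    (continuous_parametric_integral_of_continuous hg' isCompact_Icc).add continuous_const
  have hfU : ∀ c, IntegrableOn (fun t => inner ℝ (f t) (primMap a W t c)) (Icc a b) :=
    fun c => integrableOn_inner_right hf (hUc c)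
  have hJe : ∀ c, energy a b F V f (fun t => W t c) =
      (∫ t in Icc a b, g c t) + (∫ t in Icc a b, l t) c := by
    intro c
    rw [ContinuousLinearMap.integral_apply hl, energy, kin, pot, hUe]
    have e1 : IntegrableOn (fun t => V t (primMap a W t c)) (Icc a b) :=
      integrableOn_of_continuous (hV.comp (continuous_id.prodMk (hUc c)))
    have e2 : IntegrableOn (fun t => F t (primMap a W t c) (W t c)) (Icc a b) :=
      integrableOn_of_continuous (hF.continuous_comp (hUc c) (hWc c))
    rw [integral_add e1 (hfU c), ← add_assoc, ← integral_add e2 e1]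
    simp [g, l]
  have hJd : ∀ c, HasFDerivAt (fun c => energy a b F V f fun t => W t c) (J' c) c := by
    intro c
    rw [funext hJe]
    exact (hasFDerivAt_setIntegral_of_continuous hg hg' hgd c).add
      (∫ t in Icc a b, l t).hasFDerivAt
  -- The gradient is the Riesz representative of the derivative; continuity of the derivative
  -- upgrades it to a strict one.
  refine ⟨fun c => (InnerProductSpace.toDual ℝ H).symm (J' c),
    (InnerProductSpace.toDual ℝ H).symm.continuous.comp hJ'c, fun c => ?_, fun c d => ?_⟩
  · have e : innerSL ℝ ((InnerProductSpace.toDual ℝ H).symm (J' c)) = J' c := by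
      ext d
      simp
    rw [e]
    exact hasStrictFDerivAt_of_hasFDerivAt_of_continuousAt (Eventually.of_forall hJd)
      hJ'c.continuousAt
  · rw [InnerProductSpace.toDual_symm_apply, hF.denergy_eq hVx hf hW]

end

section

/-! ### Galerkin spaces -/

variable {N : ℕ} {a b Λ : ℝ} {G : Vec N → ℝ}
  {F : ℝ → Vec N → Vec N → ℝ} {Fx Fv : ℝ → Vec N → Vec N → Vec N}
  {V : ℝ → Vec N → ℝ} {Vx : ℝ → Vec N → Vec N} {f : ℝ → Vec N}

/-- The monomial of degree `i + 1`, normalized to have mean zero on `[a,b]`. -/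
def basisFun (a b : ℝ) (i : ℕ) (t : ℝ) : ℝ := t ^ (i + 1) - (b - a)⁻¹ * ∫ s in Icc a b, s ^ (i + 1)

theorem continuous_basisFun (i : ℕ) : Continuous (basisFun a b i) :=
  (continuous_pow _).sub continuous_const

theorem integral_basisFun (hab : a < b) (i : ℕ) : ∫ s in a..b, basisFun a b i s = 0 := by
  have h : b - a ≠ 0 := (sub_pos.2 hab).ne'
  simp only [basisFun, setIntegral_Icc_eq_intervalIntegral hab.le]
  rw [intervalIntegral.integral_sub ((continuous_pow _).intervalIntegrable _ _)
    intervalIntegrable_const, intervalIntegral.integral_const, smul_eq_mul]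
  field_simp
  ring

/-- Polynomial velocities of degree at most `m + 1` with mean zero. -/
def galerkinSpace (N : ℕ) (a b : ℝ) (m : ℕ) : Submodule ℝ (ℝ → Vec N) :=
  Submodule.span ℝ {z | ∃ i ≤ m, ∃ v : Vec N, z = fun t => basisFun a b i t • v}

theorem basisFun_smul_mem {i m : ℕ} (hi : i ≤ m) (v : Vec N) :
    (fun t => basisFun a b i t • v) ∈ galerkinSpace N a b m :=
  Submodule.subset_span ⟨i, hi, v, rfl⟩

theorem galerkinSpace_mono : Monotone (galerkinSpace N a b) := fun _ _ h =>
  Submodule.span_mono fun _ ⟨i, hi, v, hz⟩ => ⟨i, hi.trans h, v, hz⟩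

/-- The parametrization of the Galerkin space by coefficients. -/
def galerkinMap (N : ℕ) (a b : ℝ) (m : ℕ) (t : ℝ) :
    PiLp 2 (fun _ : Fin (m + 1) => Vec N) →L[ℝ] Vec N :=
  ∑ i : Fin (m + 1), basisFun a b i t • PiLp.proj 2 (fun _ => Vec N) i

theorem galerkinMap_apply (m : ℕ) (t : ℝ) (c : PiLp 2 (fun _ : Fin (m + 1) => Vec N)) :
    galerkinMap N a b m t c = ∑ i : Fin (m + 1), basisFun a b i t • c i := by
  simp [galerkinMap]

theorem continuous_galerkinMap (m : ℕ) : Continuous (galerkinMap N a b m) :=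
  continuous_finsetSum _ fun _ _ => (continuous_basisFun _).smul continuous_const

theorem galerkinMap_mem (m : ℕ) (c : PiLp 2 (fun _ : Fin (m + 1) => Vec N)) :
    (fun t => galerkinMap N a b m t c) ∈ galerkinSpace N a b m := by
  have h : (fun t => galerkinMap N a b m t c) =
      ∑ i : Fin (m + 1), fun t => basisFun a b i t • c i := by
    ext1 t
    rw [galerkinMap_apply, Finset.sum_apply]
  rw [h]
  exact Submodule.sum_mem _ fun i _ => basisFun_smul_mem (by omega) _

theorem exists_galerkinMap_eq {m : ℕ} {z : ℝ → Vec N} (hz : z ∈ galerkinSpace N a b m) :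
    ∃ c, z = fun t => galerkinMap N a b m t c := by
  induction hz using Submodule.span_induction with
  | mem z hz =>
    obtain ⟨i, hi, v, rfl⟩ := hz
    refine ⟨PiLp.single 2 (⟨i, by omega⟩ : Fin (m + 1)) v, ?_⟩
    ext1 t
    rw [galerkinMap_apply, Finset.sum_eq_single ⟨i, by omega⟩]
    · simp
    · intro j _ hj
      simp [hj]
    · simp
  | zero => exact ⟨0, by ext1; simp⟩
  | add x y _ _ hx hy =>
    obtain ⟨c, rfl⟩ := hx
    obtain ⟨d, rfl⟩ := hy
    exact ⟨c + d, by ext1; simp⟩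
  | smul r x _ hx =>
    obtain ⟨c, rfl⟩ := hx
    exact ⟨r • c, by ext1; simp⟩

theorem continuous_of_mem_galerkinSpace {m : ℕ} {z : ℝ → Vec N} (hz : z ∈ galerkinSpace N a b m) :
    Continuous z := by
  obtain ⟨c, rfl⟩ := exists_galerkinMap_eq hz
  exact (continuous_galerkinMap m).clm_apply continuous_const

theorem prim_eq_zero_of_mem_galerkinSpace (hab : a < b) {m : ℕ} {z : ℝ → Vec N}
    (hz : z ∈ galerkinSpace N a b m) : prim a z b = 0 := by
  obtain ⟨c, rfl⟩ := exists_galerkinMap_eq hz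
  simp only [prim, galerkinMap_apply]
  have h : ∀ i : Fin (m + 1), Continuous fun t => basisFun a b i t • c i := fun i =>
    (continuous_basisFun _).smul continuous_const
  rw [intervalIntegral.integral_finsetSum fun i _ => (h i).intervalIntegrable _ _]
  refine Finset.sum_eq_zero fun i _ => ?_
  rw [intervalIntegral.integral_smul_const, integral_basisFun hab, zero_smul]

theorem IsPolyCurve.sub_mean_mem_galerkinSpace (hab : a < b) {p : ℝ → Vec N}
    (hp : IsPolyCurve p) : ∃ m, (fun t => p t - mean a b p) ∈ galerkinSpace N a b m := by
  obtain ⟨m, c, hc⟩ := hp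
  refine ⟨m, ?_⟩
  have hi : ∀ i, IntegrableOn (fun t : ℝ => t ^ i • c i) (Icc a b) := fun i =>
    integrableOn_of_continuous ((continuous_pow i).smul continuous_const)
  have h : (fun t => p t - mean a b p) = ∑ i ∈ Finset.range m,
      fun t => (t ^ i - (b - a)⁻¹ * ∫ s in Icc a b, s ^ i) • c i := by
    ext1 t
    rw [Finset.sum_apply, mean, funext hc, integral_finsetSum _ fun i _ => hi i,
      Finset.smul_sum, ← Finset.sum_sub_distrib]
    refine Finset.sum_congr rfl fun i _ => ?_
    rw [integral_smul_const, sub_smul, mul_smul]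
  rw [h]
  refine Submodule.sum_mem _ fun i hi => ?_
  -- The constant monomial disappears after subtracting its mean; this is why the basis starts at
  -- degree one.
  cases i with
  | zero =>
    have e : (fun t : ℝ => (t ^ 0 - (b - a)⁻¹ * ∫ s in Icc a b, s ^ 0) • c 0) = 0 := by
      ext1 t
      have h : b - a ≠ 0 := (sub_pos.2 hab).ne'
      simp [Real.volume_real_Icc_of_le hab.le, h]
    rw [e]
    exact Submodule.zero_mem _
  | succ i => exact basisFun_smul_mem (by rw [Finset.mem_range] at hi; omega) _

/-- Each coordinate is a polynomial with infinitely many zeros. Its coefficient of degree `i + 1` is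
`c i`, because the subtracted means affect only degree zero. -/
theorem galerkinMap_injective (hab : a < b) {m : ℕ} {c : PiLp 2 (fun _ : Fin (m + 1) => Vec N)}
    (h : ∀ t ∈ Icc a b, galerkinMap N a b m t c = 0) : c = 0 := by
  open Polynomial in
  ext i k
  let P : ℝ[X] := ∑ j : Fin (m + 1),
    C (c j k) * (X ^ ((j : ℕ) + 1) - C ((b - a)⁻¹ * ∫ s in Icc a b, s ^ ((j : ℕ) + 1)))
  have hP : P = 0 := by
    refine Polynomial.eq_zero_of_infinite_isRoot P ((Icc_infinite hab).mono fun t ht => ?_)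
    have h1 := congrArg (fun x : Vec N => x k) (h t ht)
    simp only [galerkinMap_apply, basisFun] at h1
    simpa [P, Polynomial.IsRoot, Polynomial.eval_finsetSum, mul_comm] using h1
  have h2 := congrArg (fun p => p.coeff ((i : ℕ) + 1)) hP
  simpa [P, Polynomial.finsetSum_coeff, Polynomial.coeff_X_pow, Polynomial.coeff_C, Fin.ext_iff,
    mul_sub, Finset.sum_ite_eq, ← Fin.ext_iff] using h2

/-- Injectivity and compactness of the unit sphere give a positive minimum of the L¹ norm, and
homogeneity does the rest. This converts a bound on the gradient in coefficients into one relative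
to the L¹ norm of velocities, which is comparable across Galerkin spaces. -/
theorem exists_norm_le_integral_galerkinMap (hab : a < b) (m : ℕ) :
    ∃ K > 0, ∀ c, K * ‖c‖ ≤ ∫ t in Icc a b, ‖galerkinMap N a b m t c‖ := by
  have hW := continuous_galerkinMap (N := N) (a := a) (b := b) m
  have hWu : Continuous (Function.uncurry fun c t => ‖galerkinMap N a b m t c‖) :=
    ((hW.comp continuous_snd).clm_apply continuous_fst).norm
  obtain ⟨K, hK, h⟩ := (isCompact_sphere (0 : PiLp 2 (fun _ : Fin (m + 1) => Vec N)) 1).exists_forall_le'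
    (continuous_parametric_integral_of_continuous (μ := volume) hWu
      (isCompact_Icc (a := a) (b := b))).continuousOn (a := 0) fun c hc => by
    have hWc : Continuous fun t => ‖galerkinMap N a b m t c‖ := hWu.uncurry_left c
    refine (integral_nonneg fun t => norm_nonneg _).lt_of_ne fun h0 => ?_
    have h1 := (setIntegral_eq_zero_iff_of_nonneg_ae (Eventually.of_forall fun t => norm_nonneg _)
      (integrableOn_of_continuous hWc)).1 h0.symm
    have h2 := Measure.eqOn_Icc_of_ae_eq volume hab.ne h1 hWc.continuousOn continuousOn_const
    have h3 := galerkinMap_injective hab fun t ht => norm_eq_zero.1 (h2 ht)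
    rw [h3] at hc
    simp at hc
  refine ⟨K, hK, fun c => ?_⟩
  rcases eq_or_ne c 0 with rfl | hc
  · simp
  have hn : 0 < ‖c‖ := norm_pos_iff.2 hc
  have h1 := h (‖c‖⁻¹ • c) (by simp [norm_smul, hn.ne'])
  simp only [map_smul, norm_smul, norm_inv, norm_norm] at h1
  rw [integral_const_mul] at h1
  rwa [le_inv_mul_iff₀ hn, mul_comm] at h1

/-- The mountain pass theorem on a Galerkin space. The ridge is a sphere of the modular. -/
theorem IsKinetic.exists_almost_critical (hF : IsKinetic a b G Λ F Fx Fv)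
    (hG : IsGrowthFunction G) (hab : a < b)
    (hV : Continuous fun p : ℝ × Vec N => V p.1 p.2)
    (hVx : Continuous fun p : ℝ × Vec N => Vx p.1 p.2)
    (hVd : ∀ t x, HasGradientAt (V t) (Vx t x) x) (hf : IntegrableOn f (Icc a b))
    {R γ₀ κ : ℝ} (hγ₀ : 0 < γ₀) {m : ℕ}
    (hridge : ∀ w ∈ galerkinSpace N a b m, ∫ t in Icc a b, G (R⁻¹ • w t) = 1 →
      γ₀ ≤ energy a b F V f w)
    (h0 : energy a b F V f (fun _ => 0) ≤ 0) {e : ℝ → Vec N} (he : e ∈ galerkinSpace N a b m)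
    (heR : 1 ≤ ∫ t in Icc a b, G (R⁻¹ • e t)) (he0 : energy a b F V f e ≤ 0)
    (hκ : ∀ s ∈ Icc (0 : ℝ) 1, energy a b F V f (fun t => s • e t) ≤ κ) {ε : ℝ} (hε : 0 < ε) :
    ∃ w ∈ galerkinSpace N a b m, γ₀ ≤ energy a b F V f w ∧ energy a b F V f w ≤ κ ∧
      ∀ z ∈ galerkinSpace N a b m,
        |denergy a b Fx Fv Vx f w z| ≤ ε * ∫ t in Icc a b, ‖z t‖ := by
  have hW := continuous_galerkinMap (N := N) (a := a) (b := b) m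
  obtain ⟨DJ, hDJ, hJ, hd⟩ := hF.hasStrictFDerivAt_energy hV hVx hVd hf hW
  obtain ⟨K, hK, hKb⟩ := exists_norm_le_integral_galerkinMap (N := N) hab m
  obtain ⟨c, rfl⟩ := exists_galerkinMap_eq he
  have hRW : Continuous fun q : PiLp 2 (fun _ : Fin (m + 1) => Vec N) × ℝ =>
      R⁻¹ • galerkinMap N a b m q.2 q.1 :=
    ((hW.comp continuous_snd).clm_apply continuous_fst).const_smul R⁻¹
  have hGu : Continuous (Function.uncurry fun c t => G (R⁻¹ • galerkinMap N a b m t c)) :=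
    hG.cont.comp hRW
  have hGc := continuous_parametric_integral_of_continuous (μ := volume) hGu
    (isCompact_Icc (a := a) (b := b))
  -- The modular of velocity/R is 0 at the start of a path and at least 1 at its end, so by
  -- continuity every path crosses the ridge. The tolerance ε·K absorbs the norm equivalence.
  obtain ⟨x, hx1, hx2, hx3⟩ := exists_almost_critical_of_mountain_pass hJ hDJ (e := c)
    (by simpa using h0) he0 hγ₀ (fun p hp0 hp1 => by
      have hp : Continuous fun τ => ∫ t in Icc a b, G (R⁻¹ • galerkinMap N a b m t (p τ)) :=
        hGc.comp p.continuous
      have h1 : (1 : ℝ) ∈ Icc (∫ t in Icc a b, G (R⁻¹ • galerkinMap N a b m t (p 0)))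
          (∫ t in Icc a b, G (R⁻¹ • galerkinMap N a b m t (p 1))) := by
        rw [hp0, hp1]
        exact ⟨by simp [hG.zero], heR⟩
      obtain ⟨τ, hτ⟩ := mem_range_of_exists_le_of_exists_ge hp ⟨0, h1.1⟩ ⟨1, h1.2⟩
      exact ⟨τ, hridge _ (galerkinMap_mem m _) hτ⟩)
    (fun s hs => by simpa using hκ s hs) (mul_pos hε hK)
  refine ⟨_, galerkinMap_mem m x, hx1, hx2, fun z hz => ?_⟩
  obtain ⟨d, rfl⟩ := exists_galerkinMap_eq hz
  rw [← hd]
  calc |inner ℝ (DJ x) d| ≤ ‖DJ x‖ * ‖d‖ := abs_real_inner_le_norm _ _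
    _ ≤ ε * K * ‖d‖ := by gcongr
    _ = ε * (K * ‖d‖) := by ring
    _ ≤ _ := by gcongr; exact hKb d

end

section

/-! ### Existence of a critical curve -/

variable {N : ℕ} {a b Λ : ℝ} {G : Vec N → ℝ}
  {F : ℝ → Vec N → Vec N → ℝ} {Fx Fv : ℝ → Vec N → Vec N → Vec N}
  {V : ℝ → Vec N → ℝ} {Vx : ℝ → Vec N → Vec N} {f : ℝ → Vec N}

/-- The Ambrosetti–Rabinowitz conditions bound the modular of almost critical velocities. -/
theorem IsKinetic.exists_modular_bound (hF : IsKinetic a b G Λ F Fx Fv)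
    (hG : IsGrowthFunction G) (hab : a < b)
    (hV : Continuous fun p : ℝ × Vec N => V p.1 p.2)
    (hVx : Continuous fun p : ℝ × Vec N => Vx p.1 p.2) (hf : IntegrableOn f (Icc a b))
    {θF θV r₀ : ℝ} (hθ : θF < θV) (hθV : 1 < θV)
    (hF3 : ∀ t ∈ Icc a b, ∀ x v,
      inner ℝ (Fx t x v) x + inner ℝ (Fv t x v) v ≤ θF * F t x v)
    (hV1 : ∀ t ∈ Icc a b, ∀ x, r₀ ≤ ‖x‖ → inner ℝ (Vx t x) x ≤ θV * V t x) (κ : ℝ) :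
    ∃ K, ∀ w : ℝ → Vec N, Continuous w → energy a b F V f w ≤ κ →
      |denergy a b Fx Fv Vx f w w| ≤ ∫ t in Icc a b, ‖w t‖ → ∫ t in Icc a b, G (w t) ≤ K := by
  -- Condition (V1) is available only for ‖x‖ ≥ r₀; the defect inside that ball is bounded by
  -- compactness.
  obtain ⟨C, hC, hCb⟩ := exists_bound_of_continuous_comp
    (f := fun t (x : Vec N) => θV * V t x - inner ℝ (Vx t x) x)
    ((hV.const_mul θV).sub (hVx.inner continuous_snd)) a b r₀
  set n := ∫ t in Icc a b, ‖f t‖ with hn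
  have hn0 : 0 ≤ n := integral_nonneg fun t => norm_nonneg _
  set c := (θV - θF) * Λ with hc
  have hc0 : 0 < c := mul_pos (sub_pos.2 hθ) hF.pos
  -- The coefficient of ∫‖w‖: 1 from the bound on the derivative, (θV − 1)‖f‖₁ from the forcing. The
  -- slope c/(2M) in the next application of superlinearity lets half of c∫G absorb this term.
  set M := 1 + (θV - 1) * n with hM
  have hM0 : 0 < M := add_pos_of_pos_of_nonneg one_pos (mul_nonneg (by linarith) hn0)
  obtain ⟨D, hD⟩ := hG.superlinear (c / (2 * M)) (by positivity)
  refine ⟨(θV * κ + C * (b - a) + M * (D * (b - a))) * (2 / c), fun w hw hκ hd => ?_⟩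
  set u := prim a w with hu
  have huc : Continuous u := continuous_prim hw
  have hGw : Continuous fun t => G (w t) := hG.cont.comp hw
  have hI := integral_norm_le_of_superlinear hab.le (by positivity) hD
    (integrableOn_of_continuous hw) (integrableOn_of_continuous hGw) le_rfl
  set I := ∫ t in Icc a b, G (w t) with hIdef
  set P := ∫ t in Icc a b, ‖w t‖ with hP
  have huP : ∀ t ∈ Icc a b, ‖u t‖ ≤ P := fun t ht =>
    norm_prim_le (integrableOn_of_continuous hw) ht
  have hFi : IntegrableOn (fun t => F t (u t) (w t)) (Icc a b) :=
    integrableOn_of_continuous (hF.continuous_comp huc hw)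
  have hVc : Continuous fun t => V t (u t) := hV.comp (continuous_id.prodMk huc)
  have hVxc : Continuous fun t => Vx t (u t) := hVx.comp (continuous_id.prodMk huc)
  have hpi : IntegrableOn (fun t => V t (u t) + inner ℝ (f t) (u t)) (Icc a b) :=
    (integrableOn_of_continuous hVc).add (integrableOn_inner_right hf huc)
  have hdi := hF.integrableOn_dkin huc hw.measurable (integrableOn_of_continuous hGw) huc hw
  have hVf : IntegrableOn (fun t => Vx t (u t) + f t) (Icc a b) :=
    (integrableOn_of_continuous hVxc).add hf
  have hdpi := integrableOn_inner_right hVf huc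
  -- The integrand of θV·J(u) − J'(u)u, bounded below pointwise by (F3), (F4), (V1) and the sup
  -- bound on `u`.
  have key : ∫ t in Icc a b, (c * G (w t) - C - (θV - 1) * P * ‖f t‖) ≤
      ∫ t in Icc a b, (θV * (F t (u t) (w t) + (V t (u t) + inner ℝ (f t) (u t))) -
        ((inner ℝ (Fx t (u t) (w t)) (u t) + inner ℝ (Fv t (u t) (w t)) (w t)) +
          inner ℝ (Vx t (u t) + f t) (u t))) := by
    refine setIntegral_mono_on ((((integrableOn_of_continuous hGw).const_mul c).sub
      (integrable_const C)).sub (hf.norm.const_mul _))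
      (((hFi.add hpi).const_mul θV).sub (hdi.add hdpi)) measurableSet_Icc fun t ht => ?_
    have h1 := hF3 t ht (u t) (w t)
    have h2 : -C ≤ θV * V t (u t) - inner ℝ (Vx t (u t)) (u t) := by
      rcases le_or_gt r₀ ‖u t‖ with h | h
      · have := hV1 t ht _ h
        linarith
      · exact (abs_le.1 (hCb t ht _ h.le)).1
    have h3 : -(P * ‖f t‖) ≤ inner ℝ (f t) (u t) := by
      have h := (abs_le.1 (abs_real_inner_le_norm (f t) (u t))).1
      have h' := mul_le_mul_of_nonneg_left (huP t ht) (norm_nonneg (f t))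
      linarith
    have h4 : c * G (w t) ≤ (θV - θF) * F t (u t) (w t) := by
      rw [hc, mul_assoc]
      exact mul_le_mul_of_nonneg_left (hF.lower _ _ _) (by linarith)
    have h5 := mul_le_mul_of_nonneg_left h3 (by linarith : 0 ≤ θV - 1)
    rw [inner_add_left]
    linarith
  have hcG : IntegrableOn (fun t => c * G (w t)) (Icc a b) :=
    (integrableOn_of_continuous hGw).const_mul c
  have hcC : IntegrableOn (fun t => c * G (w t) - C) (Icc a b) := hcG.sub (integrable_const C)
  have hfP : IntegrableOn (fun t => (θV - 1) * P * ‖f t‖) (Icc a b) := hf.norm.const_mul _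
  have hE : IntegrableOn (fun t => θV * (F t (u t) (w t) + (V t (u t) + inner ℝ (f t) (u t))))
    (Icc a b) := (hFi.add hpi).const_mul θV
  have hdE : IntegrableOn (fun t =>
    (inner ℝ (Fx t (u t) (w t)) (u t) + inner ℝ (Fv t (u t) (w t)) (w t)) +
      inner ℝ (Vx t (u t) + f t) (u t)) (Icc a b) := hdi.add hdpi
  rw [integral_sub hcC hfP, integral_sub hcG (integrable_const C), integral_const_mul,
    integral_const_mul, setIntegral_const, Real.volume_real_Icc_of_le hab.le, integral_sub hE hdE,
    integral_const_mul, integral_add hFi hpi, integral_add hdi hdpi, smul_eq_mul, ← hn] at key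
  have h1 : θV * energy a b F V f w ≤ θV * κ := mul_le_mul_of_nonneg_left hκ (by linarith)
  have h2 := (abs_le.1 hd).1
  simp only [energy, denergy, kin, pot, dkin, dpot, ← hu] at h1 h2
  have h3 : M * P ≤ c / 2 * I + M * (D * (b - a)) := by
    have h := mul_le_mul_of_nonneg_left hI hM0.le
    have e : M * (c / (2 * M) * I + D * (b - a)) = c / 2 * I + M * (D * (b - a)) := by field
    linarith
  have h4 : M * P = P + (θV - 1) * P * n := by rw [hM]; ring
  have h5 : c / 2 * I ≤ θV * κ + C * (b - a) + M * (D * (b - a)) := by linarith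
  calc I = c / 2 * I * (2 / c) := by field_simp
    _ ≤ _ := by gcongr

/-- Existence of a critical curve above the mountain pass level. -/
theorem IsKinetic.exists_critical (hF : IsKinetic a b G Λ F Fx Fv)
    (hG : IsGrowthFunction G) {Gg : Vec N → Vec N}
    (hGc : IsConvexIntegrand (fun _ => G) fun _ => Gg) (hab : a < b)
    (hV : Continuous fun p : ℝ × Vec N => V p.1 p.2)
    (hVx : Continuous fun p : ℝ × Vec N => Vx p.1 p.2)
    (hVd : ∀ t x, HasGradientAt (V t) (Vx t x) x) (hf : IntegrableOn f (Icc a b))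
    {θF θV r₀ : ℝ} (hθ : θF < θV) (hθV : 1 < θV)
    (hF3 : ∀ t ∈ Icc a b, ∀ x v,
      inner ℝ (Fx t x v) x + inner ℝ (Fv t x v) v ≤ θF * F t x v)
    (hV1 : ∀ t ∈ Icc a b, ∀ x, r₀ ≤ ‖x‖ → inner ℝ (Vx t x) x ≤ θV * V t x)
    {R γ₀ : ℝ} (hγ₀ : 0 < γ₀)
    (hridge : ∀ w : ℝ → Vec N, Continuous w → prim a w b = 0 →
      ∫ t in Icc a b, G (R⁻¹ • w t) = 1 → γ₀ ≤ energy a b F V f w)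
    (h0 : energy a b F V f (fun _ => 0) ≤ 0) {e : ℝ → Vec N} (he : e ∈ galerkinSpace N a b 0)
    (heR : 1 ≤ ∫ t in Icc a b, G (R⁻¹ • e t)) (he0 : energy a b F V f e ≤ 0)
    {κ : ℝ} (hκ : ∀ s ∈ Icc (0 : ℝ) 1, energy a b F V f (fun t => s • e t) ≤ κ) :
    ∃ u : ℝ → Vec N, Continuous u ∧ AbsolutelyContinuousOnInterval u a b ∧ u a = 0 ∧ u b = 0 ∧
      IntegrableOn (fun t => G (deriv u t)) (Icc a b) ∧
      γ₀ ≤ kin a b F u (deriv u) + pot a b V f u ∧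
      ∀ p, IsPolyCurve p → dkin a b Fx Fv u (deriv u) (prim a fun t => p t - mean a b p)
        (fun t => p t - mean a b p) + dpot a b Vx f u (prim a fun t => p t - mean a b p) = 0 := by
  -- The far end point lies in the smallest Galerkin space, so it and the upper level κ are the same
  -- for every `m`; the modular bound is therefore uniform.
  have h := fun m : ℕ => hF.exists_almost_critical hG hab hV hVx hVd hf hγ₀
    (fun w hw h1 => hridge w (continuous_of_mem_galerkinSpace hw)
      (prim_eq_zero_of_mem_galerkinSpace hab hw) h1) h0
    (galerkinSpace_mono (Nat.zero_le m) he) heR he0 hκ (ε := 1 / ((m : ℝ) + 1)) (by positivity)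
  choose w hw hlev hκw hcrit using h
  obtain ⟨K, hK⟩ := hF.exists_modular_bound hG hab hV hVx hf hθ hθV hF3 hV1 κ
  obtain ⟨u, hu1, hu2, hu3, hu4, hu5, hu6, hu7⟩ := hF.exists_critical_of_galerkin hG hGc hab hV hVx
    hf galerkinSpace_mono (fun m z hz => continuous_of_mem_galerkinSpace hz)
    (fun m z hz => prim_eq_zero_of_mem_galerkinSpace hab hz)
    (fun p hp => hp.sub_mean_mem_galerkinSpace hab) hw (K := K) (γ₀ := γ₀) (fun m => by
      refine hK _ (continuous_of_mem_galerkinSpace (hw m)) (hκw m) ((hcrit m _ (hw m)).trans ?_)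
      refine mul_le_of_le_one_left (integral_nonneg fun t => norm_nonneg _) ?_
      rw [div_le_one (by positivity)]
      linarith [(Nat.cast_nonneg m : (0 : ℝ) ≤ m)]) hcrit hlev
  refine ⟨u, hu1, hu2, hu3, hu4, hu5, hu6, fun p hp => ?_⟩
  obtain ⟨m, hm⟩ := hp.sub_mean_mem_galerkinSpace hab
  exact hu7 m _ hm

end

section

/-! ### G-functions and the clamped Lagrangian -/

variable {N : ℕ} {a b Λ : ℝ} {G : Vec N → ℝ}
  {F : ℝ → Vec N → Vec N → ℝ} {V : ℝ → Vec N → ℝ}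

theorem IsGFunction.exists_norm_le (hG : IsGFunction G) {δ : ℝ} (hδ : 0 < δ) :
    ∃ C, ∀ v, ‖v‖ ≤ δ * G v + C := by
  have h := hG.superlinear.eventually_ge_atTop (1 / δ)
  rw [← Metric.cobounded_eq_cocompact, ← comap_norm_atTop] at h
  obtain ⟨R, hR⟩ := eventually_atTop.1 (eventually_comap.1 h)
  refine ⟨max R 1, fun v => ?_⟩
  have hGv := mul_nonneg hδ.le (hG.nonneg v)
  rcases le_or_gt ‖v‖ (max R 1) with hv | hv
  · linarith
  · have h1 := hR ‖v‖ ((le_max_left _ _).trans hv.le) v rfl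
    have h2 : 0 < ‖v‖ := one_pos.trans_le ((le_max_right _ _).trans hv.le)
    rw [div_le_div_iff₀ hδ h2] at h1
    have h3 : 1 ≤ max R 1 := le_max_right _ _
    linarith

theorem exists_le_of_norm_le {g : Vec N → ℝ} (hg : Continuous g) (M : ℝ) :
    ∃ C, 0 ≤ C ∧ ∀ v, ‖v‖ ≤ M → g v ≤ C := by
  obtain ⟨C, hC⟩ := (isCompact_closedBall (0 : Vec N) M).exists_bound_of_continuousOn hg.continuousOn
  refine ⟨max C 0, le_max_right _ _, fun v hv => ?_⟩
  exact (le_abs_self _).trans ((hC v (by simpa using hv)).trans (le_max_left _ _))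

/-- For the shift property, convexity gives G(v + z) ≤ ½G(2v) + ½G(2z). The first term is controlled
by Δ₂ for large `v` and by compactness otherwise, the second by compactness. -/
theorem IsGFunction.isGrowthFunction (hG : IsGFunction G) (hΔ : DeltaTwoAtInfinity G) :
    IsGrowthFunction G where
  cont := hG.contDiff.continuous
  nonneg := hG.nonneg
  zero := hG.zero
  superlinear _ hδ := hG.exists_norm_le hδ
  shift M := by
    have h2 : Continuous fun v : Vec N => G ((2 : ℝ) • v) :=
      hG.contDiff.continuous.comp (continuous_const_smul _)
    obtain ⟨K, M', hK⟩ := hΔ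
    obtain ⟨C, hC, hCb⟩ := exists_le_of_norm_le h2 M'
    obtain ⟨D, hD, hDb⟩ := exists_le_of_norm_le h2 M
    refine ⟨C + D + |K|, by positivity, fun v z hz => ?_⟩
    have hc := hG.convex.2 (mem_univ ((2 : ℝ) • v)) (mem_univ ((2 : ℝ) • z))
      (by norm_num : (0 : ℝ) ≤ 1 / 2) (by norm_num : (0 : ℝ) ≤ 1 / 2) (by norm_num)
    rw [smul_smul, smul_smul] at hc
    norm_num at hc
    have h1 := hDb z hz
    have h0 := hG.nonneg v
    have h3 : G ((2 : ℝ) • v) ≤ C + |K| * G v := by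
      rcases le_or_gt ‖v‖ M' with hv | hv
      · have := hCb v hv
        have : 0 ≤ |K| * G v := by positivity
        linarith
      · have := hK v hv.le
        have := mul_le_mul_of_nonneg_right (le_abs_self K) h0
        linarith
    have h4 : 0 ≤ (C + D) * G v := by positivity
    have h5 : 0 ≤ |K| * G v := by positivity
    have h6 := abs_nonneg K
    linarith

theorem continuous_gradient {E : Type*} [TopologicalSpace E] {D : E → Vec N →L[ℝ] ℝ}
    (hD : Continuous D) : Continuous fun p => (InnerProductSpace.toDual ℝ (Vec N)).symm (D p) :=
  (InnerProductSpace.toDual ℝ (Vec N)).symm.continuous.comp hD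

theorem IsGFunction.isConvexIntegrand (hG : IsGFunction G) :
    IsConvexIntegrand (fun _ => G) fun _ => gradient G where
  cont := hG.contDiff.continuous.comp continuous_snd
  contGrad := (continuous_gradient (hG.contDiff.continuous_fderiv one_ne_zero)).comp continuous_snd
  hasGrad _ v := (hG.contDiff.differentiable one_ne_zero v).hasGradientAt
  convex _ := hG.convex
  nonneg _ := hG.nonneg
  zero _ := hG.zero

/-- The nearest point of `[a,b]`. -/
def clamp (a b t : ℝ) : ℝ := max a (min b t)

theorem continuous_clamp : Continuous (clamp a b) :=
  continuous_const.max (continuous_const.min continuous_id)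

theorem clamp_mem (hab : a ≤ b) (t : ℝ) : clamp a b t ∈ Icc a b :=
  ⟨le_max_left _ _, max_le hab (min_le_left _ _)⟩

theorem clamp_eq {t : ℝ} (ht : t ∈ Icc a b) : clamp a b t = t := by
  rw [clamp, min_eq_right ht.2, max_eq_right ht.1]

section ClampedDerivative

variable {E : Type*} [NormedAddCommGroup E] [NormedSpace ℝ E] {g : ℝ → E → ℝ}

theorem continuous_clamped (hab : a ≤ b)
    (hg : ContDiffOn ℝ 1 (fun p : ℝ × E => g p.1 p.2) (Icc a b ×ˢ univ)) :
    Continuous fun p : ℝ × E => g (clamp a b p.1) p.2 :=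
  hg.continuousOn.comp_continuous
    ((continuous_clamp.comp continuous_fst).prodMk continuous_snd)
    fun _ => ⟨clamp_mem hab _, mem_univ _⟩

/-- The data are C¹ only over `[a, b]`; clamping the time extends them to all times. Only
derivatives in `x` are taken, so the kinks of the clamp do no harm. -/
theorem exists_clamped_derivative (hab : a < b)
    (hg : ContDiffOn ℝ 1 (fun p : ℝ × E => g p.1 p.2) (Icc a b ×ˢ univ)) :
    ∃ D : ℝ → E → E →L[ℝ] ℝ, (Continuous fun p : ℝ × E => D p.1 p.2) ∧
      ∀ t x, HasFDerivAt (g (clamp a b t)) (D t x) x := by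
  have hs : UniqueDiffOn ℝ (Icc a b ×ˢ (univ : Set E)) := (uniqueDiffOn_Icc hab).prod uniqueDiffOn_univ
  refine ⟨fun t x => (fderivWithin ℝ (fun p : ℝ × E => g p.1 p.2) (Icc a b ×ˢ univ)
    (clamp a b t, x)).comp (ContinuousLinearMap.inr ℝ ℝ E), ?_, fun t x => ?_⟩
  · have h := (hg.continuousOn_fderivWithin hs le_rfl).comp_continuous
      ((continuous_clamp.comp continuous_fst).prodMk continuous_snd)
      (fun p : ℝ × E => ⟨clamp_mem hab.le p.1, mem_univ _⟩)
    exact h.clm_comp continuous_const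
  · have hm : (clamp a b t, x) ∈ Icc a b ×ˢ (univ : Set E) := ⟨clamp_mem hab.le t, mem_univ _⟩
    have h := ((hg.differentiableOn one_ne_zero) _ hm).hasFDerivWithinAt.comp_hasFDerivAt x
      (hasFDerivAt_prodMk_right (𝕜 := ℝ) (clamp a b t) x)
      (Eventually.of_forall fun y => ⟨clamp_mem hab.le t, mem_univ _⟩)
    exact h

end ClampedDerivative

theorem exists_clamped_gradient (hab : a < b)
    (hV : ContDiffOn ℝ 1 (fun p : ℝ × Vec N => V p.1 p.2) (Icc a b ×ˢ univ)) :
    (Continuous fun p : ℝ × Vec N => gradient (V (clamp a b p.1)) p.2) ∧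
      ∀ t x, HasGradientAt (V (clamp a b t)) (gradient (V (clamp a b t)) x) x := by
  obtain ⟨D, hD, hd⟩ := exists_clamped_derivative hab hV
  refine ⟨?_, fun t x => (hd t x).differentiableAt.hasGradientAt⟩
  refine (continuous_gradient hD).congr fun p => ?_
  rw [gradient, (hd p.1 p.2).fderiv]

theorem isKinetic_clamped (hab : a < b) (hG : IsGrowthFunction G)
    (hF : ContDiffOn ℝ 1 (fun p : ℝ × Vec N × Vec N => F p.1 p.2.1 p.2.2) (Icc a b ×ˢ univ))
    (hF1 : ∀ t ∈ Icc a b, ∀ x, ConvexOn ℝ univ (F t x))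
    {A B : ℝ → ℝ} (hA : ContinuousOn A (Ici 0))
    (hB : IntegrableOn B (Icc a b)) (hB0 : ∀ t ∈ Icc a b, 0 ≤ B t)
    (hF2 : ∀ t ∈ Icc a b, ∀ x v, |F t x v| ≤ A ‖x‖ * (B t + G v) ∧
      ‖gradient (fun y => F t y v) x‖ ≤ A ‖x‖ * (B t + G v))
    (hΛ : 0 < Λ) (hF4 : ∀ t ∈ Icc a b, ∀ x v, Λ * G v ≤ F t x v)
    (hF5 : ∀ t ∈ Icc a b, ∀ x, F t x 0 = 0) :
    IsKinetic a b G Λ (fun t => F (clamp a b t))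
      (fun t x v => gradient (fun y => F (clamp a b t) y v) x)
      (fun t x v => gradient (F (clamp a b t) x) v) := by
  obtain ⟨D, hD, hd⟩ := exists_clamped_derivative (g := fun t (q : Vec N × Vec N) => F t q.1 q.2)
    hab hF
  have hX : ∀ t x v, HasFDerivAt (fun y => F (clamp a b t) y v)
      ((D t (x, v)).comp (ContinuousLinearMap.inl ℝ (Vec N) (Vec N))) x := fun t x v =>
    HasFDerivAt.comp (g := fun q : Vec N × Vec N => F (clamp a b t) q.1 q.2) x (hd t (x, v))
      (hasFDerivAt_prodMk_left (𝕜 := ℝ) x v)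
  have hV : ∀ t x v, HasFDerivAt (F (clamp a b t) x)
      ((D t (x, v)).comp (ContinuousLinearMap.inr ℝ (Vec N) (Vec N))) v := fun t x v =>
    HasFDerivAt.comp (g := fun q : Vec N × Vec N => F (clamp a b t) q.1 q.2) v (hd t (x, v))
      (hasFDerivAt_prodMk_right (𝕜 := ℝ) x v)
  refine ⟨continuous_clamped (g := fun t (q : Vec N × Vec N) => F t q.1 q.2) hab.le hF, ?_, ?_,
    fun t x v => ?_, fun t => hF1 _ (clamp_mem hab.le t), fun t => hF5 _ (clamp_mem hab.le t), hΛ,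
    fun t => hF4 _ (clamp_mem hab.le t), fun M => ?_⟩
  · refine (continuous_gradient (hD.clm_comp
      (continuous_const (y := ContinuousLinearMap.inl ℝ (Vec N) (Vec N))))).congr fun p => ?_
    rw [gradient, (hX p.1 p.2.1 p.2.2).fderiv]
  · refine (continuous_gradient (hD.clm_comp
      (continuous_const (y := ContinuousLinearMap.inr ℝ (Vec N) (Vec N))))).congr fun p => ?_
    rw [gradient, (hV p.1 p.2.1 p.2.2).fderiv]
  · refine (hd t (x, v)).congr_fderiv ?_
    ext z
    · simp [gradient, (hX t x v).fderiv]
    · simp [gradient, (hV t x v).fderiv]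
  · obtain ⟨A₀, hA₀⟩ := (isCompact_Icc (a := (0 : ℝ)) (b := M)).exists_bound_of_continuousOn
      (hA.mono Icc_subset_Ici_self)
    obtain ⟨A₁, hA₁, hsh⟩ := hG.shift 1
    have hB' : IntegrableOn (fun t => B (clamp a b t)) (Icc a b) :=
      hB.congr_fun (fun t ht => by simp only [clamp_eq ht]) measurableSet_Icc
    refine ⟨fun t => max A₀ 0 * (B (clamp a b t) + A₁), max A₀ 0 * (1 + A₁),
      (hB'.add (integrable_const A₁)).const_mul _, fun t => ?_, by positivity,
      fun t x v hx => ?_⟩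
    · exact mul_nonneg (le_max_right _ _) (add_nonneg (hB0 _ (clamp_mem hab.le t)) hA₁)
    have ht := clamp_mem hab.le t
    have hAx : A ‖x‖ ≤ max A₀ 0 :=
      ((le_abs_self _).trans (hA₀ _ ⟨norm_nonneg x, hx⟩)).trans (le_max_left _ _)
    have hbd : ∀ v, A ‖x‖ * (B (clamp a b t) + G v) ≤ max A₀ 0 * (B (clamp a b t) + G v) :=
      fun v => mul_le_mul_of_nonneg_right hAx (add_nonneg (hB0 _ ht) (hG.nonneg v))
    have hm : 0 ≤ max A₀ 0 := le_max_right _ _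
    have h0 : 0 ≤ max A₀ 0 * A₁ := by positivity
    have h1 : 0 ≤ max A₀ 0 * A₁ * G v := mul_nonneg h0 (hG.nonneg v)
    have h2 : 0 ≤ max A₀ 0 * G v := mul_nonneg hm (hG.nonneg v)
    refine ⟨?_, ?_, ?_⟩
    · have := (hF2 _ ht x v).1.trans (hbd v)
      rw [Real.norm_eq_abs]
      linarith
    · have := (hF2 _ ht x v).2.trans (hbd v)
      linarith
    · set q := gradient (F (clamp a b t) x) v with hq
      have hb0 : 0 ≤ max A₀ 0 * B (clamp a b t) := mul_nonneg hm (hB0 _ ht)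
      rcases eq_or_ne q 0 with h | h
      · rw [h, norm_zero]
        linarith
      · have hn : 0 < ‖q‖ := norm_pos_iff.2 h
        -- The bound on Fv comes from convexity and the growth of F itself: the tangent at `v`,
        -- evaluated one unit along the gradient q, gives ‖q‖ ≤ F(v + q/‖q‖) because F(v) ≥ 0.
        have h3 := tangent_le_of_convexOn (hF1 _ ht x) (hV t x v).differentiableAt.hasGradientAt
          (v + ‖q‖⁻¹ • q)
        rw [← hq, add_sub_cancel_left, real_inner_smul_right, real_inner_self_eq_norm_sq] at h3
        have e : ‖q‖⁻¹ * ‖q‖ ^ 2 = ‖q‖ := by field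
        have h4 := (le_abs_self _).trans ((hF2 _ ht x (v + ‖q‖⁻¹ • q)).1.trans (hbd _))
        have h5 := (mul_nonneg hΛ.le (hG.nonneg v)).trans (hF4 _ ht x v)
        have h6 := mul_le_mul_of_nonneg_left (hsh v (‖q‖⁻¹ • q)
          (by rw [norm_smul, norm_inv, norm_norm, inv_mul_cancel₀ hn.ne'])) hm
        linarith

end

section

/-! ### The convex conjugate and the forcing term -/

variable {N : ℕ} {a b Λ : ℝ} {G : Vec N → ℝ}

/-- Superlinearity with slope 1/(‖y‖ + 1) lets G absorb the inner product. This matters because a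
real supremum of an unbounded set would have the default value 0. -/
theorem IsGFunction.bddAbove_conjugate (hG : IsGFunction G) (y : Vec N) :
    BddAbove (range fun x : Vec N => inner ℝ x y - G x) := by
  obtain ⟨C, hC⟩ := hG.exists_norm_le (δ := 1 / (‖y‖ + 1)) (by positivity)
  refine ⟨‖y‖ * |C|, ?_⟩
  rintro _ ⟨x, rfl⟩
  have h1 := real_inner_le_norm x y
  have h2 := mul_le_mul_of_nonneg_right ((hC x).trans (add_le_add le_rfl (le_abs_self C)))
    (norm_nonneg y)
  have h3 : 1 / (‖y‖ + 1) * G x * ‖y‖ ≤ G x := by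
    rw [mul_right_comm]
    refine mul_le_of_le_one_left (hG.nonneg x) ?_
    rw [div_mul_eq_mul_div, one_mul, div_le_one (by positivity)]
    linarith
  simp only
  linarith

/-- Young's inequality. -/
theorem IsGFunction.inner_le (hG : IsGFunction G) (x y : Vec N) :
    inner ℝ x y ≤ G x + conjugate G y := by
  have := le_ciSup (hG.bddAbove_conjugate y) x
  rw [conjugate]
  linarith

theorem IsGFunction.conjugate_nonneg (hG : IsGFunction G) (y : Vec N) : 0 ≤ conjugate G y := by
  have := hG.inner_le 0 y
  rwa [inner_zero_left, hG.zero, zero_add] at this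

theorem IsGFunction.conjugate_smul_le (hG : IsGFunction G) {s : ℝ} (h0 : 0 ≤ s) (h1 : s ≤ 1)
    (y : Vec N) : conjugate G (s • y) ≤ s * conjugate G y := by
  refine ciSup_le fun x => ?_
  have h2 := mul_le_mul_of_nonneg_left (hG.inner_le x y) h0
  have h3 := mul_le_mul_of_nonneg_right h1 (hG.nonneg x)
  rw [real_inner_smul_right]
  linarith

/-- A finite convex function on a finite dimensional space is continuous. -/
theorem IsGFunction.continuous_conjugate (hG : IsGFunction G) : Continuous (conjugate G) := by
  have h : ConvexOn ℝ univ (conjugate G) := by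
    refine ⟨convex_univ, fun y _ z _ s t hs ht hst => ciSup_le fun x => ?_⟩
    have h1 := mul_le_mul_of_nonneg_left (hG.inner_le x y) hs
    have h2 := mul_le_mul_of_nonneg_left (hG.inner_le x z) ht
    have h3 : G x = s * G x + t * G x := by rw [← add_mul, hst, one_mul]
    rw [inner_add_right, real_inner_smul_right, real_inner_smul_right, smul_eq_mul, smul_eq_mul]
    linarith
  exact continuousOn_univ.1 (h.continuousOn isOpen_univ)

/-- Young's inequality against the unit vector f/‖f‖ bounds ‖f‖ by G*(f) plus the maximum of G on
the unit ball. -/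
theorem IsGFunction.integrableOn_of_memOrlicz_conjugate (hG : IsGFunction G) {f : ℝ → Vec N}
    (hf : MemOrlicz (conjugate G) a b f) : IntegrableOn f (Icc a b) := by
  obtain ⟨C, hC, hCb⟩ := exists_le_of_norm_le hG.contDiff.continuous 1
  refine (hf.2.add (integrable_const C)).mono' hf.1 (Eventually.of_forall fun t => ?_)
  have h0 := hG.conjugate_nonneg (f t)
  rcases eq_or_ne (f t) 0 with h | h
  · simp only [Pi.add_apply, h, norm_zero]
    rw [h] at h0
    linarith
  · have hn : ‖f t‖ ≠ 0 := norm_ne_zero_iff.2 h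
    have h1 := hG.inner_le (‖f t‖⁻¹ • f t) (f t)
    have h2 := hCb (‖f t‖⁻¹ • f t) (by rw [norm_smul, norm_inv, norm_norm, inv_mul_cancel₀ hn])
    rw [real_inner_smul_left, real_inner_self_eq_norm_sq] at h1
    have e : ‖f t‖⁻¹ * ‖f t‖ ^ 2 = ‖f t‖ := by field_simp
    simp only [Pi.add_apply]
    linarith

theorem luxNorm_nonneg (H : Vec N → ℝ) (u : ℝ → Vec N) : 0 ≤ luxNorm H a b u :=
  Real.sInf_nonneg fun _ h => h.1.le

theorem luxNorm_le {H : Vec N → ℝ} {u : ℝ → Vec N} {l : ℝ} (hl : 0 < l) (hH : ∀ x, 0 ≤ H x)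
    (hi : IntegrableOn (fun t => H (l⁻¹ • u t)) (Icc a b))
    (h : ∫ t in Icc a b, H (l⁻¹ • u t) ≤ 1) : luxNorm H a b u ≤ l := by
  refine csInf_le ⟨0, fun _ h => h.1.le⟩ ⟨hl, ?_⟩
  rw [← ofReal_integral_eq_lintegral_ofReal hi (Eventually.of_forall fun t => hH _)]
  exact ENNReal.ofReal_le_one.2 h

/-- Jensen's inequality for primitives. -/
theorem IsGFunction.prim_le (hG : IsGFunction G) (hab : a < b) {w : ℝ → Vec N} (hw : Continuous w)
    {t : ℝ} (ht : t ∈ Icc a b) :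
    G ((b - a)⁻¹ • prim a w t) ≤ (b - a)⁻¹ * ∫ s in Icc a b, G (w s) := by
  have hba : 0 < b - a := sub_pos.2 hab
  have hv : volume (Icc a b) ≠ 0 := by simp [hab]
  have hGw : Continuous fun s => G (w s) := hG.contDiff.continuous.comp hw
  have hGi : (fun s => G ((Icc a t).indicator w s)) = (Icc a t).indicator fun s => G (w s) := by
    ext1 s
    by_cases hs : s ∈ Icc a t <;> simp [hs, hG.zero]
  -- Jensen over all of `[a, b]` for the velocity cut off after `t`; G(0) = 0 makes the cut-off
  -- harmless.
  have h := hG.convex.map_set_average_le (μ := volume) (t := Icc a b)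
    hG.contDiff.continuous.continuousOn isClosed_univ hv (by simp)
    (f := (Icc a t).indicator w) (by simp)
    ((integrableOn_of_continuous hw).indicator measurableSet_Icc) (by
      show Integrable (fun s => G ((Icc a t).indicator w s)) _
      rw [hGi]
      exact (integrableOn_of_continuous hGw).indicator measurableSet_Icc)
  rw [setAverage_eq, setAverage_eq, Real.volume_real_Icc_of_le hab.le, hGi,
    setIntegral_indicator measurableSet_Icc, setIntegral_indicator measurableSet_Icc,
    inter_eq_right.2 (Icc_subset_Icc_right ht.2), setIntegral_Icc_eq_intervalIntegral ht.1,
    smul_eq_mul] at h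
  refine h.trans (mul_le_mul_of_nonneg_left ?_ (inv_nonneg.2 hba.le))
  exact setIntegral_mono_set (integrableOn_of_continuous hGw)
    (Eventually.of_forall fun s => hG.nonneg _) (Icc_subset_Icc_right ht.2).eventuallyLE

/-- Hölder's inequality for the forcing term and a primitive. -/
theorem IsGFunction.neg_le_integral_forcing (hG : IsGFunction G) (hab : a < b) {f : ℝ → Vec N}
    (hf : MemOrlicz (conjugate G) a b f) {w : ℝ → Vec N} (hw : Continuous w) {R : ℝ} (hR : 0 < R)
    (hwR : ∫ t in Icc a b, G (R⁻¹ • w t) ≤ 1) :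
    -(2 * (b - a) * R * luxNorm (conjugate G) a b f) ≤ ∫ t in Icc a b, inner ℝ (f t) (prim a w t) := by
  have hba : 0 < b - a := sub_pos.2 hab
  have hu := continuous_prim (a := a) hw
  have hGc := hG.contDiff.continuous
  set X := ∫ t in Icc a b, inner ℝ (f t) (prim a w t) with hX
  -- Jensen bounds G(z) by 1/(b − a) pointwise, so the modular of z is at most 1. The minus sign
  -- turns Young's inequality into a lower bound for the forcing term and is invisible to the even
  -- function G.
  set z : ℝ → Vec N := fun t => (-((b - a) * R)⁻¹) • prim a w t with hz
  have hzc : Continuous z := hu.const_smul (-((b - a) * R)⁻¹)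
  have hGz : IntegrableOn (fun t => G (z t)) (Icc a b) := integrableOn_of_continuous (hGc.comp hzc)
  have hz1 : ∫ t in Icc a b, G (z t) ≤ 1 := by
    have h1 : ∀ t ∈ Icc a b, G (z t) ≤ (b - a)⁻¹ := fun t ht => by
      have h := hG.prim_le hab (hw.const_smul R⁻¹) ht
      have e : G (z t) = G ((b - a)⁻¹ • prim a (R⁻¹ • w) t) := by
        have e1 : prim a (R⁻¹ • w) t = R⁻¹ • prim a w t := by
          simp only [prim, Pi.smul_apply]
          exact intervalIntegral.integral_smul _ _
        rw [e1, hz, smul_smul, ← mul_inv]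
        simp only [neg_smul]
        rw [hG.even]
      rw [e]
      exact h.trans (mul_le_of_le_one_right (inv_nonneg.2 hba.le) hwR)
    refine (setIntegral_mono_on hGz (integrable_const _) measurableSet_Icc h1).trans ?_
    rw [setIntegral_const, Real.volume_real_Icc_of_le hab.le, smul_eq_mul, mul_inv_cancel₀ hba.ne']
  -- Young's inequality for z and f/l, with both modulars at most 1, produces the factor 2.
  have key : ∀ l ∈ {l : ℝ | 0 < l ∧ ∫⁻ t in Icc a b, ENNReal.ofReal (conjugate G (l⁻¹ • f t)) ≤ 1},
      -X / (2 * (b - a) * R) ≤ l := by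
    rintro l ⟨hl, hl1⟩
    have hm : AEStronglyMeasurable (fun t => conjugate G (l⁻¹ • f t))
        (volume.restrict (Icc a b)) :=
      hG.continuous_conjugate.comp_aestronglyMeasurable (hf.1.const_smul l⁻¹)
    have hi : IntegrableOn (fun t => conjugate G (l⁻¹ • f t)) (Icc a b) :=
      ⟨hm, (hasFiniteIntegral_iff_ofReal (Eventually.of_forall fun t => hG.conjugate_nonneg _)).2
        (hl1.trans_lt ENNReal.one_lt_top)⟩
    rw [← ofReal_integral_eq_lintegral_ofReal hi
      (Eventually.of_forall fun t => hG.conjugate_nonneg _), ENNReal.ofReal_le_one] at hl1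
    have hfi := integrableOn_inner_right (hG.integrableOn_of_memOrlicz_conjugate hf) hu
    have h1 : -X ≤ l * ((b - a) * R) * ((∫ t in Icc a b, G (z t)) +
        ∫ t in Icc a b, conjugate G (l⁻¹ • f t)) := by
      rw [hX, ← integral_neg, ← integral_add hGz hi, ← integral_const_mul]
      refine integral_mono hfi.neg ((hGz.add hi).const_mul _) fun t => ?_
      have h2 := mul_le_mul_of_nonneg_left (hG.inner_le (z t) (l⁻¹ • f t))
        (by positivity : 0 ≤ l * ((b - a) * R))
      refine le_trans (le_of_eq ?_) h2
      rw [hz, real_inner_smul_left, real_inner_smul_right, real_inner_comm]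
      field_simp
    rw [div_le_iff₀ (by positivity)]
    have h3 : 0 ≤ l * ((b - a) * R) := by positivity
    have h4 := mul_le_mul_of_nonneg_left (add_le_add hz1 hl1) h3
    linarith
  -- The infimum of the empty set would be 0, so the bound passes to the Luxemburg norm only if some
  -- `l` is admissible.
  have hne : {l : ℝ | 0 < l ∧
      ∫⁻ t in Icc a b, ENNReal.ofReal (conjugate G (l⁻¹ • f t)) ≤ 1}.Nonempty := by
    set I := ∫ t in Icc a b, conjugate G (f t) with hI
    have hl : 0 < max 1 I := one_pos.trans_le (le_max_left _ _)
    refine ⟨max 1 I, hl, ?_⟩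
    have h1 : ∀ t, conjugate G ((max 1 I)⁻¹ • f t) ≤ (max 1 I)⁻¹ * conjugate G (f t) := fun t =>
      hG.conjugate_smul_le (inv_nonneg.2 hl.le) (inv_le_one_of_one_le₀ (le_max_left _ _)) _
    refine (lintegral_mono fun t => ENNReal.ofReal_le_ofReal (h1 t)).trans ?_
    rw [← ofReal_integral_eq_lintegral_ofReal (hf.2.const_mul _) (Eventually.of_forall fun t =>
      mul_nonneg (inv_nonneg.2 hl.le) (hG.conjugate_nonneg _)), ENNReal.ofReal_le_one,
      integral_const_mul, ← hI, inv_mul_le_iff₀ hl, mul_one]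
    exact le_max_right _ _
  have h := le_csInf hne key
  change _ ≤ luxNorm (conjugate G) a b f at h
  rw [div_le_iff₀ (by positivity)] at h
  linarith

end

section

/-! ### The mountain pass geometry -/

variable {N : ℕ} {a b Λ : ℝ} {G : Vec N → ℝ}
  {F : ℝ → Vec N → Vec N → ℝ} {Fx Fv : ℝ → Vec N → Vec N → Vec N}
  {V : ℝ → Vec N → ℝ} {Vx : ℝ → Vec N → Vec N} {f : ℝ → Vec N}

theorem memOrlicz_of_continuous {H : Vec N → ℝ} (hH : Continuous H) {u : ℝ → Vec N}
    (hu : Continuous u) : MemOrlicz H a b u :=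
  ⟨hu.aestronglyMeasurable, integrableOn_of_continuous (hH.comp hu)⟩

theorem deriv_prim {w : ℝ → Vec N} (hw : Continuous w) : deriv (prim a w) = w :=
  funext fun t => (hasDerivAt_prim hw t).deriv

theorem memOrliczSobolevZero_prim (hG : Continuous G) (hab : a ≤ b) {w : ℝ → Vec N}
    (hw : Continuous w) (hb : prim a w b = 0) : MemOrliczSobolevZero G a b (prim a w) :=
  ⟨⟨absolutelyContinuousOnInterval_prim hab (integrableOn_of_continuous hw),
    memOrlicz_of_continuous hG (continuous_prim hw), by
      rw [deriv_prim hw]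
      exact memOrlicz_of_continuous hG hw⟩, prim_self w, hb⟩

theorem IsEmbeddingConstant.norm_prim_le {C : ℝ} (hC : IsEmbeddingConstant G a b C)
    (hG : Continuous G) (hab : a ≤ b) {w : ℝ → Vec N} (hw : Continuous w) (hb : prim a w b = 0)
    {t : ℝ} (ht : t ∈ Icc a b) : ‖prim a w t‖ ≤ C * luxNorm G a b w := by
  have h := hC _ (memOrliczSobolevZero_prim hG hab hw hb) t ht
  rwa [deriv_prim hw] at h

/-- Otherwise the derivative `t` minus its mean would vanish at two distinct points. -/
theorem exists_prim_basisFun_ne_zero (hab : a < b) {v : Vec N} (hv : v ≠ 0) :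
    ∃ t ∈ Icc a b, prim a (fun t => basisFun a b 0 t • v) t ≠ 0 := by
  by_contra! h
  have hc : Continuous fun t => basisFun a b 0 t • v :=
    (continuous_basisFun 0).smul continuous_const
  have h0 : ∀ t ∈ Ioo a b, basisFun a b 0 t = 0 := fun t ht => by
    have h1 : prim a (fun t => basisFun a b 0 t • v) =ᶠ[𝓝 t] fun _ => 0 := by
      filter_upwards [Icc_mem_nhds ht.1 ht.2] with s hs using h s hs
    have h2 := (h1.hasDerivAt_iff.1 (hasDerivAt_prim hc t)).unique (hasDerivAt_const t (0 : Vec N))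
    exact (smul_eq_zero.1 h2).resolve_right hv
  obtain ⟨s, hs⟩ := exists_between hab
  obtain ⟨t, ht⟩ := exists_between hs.2
  have h1 := h0 s hs
  have h2 := h0 t ⟨hs.1.trans ht.1, ht.2⟩
  simp only [basisFun, zero_add, pow_one] at h1 h2
  linarith [ht.1]

/-- A nonzero admissible curve, which exists because N ≥ 1, would violate the embedding inequality
if C ≤ 0. -/
theorem IsEmbeddingConstant.pos {C : ℝ} (hC : IsEmbeddingConstant G a b C) (hG : Continuous G)
    (hab : a < b) (hN : 1 ≤ N) : 0 < C := by
  have : NeZero N := ⟨by omega⟩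
  have hv : (EuclideanSpace.single 0 1 : Vec N) ≠ 0 := by simp
  obtain ⟨t, ht, h⟩ := exists_prim_basisFun_ne_zero hab hv
  have hm := basisFun_smul_mem (a := a) (b := b) le_rfl (EuclideanSpace.single 0 1 : Vec N) (i := 0)
  have h1 := hC.norm_prim_le hG hab.le (continuous_of_mem_galerkinSpace hm)
    (prim_eq_zero_of_mem_galerkinSpace hab hm) ht
  by_contra! hC0
  have h2 := mul_nonpos_of_nonpos_of_nonneg hC0 (luxNorm_nonneg (a := a) (b := b) G
    fun t => basisFun a b 0 t • (EuclideanSpace.single 0 1 : Vec N))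
  exact h (norm_le_zero_iff.1 (h1.trans h2))

/-- The energy on the ridge. -/
theorem IsKinetic.le_energy_of_modular_eq_one (hF : IsKinetic a b G Λ F Fx Fv)
    (hG : IsGFunction G) (hab : a < b) (hV : Continuous fun p : ℝ × Vec N => V p.1 p.2)
    (hf : MemOrlicz (conjugate G) a b f) {C R : ℝ} (hC : IsEmbeddingConstant G a b C)
    (hC0 : 0 < C) (hR : 1 ≤ R) {g : ℝ → ℝ} (hg : IntegrableOn g (Icc a b))
    (hV3 : ∀ t ∈ Icc a b, ∀ x, ‖x‖ ≤ C * R → -g t ≤ V t x) {w : ℝ → Vec N} (hw : Continuous w)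
    (hb : prim a w b = 0) (hwR : ∫ t in Icc a b, G (R⁻¹ • w t) = 1) :
    (Λ - 2 * (b - a) * luxNorm (conjugate G) a b f) * R - ∫ t in Icc a b, g t ≤
      energy a b F V f w := by
  have hR0 : 0 < R := one_pos.trans_le hR
  have hGc := hG.contDiff.continuous
  have hu := continuous_prim (a := a) hw
  have hGi : IntegrableOn (fun t => G (w t)) (Icc a b) :=
    integrableOn_of_continuous (hGc.comp hw)
  have hGRi : IntegrableOn (fun t => G (R⁻¹ • w t)) (Icc a b) :=
    integrableOn_of_continuous (hGc.comp (hw.const_smul R⁻¹))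
  have hfi := integrableOn_inner_right (hG.integrableOn_of_memOrlicz_conjugate hf) hu
  have hVi : IntegrableOn (fun t => V t (prim a w t)) (Icc a b) :=
    integrableOn_of_continuous (hV.comp (continuous_id.prodMk hu))
  have hnorm : ∀ t ∈ Icc a b, ‖prim a w t‖ ≤ C * R := fun t ht =>
    (hC.norm_prim_le hGc hab.le hw hb ht).trans (mul_le_mul_of_nonneg_left
      (luxNorm_le hR0 hG.nonneg hGRi hwR.le) hC0.le)
  have h1 : Λ * R ≤ kin a b F (prim a w) w := by
    have h : ∫ t in Icc a b, Λ * (R * G (R⁻¹ • w t)) ≤ kin a b F (prim a w) w := by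
      refine integral_mono ((hGRi.const_mul R).const_mul Λ)
        (hF.integrableOn hu hw.measurable hGi) fun t => ?_
      -- Convexity and G(0) = 0 give R·G(w/R) ≤ G(w) because R ≥ 1; this is where C ≤ ρ₀ enters.
      refine le_trans (mul_le_mul_of_nonneg_left ?_ hF.pos.le) (hF.lower t _ _)
      have hc := hG.convex.2 (mem_univ (w t)) (mem_univ 0) (inv_nonneg.2 hR0.le)
        (sub_nonneg.2 (inv_le_one_of_one_le₀ hR)) (by ring)
      rw [smul_zero, add_zero, hG.zero, smul_zero, add_zero, smul_eq_mul,
        le_inv_mul_iff₀ hR0] at hc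
      exact hc
    rwa [integral_const_mul, integral_const_mul, hwR, mul_one] at h
  have h2 : -(∫ t in Icc a b, g t) ≤ ∫ t in Icc a b, V t (prim a w t) := by
    rw [← integral_neg]
    exact setIntegral_mono_on hg.neg hVi measurableSet_Icc fun t ht => hV3 t ht _ (hnorm t ht)
  have h3 := hG.neg_le_integral_forcing hab hf hw hR0 hwR.le
  rw [energy, pot, integral_add hVi hfi]
  linarith

/-- The differential inequality says that s^(−θ)·h(s) is nonincreasing for s ≥ 1. -/
theorem le_rpow_mul_of_deriv_le {h h' : ℝ → ℝ} {θ : ℝ} (hd : ∀ s, HasDerivAt h (h' s) s)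
    (hle : ∀ s, 1 ≤ s → s * h' s ≤ θ * h s) {s : ℝ} (hs : 1 ≤ s) : h s ≤ s ^ θ * h 1 := by
  have hφ : ∀ s : ℝ, 0 < s → HasDerivAt (fun s => s ^ (-θ) * h s)
      ((-θ) * s ^ (-θ - 1) * h s + s ^ (-θ) * h' s) s := fun s hs =>
    (Real.hasDerivAt_rpow_const (Or.inl hs.ne')).fun_mul (hd s)
  have hanti : AntitoneOn (fun s => s ^ (-θ) * h s) (Ici 1) := by
    refine antitoneOn_of_deriv_nonpos (convex_Ici 1)
      (fun s hs => (hφ s (one_pos.trans_le hs)).continuousAt.continuousWithinAt)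
      (fun s hs => ?_) (fun s hs => ?_)
    · rw [interior_Ici] at hs
      exact (hφ s (one_pos.trans hs)).differentiableAt.differentiableWithinAt
    · rw [interior_Ici] at hs
      have hs0 : 0 < s := one_pos.trans hs
      rw [(hφ s hs0).deriv, Real.rpow_sub_one hs0.ne']
      have h1 := mul_le_mul_of_nonneg_left (hle s hs.le)
        (div_nonneg (Real.rpow_nonneg hs0.le (-θ)) hs0.le)
      have e : s ^ (-θ) / s * (s * h' s) = s ^ (-θ) * h' s := by field_simp
      linarith
  have h1 := hanti (mem_Ici.2 le_rfl) (mem_Ici.2 hs) hs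
  simp only [Real.one_rpow, one_mul] at h1
  have hs0 : 0 < s := one_pos.trans_le hs
  rwa [Real.rpow_neg hs0.le, inv_mul_le_iff₀ (Real.rpow_pos_of_pos hs0 θ)] at h1

theorem IsKinetic.smul_le (hF : IsKinetic a b G Λ F Fx Fv) {θF t : ℝ}
    (hF3 : ∀ x v, inner ℝ (Fx t x v) x + inner ℝ (Fv t x v) v ≤ θF * F t x v) (x v : Vec N)
    {s : ℝ} (hs : 1 ≤ s) : F t (s • x) (s • v) ≤ s ^ θF * F t x v := by
  have h := le_rpow_mul_of_deriv_le (h := fun s => F t (s • x) (s • v)) (θ := θF)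
    (h' := fun s => inner ℝ (Fx t (s • x) (s • v)) x + inner ℝ (Fv t (s • x) (s • v)) v)
    (fun s => ?_) (fun s _ => ?_) hs
  · simpa using h
  · have h1 : HasDerivAt (fun s : ℝ => s • x) x s := by
      simpa using (hasDerivAt_id s).smul_const x
    have h2 : HasDerivAt (fun s : ℝ => s • v) v s := by
      simpa using (hasDerivAt_id s).smul_const v
    have h3 := (hF.hasFDeriv t (s • x) (s • v)).comp_hasDerivAt s (h1.prodMk h2)
    simpa [Function.comp_def] using h3
  · have h := hF3 (s • x) (s • v)
    rw [real_inner_smul_right, real_inner_smul_right] at h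
    linarith

theorem potential_smul_le {t θV r₀ : ℝ} (hVd : ∀ x, HasGradientAt (V t) (Vx t x) x)
    (hV1 : ∀ x, r₀ ≤ ‖x‖ → inner ℝ (Vx t x) x ≤ θV * V t x) {x : Vec N} (hx : r₀ ≤ ‖x‖)
    {s : ℝ} (hs : 1 ≤ s) : V t (s • x) ≤ s ^ θV * V t x := by
  have h := le_rpow_mul_of_deriv_le (h := fun s => V t (s • x)) (θ := θV)
    (h' := fun s => inner ℝ (Vx t (s • x)) x) (fun s => ?_) (fun s hs => ?_) hs
  · simpa using h
  · have h1 : HasDerivAt (fun s : ℝ => s • x) x s := by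
      simpa using (hasDerivAt_id s).smul_const x
    have h3 := (hVd (s • x)).hasFDerivAt.comp_hasDerivAt s h1
    simpa [Function.comp_def] using h3
  · have hsx : r₀ ≤ ‖s • x‖ := by
      rw [norm_smul, Real.norm_of_nonneg (by linarith)]
      exact hx.trans (le_mul_of_one_le_left (norm_nonneg x) hs)
    have h := hV1 (s • x) hsx
    rw [real_inner_smul_right] at h
    linarith

end

section

/-! ### Decay of the energy along rays -/

variable {N : ℕ} {a b Λ : ℝ} {G : Vec N → ℝ}
  {F : ℝ → Vec N → Vec N → ℝ} {Fx Fv : ℝ → Vec N → Vec N → Vec N}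
  {V : ℝ → Vec N → ℝ} {Vx : ℝ → Vec N → Vec N} {f : ℝ → Vec N}

theorem setIntegral_neg_of_continuous (hab : a < b) {q : ℝ → ℝ} (hq : Continuous q)
    (hq0 : ∀ t ∈ Icc a b, q t ≤ 0) {t₀ : ℝ} (ht₀ : t₀ ∈ Icc a b) (h : q t₀ < 0) :
    ∫ t in Icc a b, q t < 0 := by
  have h1 : 0 ≤ᵐ[volume.restrict (Icc a b)] fun t => -q t := by
    filter_upwards [ae_restrict_mem measurableSet_Icc] with t ht
    simpa using hq0 t ht
  have hqc : Continuous fun t => -q t := hq.neg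
  have h2 := integral_nonneg_of_ae h1
  rw [integral_neg] at h2
  refine lt_of_le_of_ne (by linarith) fun h0 => ?_
  have h3 := (setIntegral_eq_zero_iff_of_nonneg_ae h1 (integrableOn_of_continuous hqc)).1
    (by rw [integral_neg, h0, neg_zero])
  have h4 := Measure.eqOn_Icc_of_ae_eq volume hab.ne h3 hqc.continuousOn continuousOn_const ht₀
  simp only [Pi.zero_apply] at h4
  linarith

/-- The potential energy decays like `s ^ θV` along rays. -/
theorem exists_pot_smul_le (hab : a < b) (hV : Continuous fun p : ℝ × Vec N => V p.1 p.2)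
    (hVd : ∀ t x, HasGradientAt (V t) (Vx t x) x) (hf : IntegrableOn f (Icc a b)) {θV r₀ : ℝ}
    (hV1 : ∀ t ∈ Icc a b, ∀ x, r₀ ≤ ‖x‖ → inner ℝ (Vx t x) x ≤ θV * V t x)
    (hV4 : ∀ t ∈ Icc a b, ∀ x, r₀ ≤ ‖x‖ → V t x < 0) {u : ℝ → Vec N} (hu : Continuous u)
    {t₀ : ℝ} (ht₀ : t₀ ∈ Icc a b) (hr : r₀ < ‖u t₀‖) :
    ∃ c > 0, ∃ D, ∀ s, 1 ≤ s → pot a b V f (fun t => s • u t) ≤ D * s - c * s ^ θV := by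
  obtain ⟨M, hM⟩ := (isCompact_Icc (a := a) (b := b)).exists_bound_of_continuousOn hu.continuousOn
  obtain ⟨C, hC, hCb⟩ := exists_bound_of_continuous_comp hV a b r₀
  have hVu : Continuous fun t => V t (u t) := hV.comp (continuous_id.prodMk hu)
  -- A continuous substitute for the indicator of {‖u‖ ≥ r₀}. It makes the integrand of `Q`
  -- continuous, so its negativity at `t₀` gives Q < 0.
  let φ : ℝ → ℝ := fun t => min 1 (max 0 (‖u t‖ - r₀))
  have hφc : Continuous φ := continuous_const.min (continuous_const.max (hu.norm.sub continuous_const))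
  have hφ0 : ∀ t, 0 ≤ φ t := fun t => le_min zero_le_one (le_max_left _ _)
  have hφ1 : ∀ t, φ t ≤ 1 := fun t => min_le_left _ _
  have hφr : ∀ t, ‖u t‖ < r₀ → φ t = 0 := fun t ht => by
    simp only [φ]
    rw [max_eq_left (by linarith), min_eq_right zero_le_one]
  have hqc : Continuous fun t => φ t * V t (u t) := hφc.mul hVu
  set Q := ∫ t in Icc a b, φ t * V t (u t) with hQ
  have hQ0 : Q < 0 := by
    refine setIntegral_neg_of_continuous hab hqc (fun t ht => ?_) ht₀ ?_
    · rcases lt_or_ge ‖u t‖ r₀ with h | h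
      · rw [hφr t h, zero_mul]
      · exact mul_nonpos_of_nonneg_of_nonpos (hφ0 t) (hV4 t ht _ h).le
    · refine mul_neg_of_pos_of_neg (lt_min one_pos (lt_max_of_lt_right (by linarith))) ?_
      exact hV4 t₀ ht₀ _ hr.le
  set n := ∫ t in Icc a b, ‖f t‖ with hn
  refine ⟨-Q, neg_pos.2 hQ0, C * (b - a) + M * n, fun s hs => ?_⟩
  have hs0 : 0 < s := one_pos.trans_le hs
  have hsu : Continuous fun t => s • u t := hu.const_smul s
  have hVs : Continuous fun t => V t (s • u t) := hV.comp (continuous_id.prodMk hsu)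
  have h1 : IntegrableOn (fun t => C + s ^ θV * (φ t * V t (u t))) (Icc a b) :=
    (integrable_const C).add ((integrableOn_of_continuous hqc).const_mul _)
  have h2 : IntegrableOn (fun t => s * M * ‖f t‖) (Icc a b) := hf.norm.const_mul _
  have h : pot a b V f (fun t => s • u t) ≤
      ∫ t in Icc a b, ((C + s ^ θV * (φ t * V t (u t))) + s * M * ‖f t‖) := by
    refine setIntegral_mono_on ((integrableOn_of_continuous hVs).add
      (integrableOn_inner_right hf hsu)) (h1.add h2) measurableSet_Icc fun t ht => add_le_add ?_ ?_
    -- Where the curve is small the scaling law is unavailable. There V(su) ≤ C, either because su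
    -- is still in the ball or because V is negative outside it.
    · rcases lt_or_ge ‖u t‖ r₀ with h | h
      · rw [hφr t h, zero_mul, mul_zero, add_zero]
        rcases lt_or_ge ‖s • u t‖ r₀ with h' | h'
        · exact (le_abs_self _).trans (hCb t ht _ h'.le)
        · exact (hV4 t ht _ h').le.trans hC
      · refine (potential_smul_le (hVd t) (hV1 t ht) h hs).trans ?_
        refine le_add_of_nonneg_of_le hC (mul_le_mul_of_nonneg_left ?_ (Real.rpow_nonneg hs0.le _))
        have := mul_le_mul_of_nonpos_right (hφ1 t) (hV4 t ht _ h).le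
        linarith
    · refine (real_inner_le_norm _ _).trans ?_
      rw [norm_smul, Real.norm_of_nonneg hs0.le, mul_comm]
      have := hM t ht
      gcongr
  have hq : IntegrableOn (fun t => s ^ θV * (φ t * V t (u t))) (Icc a b) :=
    (integrableOn_of_continuous hqc).const_mul _
  rw [integral_add h1 h2, integral_add (integrable_const C) hq, integral_const_mul,
    integral_const_mul, setIntegral_const, Real.volume_real_Icc_of_le hab.le, smul_eq_mul, ← hQ,
    ← hn] at h
  have h3 := mul_le_mul_of_nonneg_left hs (mul_nonneg hC (sub_pos.2 hab).le)
  linarith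

theorem prim_const_smul (s : ℝ) (w : ℝ → Vec N) :
    (prim a fun t => s • w t) = fun t => s • prim a w t :=
  funext fun _ => intervalIntegral.integral_smul _ _

/-- After division by s^θ' the first two terms tend to zero and −c remains. -/
theorem eventually_rpow_sum_nonpos {A D c θ θ' : ℝ} (hc : 0 < c) (hθ : θ < θ') (hθ' : 1 < θ') :
    ∀ᶠ s : ℝ in atTop, s ^ θ * A + (D * s - c * s ^ θ') ≤ 0 := by
  have h1 := tendsto_rpow_neg_atTop (sub_pos.2 hθ)
  have h2 := tendsto_rpow_neg_atTop (sub_pos.2 hθ')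
  have h3 := ((h1.mul_const A).add (h2.mul_const D)).sub_const c
  rw [zero_mul, zero_mul, add_zero, zero_sub] at h3
  filter_upwards [h3.eventually (gt_mem_nhds (neg_lt_zero.2 hc)), eventually_gt_atTop 0]
    with s hs hs0
  have h4 := mul_nonpos_of_nonneg_of_nonpos (Real.rpow_nonneg hs0.le θ') hs.le
  have e1 : s ^ θ' * s ^ (-(θ' - θ)) = s ^ θ := by
    rw [← Real.rpow_add hs0]
    congr 1
    ring
  have e2 : s ^ θ' * s ^ (-(θ' - 1)) = s := by
    rw [← Real.rpow_add hs0, add_neg_eq_iff_eq_add.2 (by ring : θ' = 1 + (θ' - 1)), Real.rpow_one]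
  calc s ^ θ * A + (D * s - c * s ^ θ')
      = s ^ θ' * s ^ (-(θ' - θ)) * A + (D * (s ^ θ' * s ^ (-(θ' - 1))) - c * s ^ θ') := by
        rw [e1, e2]
    _ = s ^ θ' * (s ^ (-(θ' - θ)) * A + s ^ (-(θ' - 1)) * D - c) := by ring
    _ ≤ 0 := h4

/-- The far end point of the mountain pass. -/
theorem IsKinetic.exists_energy_nonpos (hF : IsKinetic a b G Λ F Fx Fv)
    (hG : IsGrowthFunction G) (hab : a < b) (hN : 1 ≤ N)
    (hV : Continuous fun p : ℝ × Vec N => V p.1 p.2)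
    (hVd : ∀ t x, HasGradientAt (V t) (Vx t x) x) (hf : IntegrableOn f (Icc a b))
    {θF θV r₀ : ℝ} (hθ : θF < θV) (hθV : 1 < θV) (hr₀ : 0 < r₀)
    (hF3 : ∀ t ∈ Icc a b, ∀ x v,
      inner ℝ (Fx t x v) x + inner ℝ (Fv t x v) v ≤ θF * F t x v)
    (hV1 : ∀ t ∈ Icc a b, ∀ x, r₀ ≤ ‖x‖ → inner ℝ (Vx t x) x ≤ θV * V t x)
    (hV4 : ∀ t ∈ Icc a b, ∀ x, r₀ ≤ ‖x‖ → V t x < 0) {R : ℝ} (hR : 0 < R) :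
    ∃ e ∈ galerkinSpace N a b 0, 1 ≤ ∫ t in Icc a b, G (R⁻¹ • e t) ∧ energy a b F V f e ≤ 0 := by
  have : NeZero N := ⟨by omega⟩
  obtain ⟨t₀, ht₀, h0⟩ := exists_prim_basisFun_ne_zero hab
    (by simp : (EuclideanSpace.single 0 1 : Vec N) ≠ 0)
  have hn0 := norm_pos_iff.2 h0
  set e₀ : ℝ → Vec N := fun t => basisFun a b 0 t • (EuclideanSpace.single 0 1 : Vec N) with he₀
  -- Scaled so that its primitive has norm r₀ + 1 at `t₀`, beyond the radius where V is negative.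
  set e : ℝ → Vec N := fun t => ((r₀ + 1) / ‖prim a e₀ t₀‖) • e₀ t with he
  have hmem : ∀ s : ℝ, (fun t => s • e t) ∈ galerkinSpace N a b 0 := fun s =>
    Submodule.smul_mem _ s (Submodule.smul_mem _ _ (basisFun_smul_mem le_rfl _))
  have hec : Continuous e := continuous_of_mem_galerkinSpace (by simpa using hmem 1)
  set u := prim a e with hu
  have huc : Continuous u := continuous_prim hec
  have hut : ‖u t₀‖ = r₀ + 1 := by
    rw [hu, he, prim_const_smul, norm_smul, Real.norm_of_nonneg (by positivity),
      div_mul_cancel₀ _ hn0.ne']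
  obtain ⟨c, hc, D, hD⟩ := exists_pot_smul_le hab hV hVd hf hV1 hV4 huc ht₀ (by rw [hut]; linarith)
  have hen : ∀ s, 1 ≤ s → energy a b F V f (fun t => s • e t) ≤
      s ^ θF * kin a b F u e + (D * s - c * s ^ θV) := fun s hs => by
    rw [energy, prim_const_smul]
    refine add_le_add ?_ (hD s hs)
    rw [kin, kin, ← integral_const_mul]
    exact setIntegral_mono_on
      (integrableOn_of_continuous (hF.continuous_comp (huc.const_smul s) (hec.const_smul s)))
      ((integrableOn_of_continuous (hF.continuous_comp huc hec)).const_mul _) measurableSet_Icc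
      fun t ht => hF.smul_le (hF3 t ht) _ _ hs
  obtain ⟨K, hK⟩ := hG.superlinear 1 one_pos
  set I := ∫ t in Icc a b, ‖e t‖ with hI
  have hI0 : 0 < I := by
    have h := norm_prim_le (integrableOn_of_continuous hec) ht₀
    rw [← hu, hut] at h
    linarith
  -- The L¹ norm grows linearly in `s`, and superlinearity bounds the modular below by the L¹ norm
  -- up to a constant.
  have hmod : ∀ᶠ s : ℝ in atTop, 1 ≤ ∫ t in Icc a b, G (R⁻¹ • s • e t) := by
    filter_upwards [eventually_ge_atTop ((1 + K * (b - a)) * R / I), eventually_ge_atTop 0]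
      with s hs hs0
    have hc1 : Continuous fun t => R⁻¹ • s • e t := (hec.const_smul s).const_smul R⁻¹
    have hc2 : Continuous fun t => G (R⁻¹ • s • e t) := hG.cont.comp hc1
    have h := integral_norm_le_of_superlinear hab.le zero_le_one hK
      (integrableOn_of_continuous hc1) (integrableOn_of_continuous hc2) le_rfl
    simp only [norm_smul, Real.norm_of_nonneg hs0, Real.norm_of_nonneg (inv_nonneg.2 hR.le)] at h
    rw [integral_const_mul, integral_const_mul, ← hI, one_mul] at h
    rw [div_le_iff₀ hI0, ← le_inv_mul_iff₀' hR] at hs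
    linarith
  obtain ⟨s, hs1, hs2, hs3⟩ := (hmod.and ((eventually_rpow_sum_nonpos (A := kin a b F u e) (D := D)
    hc hθ hθV).and (eventually_ge_atTop 1))).exists
  exact ⟨_, hmem s, hs1, (hen s hs3).trans hs2⟩

/-- The energy is differentiable along the one dimensional space spanned by `e`, hence bounded above
on the compact segment. -/
theorem IsKinetic.exists_energy_smul_le (hF : IsKinetic a b G Λ F Fx Fv)
    (hV : Continuous fun p : ℝ × Vec N => V p.1 p.2)
    (hVx : Continuous fun p : ℝ × Vec N => Vx p.1 p.2)
    (hVd : ∀ t x, HasGradientAt (V t) (Vx t x) x) (hf : IntegrableOn f (Icc a b))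
    {e : ℝ → Vec N} (he : Continuous e) :
    ∃ κ, ∀ s ∈ Icc (0 : ℝ) 1, energy a b F V f (fun t => s • e t) ≤ κ := by
  obtain ⟨DJ, -, hJ, -⟩ := hF.hasStrictFDerivAt_energy hV hVx hVd hf
    (W := fun t => ContinuousLinearMap.toSpanSingleton ℝ (e t))
    (ContinuousLinearMap.toSpanSingletonCLE.continuous.comp he)
  have hc : Continuous fun s : ℝ => energy a b F V f
      fun t => ContinuousLinearMap.toSpanSingleton ℝ (e t) s :=
    continuous_iff_continuousAt.2 fun s => (hJ s).continuousAt
  obtain ⟨κ, hκ⟩ := (isCompact_Icc (a := (0 : ℝ)) (b := 1)).bddAbove_image hc.continuousOn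
  exact ⟨κ, fun s hs => by simpa using hκ (mem_image_of_mem _ hs)⟩

end

section

/-! ### The Euler–Lagrange equation -/

variable {N : ℕ} {a b Λ : ℝ} {G : Vec N → ℝ}
  {F : ℝ → Vec N → Vec N → ℝ} {Fx Fv : ℝ → Vec N → Vec N → Vec N}
  {V : ℝ → Vec N → ℝ} {Vx : ℝ → Vec N → Vec N} {f : ℝ → Vec N}

/-- Polynomial curves are uniformly dense among continuous ones, so all continuous tests vanish,
which leads back to the fundamental lemma with scalar test functions. -/
theorem ae_eq_zero_of_integral_inner_polyCurve {ρ : ℝ → Vec N} (hρ : IntegrableOn ρ (Icc a b))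
    (h : ∀ p, IsPolyCurve p → ∫ t in Icc a b, inner ℝ (ρ t) (p t) = 0) :
    ∀ᵐ t ∂(volume.restrict (Icc a b)), ρ t = 0 := by
  have hcont : ∀ ξ : ℝ → Vec N, Continuous ξ → ∫ t in Icc a b, inner ℝ (ρ t) (ξ t) = 0 := by
    intro ξ hξ
    set n := ∫ t in Icc a b, ‖ρ t‖ with hn
    have hn0 : 0 ≤ n := integral_nonneg fun t => norm_nonneg _
    refine abs_eq_zero.1 (le_antisymm (le_of_forall_pos_le_add fun ε hε => ?_) (abs_nonneg _))
    obtain ⟨p, hp, hpξ⟩ := exists_polyCurve_near (hξ.continuousOn (s := Icc a b))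
      (ε := ε / (n + 1)) (by positivity)
    have h1 := abs_integral_inner_le hρ hpξ
    have e : ∫ t in Icc a b, inner ℝ (p t - ξ t) (ρ t) = -∫ t in Icc a b, inner ℝ (ρ t) (ξ t) := by
      simp only [real_inner_comm, inner_sub_right]
      rw [integral_sub (integrableOn_inner_right hρ hp.continuous) (integrableOn_inner_right hρ hξ),
        h p hp, zero_sub]
    rw [e, abs_neg] at h1
    refine h1.trans ?_
    rw [zero_add, ← hn, div_mul_eq_mul_div, div_le_iff₀ (by positivity)]
    nlinarith
  have hi : Integrable ((Icc a b).indicator ρ) := (integrable_indicator_iff measurableSet_Icc).2 hρ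
  have h0 := ae_eq_zero_of_integral_contDiff_smul_eq_zero hi.locallyIntegrable fun φ hφ _ => by
    have e : (fun t => φ t • (Icc a b).indicator ρ t) =
        (Icc a b).indicator fun t => φ t • ρ t := by
      ext1 t
      by_cases ht : t ∈ Icc a b <;> simp [ht]
    have hφc := hφ.continuous
    have hφi : IntegrableOn (fun t => φ t • ρ t) (Icc a b) :=
      hρ.continuousOn_smul hφc.continuousOn isCompact_Icc
    rw [e, integral_indicator measurableSet_Icc]
    -- Testing with φ times the constant vector ∫φρ gives ‖∫φρ‖² = 0.
    refine (inner_self_eq_zero (𝕜 := ℝ)).1 ((integral_inner hφi (∫ t in Icc a b, φ t • ρ t)).symm.trans ?_)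
    have hc : Continuous fun t => φ t • ∫ s in Icc a b, φ s • ρ s := hφc.smul continuous_const
    rw [← hcont _ hc]
    refine integral_congr_ae (Eventually.of_forall fun t => ?_)
    simp only [real_inner_smul_right]
    rw [real_inner_comm]
  rw [ae_restrict_iff' measurableSet_Icc]
  filter_upwards [h0] with t ht hmem
  rwa [indicator_of_mem hmem] at ht

/-- Subtraction of the mean is symmetric for the L² pairing, so testing with curves of mean zero
amounts to testing a residual of mean zero with all curves. -/
theorem integral_inner_sub_mean {r p : ℝ → Vec N} (hr : IntegrableOn r (Icc a b))
    (hp : Continuous p) :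
    ∫ t in Icc a b, inner ℝ (r t - mean a b r) (p t) =
      ∫ t in Icc a b, inner ℝ (r t) (p t - mean a b p) := by
  simp only [inner_sub_left, inner_sub_right]
  have h1 : IntegrableOn (fun t => inner ℝ (mean a b r) (p t)) (Icc a b) :=
    integrableOn_of_continuous (continuous_const.inner hp)
  have h2 : IntegrableOn (fun t => inner ℝ (r t) (mean a b p)) (Icc a b) :=
    integrableOn_inner_right hr continuous_const
  have e : ∫ t in Icc a b, inner ℝ (r t) (mean a b p) = inner ℝ (mean a b p) (∫ t in Icc a b, r t) := by
    rw [← integral_inner hr]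
    simp only [real_inner_comm]
  rw [integral_sub (integrableOn_inner_right hr hp) h1,
    integral_sub (integrableOn_inner_right hr hp) h2, e,
    integral_inner (integrableOn_of_continuous hp)]
  simp only [mean, real_inner_smul_left, real_inner_smul_right, real_inner_comm]

/-- The lemma of du Bois-Reymond. -/
theorem exists_ae_eq_const_add_prim (hab : a < b) {q h : ℝ → Vec N} (hq : IntegrableOn q (Icc a b))
    (hh : IntegrableOn h (Icc a b))
    (hweak : ∀ p, IsPolyCurve p →
      (∫ t in Icc a b, inner ℝ (h t) (prim a (fun t => p t - mean a b p) t)) +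
        ∫ t in Icc a b, inner ℝ (q t) (p t - mean a b p) = 0) :
    ∃ c, ∀ᵐ t ∂(volume.restrict (Icc a b)), q t = c + prim a h t := by
  have hP := absolutelyContinuousOnInterval_prim hab.le hh
  have hPc : ContinuousOn (prim a h) (Icc a b) := by
    simpa [uIcc_of_le hab.le] using hP.continuousOn
  have hPi : IntegrableOn (prim a h) (Icc a b) := hPc.integrableOn_compact isCompact_Icc
  have hr : IntegrableOn (fun t => q t - prim a h t) (Icc a b) := hq.sub hPi
  refine ⟨mean a b fun t => q t - prim a h t, ?_⟩
  -- Integration by parts turns the term with `h` into one with its primitive, so the weak equation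
  -- says that q − prim h minus its mean is orthogonal to every polynomial curve.
  have h0 := ae_eq_zero_of_integral_inner_polyCurve (hr.sub (integrable_const
    (mean a b fun t => q t - prim a h t))) fun p hp => by
      set z : ℝ → Vec N := fun t => p t - mean a b p with hz
      have hzc : Continuous z := hp.continuous.sub continuous_const
      have hzb : prim a z b = 0 := by
        obtain ⟨m, hm⟩ := hp.sub_mean_mem_galerkinSpace hab
        exact prim_eq_zero_of_mem_galerkinSpace hab hm
      have h1 := integral_inner_deriv_eq_neg hab.le
        (absolutelyContinuousOnInterval_prim hab.le (integrableOn_of_continuous hzc)) hP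
        (prim_self z) hzb
      have h2 : ∫ t in Icc a b, inner ℝ (deriv (prim a h) t) (prim a z t) =
          ∫ t in Icc a b, inner ℝ (h t) (prim a z t) := by
        refine integral_congr_ae ?_
        filter_upwards [ae_hasDerivAt_prim hab.le hh] with t ht
        rw [ht.deriv]
      rw [deriv_prim hzc, h2] at h1
      refine (integral_inner_sub_mean hr hp.continuous).trans ?_
      simp only [inner_sub_left (𝕜 := ℝ) (q _)]
      rw [integral_sub (integrableOn_inner_right hq hzc) (integrableOn_inner_right hPi hzc)]
      have h3 := hweak p hp
      change _ - ∫ t in Icc a b, inner ℝ (prim a h t) (z t) = 0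
      rw [h1]
      linarith
  filter_upwards [h0] with t ht
  simp only [Pi.sub_apply] at ht
  rw [sub_eq_zero] at ht
  rw [← ht, sub_add_cancel]

theorem gradient_lagrangian_velocity {t : ℝ} {x v p : Vec N} (h : HasGradientAt (F t x) p v) :
    gradient (fun v => lagrangian F V f t x v) v = p := by
  refine HasGradientAt.gradient ?_
  rw [hasGradientAt_iff_hasFDerivAt] at h ⊢
  exact (h.add_const (V t x)).add_const _

theorem gradient_lagrangian_position {t : ℝ} {x v p q : Vec N}
    (hp : HasGradientAt (fun y => F t y v) p x) (hq : HasGradientAt (V t) q x) :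
    gradient (fun x => lagrangian F V f t x v) x = p + (q + f t) := by
  refine HasGradientAt.gradient ?_
  rw [hasGradientAt_iff_hasFDerivAt] at hp hq ⊢
  refine ((hp.add hq).add (innerSL ℝ (f t)).hasFDerivAt).congr_fderiv ?_
  ext z
  simp [add_assoc]

/-- Critical curves solve the Euler–Lagrange equation. -/
theorem IsKinetic.isSolution (hF : IsKinetic a b G Λ F Fx Fv) (hG : Continuous G) (hab : a < b)
    (hVx : Continuous fun p : ℝ × Vec N => Vx p.1 p.2)
    (hVd : ∀ t x, HasGradientAt (V t) (Vx t x) x) (hf : IntegrableOn f (Icc a b)) {u : ℝ → Vec N}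
    (hu : Continuous u) (huAC : AbsolutelyContinuousOnInterval u a b) (hua : u a = 0)
    (hub : u b = 0) (hGu : IntegrableOn (fun t => G (deriv u t)) (Icc a b))
    (hweak : ∀ p, IsPolyCurve p → dkin a b Fx Fv u (deriv u) (prim a fun t => p t - mean a b p)
        (fun t => p t - mean a b p) + dpot a b Vx f u (prim a fun t => p t - mean a b p) = 0) :
    IsSolutionELT G a b (lagrangian F V f) u := by
  have hw : Measurable (deriv u) := measurable_deriv u
  have hX := hF.integrableOn_gradX hu hw hGu
  have hV := hF.integrableOn_gradV hu hw hGu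
  have hVxu : Continuous fun t => Vx t (u t) := hVx.comp (continuous_id.prodMk hu)
  have hVf : IntegrableOn (fun t => Vx t (u t) + f t) (Icc a b) :=
    (integrableOn_of_continuous hVxu).add hf
  have hh : IntegrableOn (fun t => Fx t (u t) (deriv u t) + (Vx t (u t) + f t)) (Icc a b) :=
    hX.add hVf
  obtain ⟨c, hc⟩ := exists_ae_eq_const_add_prim hab hV hh fun p hp => by
    have hz : Continuous fun t => p t - mean a b p := hp.continuous.sub continuous_const
    have h1 := hweak p hp
    rw [dkin, dpot, integral_add (integrableOn_inner_right hX (continuous_prim hz))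
      (integrableOn_inner_right hV hz)] at h1
    simp only [inner_add_left (𝕜 := ℝ) (Fx _ _ _)]
    rw [integral_add (integrableOn_inner_right hX (continuous_prim hz))
      (integrableOn_inner_right hVf (continuous_prim hz))]
    linarith
  refine ⟨⟨⟨huAC, memOrlicz_of_continuous hG hu, hw.aestronglyMeasurable, hGu⟩, hua, hub⟩,
    fun t => c + prim a (fun t => Fx t (u t) (deriv u t) + (Vx t (u t) + f t)) t,
    (contDiffOn_const.absolutelyContinuousOnInterval).fun_add
      (absolutelyContinuousOnInterval_prim hab.le hh), ?_, ?_⟩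
  · filter_upwards [hc] with t ht
    rw [gradient_lagrangian_velocity (hF.hasGradV t (u t) (deriv u t)), ht]
  · filter_upwards [ae_hasDerivAt_prim hab.le hh] with t ht
    rw [gradient_lagrangian_position (hF.hasGradX t (u t) (deriv u t)) (hVd t (u t))]
    exact ht.const_add c

/-- A curve of positive energy is not identically zero. -/
theorem IsKinetic.exists_ne_zero (hF : IsKinetic a b G Λ F Fx Fv)
    (hV2 : (∫ t in Icc a b, V t 0) = 0) {u : ℝ → Vec N}
    (hpos : 0 < kin a b F u (deriv u) + pot a b V f u) : ∃ t ∈ Icc a b, u t ≠ 0 := by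
  by_contra! h
  have hd : ∀ t ∈ Ioo a b, deriv u t = 0 := fun t ht => by
    have h1 : u =ᶠ[𝓝 t] fun _ => 0 := by
      filter_upwards [Icc_mem_nhds ht.1 ht.2] with s hs using h s hs
    rw [h1.deriv_eq, deriv_const]
  have h1 : kin a b F u (deriv u) = 0 := by
    -- The end points are dropped: `u` is not known outside `[a, b]`, so its derivative there is
    -- undetermined.
    rw [kin, integral_Icc_eq_integral_Ioo, setIntegral_congr_fun (g := fun _ => 0) measurableSet_Ioo,
      integral_zero]
    intro t ht
    simp only [hd t ht, hF.zero]
  have h2 : pot a b V f u = 0 := by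
    rw [pot, ← hV2]
    refine setIntegral_congr_fun measurableSet_Icc fun t ht => ?_
    simp only [h t ht, inner_zero_right, add_zero]
  linarith

end

/-! ### Lagrangians agreeing on the interval. -/

section

variable {N : ℕ} {a b : ℝ} {G : Vec N → ℝ}

/-- The equation involves gradients in `x` and `v` only, so agreement at almost every fixed time
suffices. This returns from the clamped Lagrangian to the original one. -/
theorem IsSolutionELT.congr {L L' : ℝ → Vec N → Vec N → ℝ} {u : ℝ → Vec N}
    (h : IsSolutionELT G a b L u) (hL : ∀ t ∈ Icc a b, L t = L' t) : IsSolutionELT G a b L' u := by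
  obtain ⟨hu, p, hp, h1, h2⟩ := h
  refine ⟨hu, p, hp, ?_, ?_⟩
  · filter_upwards [h1, ae_restrict_mem measurableSet_Icc] with t ht hmem
    rwa [← hL t hmem]
  · filter_upwards [h2, ae_restrict_mem measurableSet_Icc] with t ht hmem
    rwa [← hL t hmem]

end

end OrliczELT

end

/-! ### The existence theorem. -/

theorem theoremA
    {N : ℕ} (hN : 1 ≤ N) {a b : ℝ} (hab : a < b)
    -- the G-function
    (G : EuclideanSpace ℝ (Fin N) → ℝ) (hG : OrliczELT.IsGFunction G)
    (hΔ : OrliczELT.DeltaTwoAtInfinity G) (hnab : OrliczELT.NablaTwoAtInfinity G)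
    -- the data of the Lagrangian
    (F : ℝ → EuclideanSpace ℝ (Fin N) → EuclideanSpace ℝ (Fin N) → ℝ)
    (V : ℝ → EuclideanSpace ℝ (Fin N) → ℝ)
    (f : ℝ → EuclideanSpace ℝ (Fin N))
    (hF : ContDiffOn ℝ 1
      (fun p : ℝ × EuclideanSpace ℝ (Fin N) × EuclideanSpace ℝ (Fin N) => F p.1 p.2.1 p.2.2)
      (Icc a b ×ˢ univ))
    (hV : ContDiffOn ℝ 1 (fun p : ℝ × EuclideanSpace ℝ (Fin N) => V p.1 p.2) (Icc a b ×ˢ univ))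
    -- convexity of F in v
    (hF1 : ∀ t ∈ Icc a b, ∀ x, ConvexOn ℝ univ (F t x))
    -- growth of F and its derivatives
    (hF2 : ∃ (A : ℝ → ℝ) (B : ℝ → ℝ), ContinuousOn A (Ici 0) ∧ (∀ s, 0 ≤ s → 0 ≤ A s) ∧
      IntegrableOn B (Icc a b) ∧ (∀ t ∈ Icc a b, 0 ≤ B t) ∧
      ∀ t ∈ Icc a b, ∀ x v,
        |F t x v| ≤ A ‖x‖ * (B t + G v) ∧
        ‖gradient (fun y => F t y v) x‖ ≤ A ‖x‖ * (B t + G v) ∧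
        OrliczELT.conjugate G (gradient (F t x) v) ≤
          A ‖x‖ * (B t + OrliczELT.conjugate G (gradient G v)))
    -- Ambrosetti–Rabinowitz type condition on F
    (θF : ℝ) (hθF : 0 < θF)
    (hF3 : ∀ t ∈ Icc a b, ∀ x v,
      inner ℝ (gradient (fun y => F t y v) x) x + inner ℝ (gradient (F t x) v) v ≤ θF * F t x v)
    -- ellipticity
    (Λ : ℝ) (hΛ : 0 < Λ) (hF4 : ∀ t ∈ Icc a b, ∀ x v, Λ * G v ≤ F t x v)
    -- F vanishes at v = 0
    (hF5 : ∀ t ∈ Icc a b, ∀ x, F t x 0 = 0)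
    -- Ambrosetti–Rabinowitz type condition on V
    (θV r₀ : ℝ) (hθV : 1 < θV) (hθ : θF < θV) (hr₀ : 0 < r₀)
    (hV1 : ∀ t ∈ Icc a b, ∀ x, r₀ ≤ ‖x‖ → inner ℝ (gradient (V t) x) x ≤ θV * V t x)
    -- normalization of V
    (hV2 : (∫ t in Icc a b, V t 0) = 0)
    -- bound of V from below near zero
    (ρ₀ : ℝ) (hρ₀ : 0 < ρ₀) (g : ℝ → ℝ) (hg : IntegrableOn g (Icc a b))
    (hV3 : ∀ t ∈ Icc a b, ∀ x, ‖x‖ ≤ ρ₀ → -g t ≤ V t x)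
    -- negativity of V for large arguments
    (hV4 : ∀ t ∈ Icc a b, ∀ x, r₀ ≤ ‖x‖ → V t x < 0)
    -- the forcing term
    (hf : OrliczELT.MemOrlicz (OrliczELT.conjugate G) a b f)
    -- the embedding constant and the mountain pass condition
    (C : ℝ) (hC : OrliczELT.IsEmbeddingConstant G a b C) (hCρ : C ≤ ρ₀)
    (hA : (∫ t in Icc a b, g t) <
      (Λ - 2 * (b - a) * OrliczELT.luxNorm (OrliczELT.conjugate G) a b f) * (ρ₀ / C)) :
    ∃ u : ℝ → EuclideanSpace ℝ (Fin N),
      OrliczELT.IsSolutionELT G a b (OrliczELT.lagrangian F V f) u ∧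
        ∃ t ∈ Icc a b, u t ≠ 0 := by

  open OrliczELT in
  obtain ⟨A, B, hAc, -, hB, hB0, hF2⟩ := hF2
  have hGg := hG.isGrowthFunction hΔ
  have hFk := isKinetic_clamped hab hGg hF hF1 hAc hB hB0
    (fun t ht x v => ⟨(hF2 t ht x v).1, (hF2 t ht x v).2.1⟩) hΛ hF4 hF5
  have hVc := continuous_clamped hab.le hV
  obtain ⟨hVx, hVd⟩ := exists_clamped_gradient hab hV
  have hmem := clamp_mem hab.le
  have hfi := hG.integrableOn_of_memOrlicz_conjugate hf
  have hC0 := hC.pos hG.contDiff.continuous hab hN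
  -- The ridge radius R = ρ₀/C is the largest for which the embedding keeps the curves in the ball
  -- of (V3).
  have hR : 1 ≤ ρ₀ / C := (one_le_div hC0).2 hCρ
  have hCR : C * (ρ₀ / C) = ρ₀ := mul_div_cancel₀ ρ₀ hC0.ne'
  obtain ⟨e, he, heR, he0⟩ := hFk.exists_energy_nonpos hGg hab hN hVc hVd hfi hθ hθV hr₀
    (fun t _ => hF3 _ (hmem t)) (fun t _ => hV1 _ (hmem t)) (fun t _ => hV4 _ (hmem t))
    (one_pos.trans_le hR)
  obtain ⟨κ, hκ⟩ := hFk.exists_energy_smul_le hVc hVx hVd hfi (continuous_of_mem_galerkinSpace he)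
  have hV0 : ∫ t in Icc a b, V (clamp a b t) 0 = 0 := by
    rw [← hV2]
    exact setIntegral_congr_fun measurableSet_Icc fun t ht => by simp only [clamp_eq ht]
  have hprim : prim a (fun _ => (0 : Vec N)) = fun _ => 0 := by
    funext t
    simp [prim]
  have h0 : energy a b (fun t => F (clamp a b t)) (fun t => V (clamp a b t)) f
      (fun _ => (0 : Vec N)) ≤ 0 := by
    rw [energy, hprim, kin, pot]
    simp only [hFk.zero, integral_zero, inner_zero_right, add_zero, hV0, le_refl]
  -- The hypothesis on ∫g says precisely that the lower bound on the ridge is positive; this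
  -- difference is the mountain pass level γ₀.
  have hγ := sub_pos.2 hA
  obtain ⟨u, hu, huAC, hua, hub, hGu, hlev, hweak⟩ := hFk.exists_critical hGg hG.isConvexIntegrand
    hab hVc hVx hVd hfi hθ hθV (fun t _ => hF3 _ (hmem t)) (fun t _ => hV1 _ (hmem t)) hγ
    (fun w hw hb hwR => hFk.le_energy_of_modular_eq_one hG hab hVc hf hC hC0 hR hg
      (fun t ht x hx => by
        rw [clamp_eq ht]
        exact hV3 t ht x (hx.trans_eq hCR)) hw hb hwR) h0 he heR he0 hκ
  refine ⟨u, ?_, hFk.exists_ne_zero hV0 (hγ.trans_le hlev)⟩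
  refine (hFk.isSolution hG.contDiff.continuous hab hVx hVd hfi hu huAC hua hub hGu hweak).congr
    fun t ht => ?_
  funext x v
  simp only [lagrangian, clamp_eq ht]
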